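/- Let $n\ge 1$, and write points of $\mathbb R^{n+1}$ as $X=(x,y)$, $x=(x',x_n)\in\mathbb R^n$, $y\in\mathbb R$. Let $B_r\subset\mathbb R^n$ be the ball of radius $r$ centred at $0$, $B_r^+=B_r\cap\{x_n>0\}$, $T_r=B_r\cap\{x_n=0\}$, $Q_r=B_r\times(0,r)$, $Q_r^+=B_r^+\times(0,r)$. A weight $\mu\in A_2(\mathbb R)$ is a non-negative, locally integrable function on $\mathbb R$, positive almost everywhere, with $[\mu]_{A_2}=\sup_{I}\left(\frac1{|I|}\int_I\mu\right)\left(\frac1{|I|}\int_I\mu^{-1}\right)<\infty$, the supremum being over all bounded open intervals $I$. Put $\hat\mu(E)=\int_E\mu(y)\,dx\,dy$. For $U\subset\mathbb R^{n+1}$ open, $W^{1,2}(U,\mu)$ is the space of functions $u$ on $U$ having a weak gradient $\nabla u$ with $\int_U(|u|^2+|\nabla u|^2)\,\mu(y)\,dX<\infty$. For $\Omega=B_R$ or $B_R^+$, let $\overset{*}{W}{}^{1,2}(\Omega\times(0,R),\mu)$ be the closure in $W^{1,2}(\Omega\times(0,R),\mu)$ of the functions $\phi\in C^\infty(\overline{\Omega\times(0,R)})$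 that vanish on $(\partial\Omega\times(0,R))\cup(\Omega\times\{R\})$. Let $\Lambda,C_0,M_0>0$ and $\theta\in(0,1)$. There is a constant $C=C(n,\Lambda,C_0,M_0,\theta)>0$ such that the following two statements hold for every $\tau\in(0,1)$ and every $\mu\in A_2(\mathbb R)$ with $[\mu]_{A_2}\le M_0$ and $$\int_0^{\tau y}\mu(s)\,ds\le C_0\,\tau\,\mu(\tau y)\qquad\text{for a.e. } y\in(0,1).$$ (a) Let $\mathbb A_0(y)=\mu(y)\begin{bmatrix}\mathbb B_0(y)&0\\0&b_0(y)\end{bmatrix}$ be a symmetric $(n+1)\times(n+1)$ matrix, measurable in $y$, where $\mathbb B_0(y)$ is $n\times n$ and $b_0(y)$ is scalar, with $$\Lambda^{-1}\mu(y)|\xi|^2\le\langle\mathbb A_0(y)\xi,\xi\rangle\le\Lambda\mu(y)|\xi|^2\qquad\text{for all }\xi\in\mathbb R^{n+1}\text{ and a.e. } y\in(0,\tau).$$ Let $v\in W^{1,2}(Q_\tau,\mu)$ be a weak solution of $\operatorname{div}[\mathbb A_0(y)\nabla v]=0$ in $Q_\tau$ with $\lim_{y\to0^+}\langle\mathbb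 A_0(y)\nabla v(x,y),e_{n+1}\rangle=0$ on $B_\tau$, that is, $\int_{Q_\tau}\langle\mathbb A_0(y)\nabla v,\nabla\psi\rangle\,dX=0$ for all $\psi\in\overset{*}{W}{}^{1,2}(Q_\tau,\mu)$. Then $$\|\nabla v\|_{L^\infty(Q_{\theta\tau})}\le C\left[\frac1{\hat\mu(Q_\tau)}\int_{Q_\tau}|\nabla v|^2\,\mu(y)\,dX\right]^{1/2}.$$ (b) Let $\tilde{\mathbb A}_0(y)=\mu(y)\begin{bmatrix}\tilde{\mathbb B}_0&0\\0&1\end{bmatrix}$, where $\tilde{\mathbb B}_0$ is a constant symmetric $n\times n$ matrix, satisfy the same two-sided bound as $\mathbb A_0$ in (a). Let $v\in W^{1,2}(Q_\tau^+,\mu)$ be a weak solution of $\operatorname{div}[\tilde{\mathbb A}_0(y)\nabla v]=0$ in $Q_\tau^+$ with $v=0$ on $T_\tau\times(0,\tau)$ and $\lim_{y\to0^+}\langle\tilde{\mathbb A}_0(y)\nabla v(x,y),e_{n+1}\rangle=0$ on $B_\tau^+$, that is, $v$ lies in the closure in $W^{1,2}(Q_\tau^+,\mu)$ of $\{\phi\in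 C^\infty(\overline{Q_\tau^+}):\phi=0\text{ on }T_\tau\times(0,\tau)\}$ and $\int_{Q_\tau^+}\langle\tilde{\mathbb A}_0(y)\nabla v,\nabla\psi\rangle\,dX=0$ for all $\psi\in\overset{*}{W}{}^{1,2}(Q_\tau^+,\mu)$. Then $$\|\nabla v\|_{L^\infty(Q^+_{\theta\tau})}\le C\left[\frac1{\hat\mu(Q_\tau)}\int_{Q_\tau^+}|\nabla v|^2\,\mu(y)\,dX\right]^{1/2}.$$ -/

import Mathlib

open MeasureTheory Set Filter Topology
open scoped ContDiff Matrix

noncomputable section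

/-- The `A₂` constant of a weight on the real line,
`[μ]_{A₂} = sup_B (⨍_B μ) (⨍_B μ⁻¹)`, computed in `[0, ∞]` (with `0⁻¹ = ∞`). -/
def a2Const (μ : ℝ → ℝ) : ENNReal :=
  ⨆ (c : ℝ) (r : ℝ) (_ : 0 < r),
    laverage (volume.restrict (Metric.ball c r)) (fun y => ENNReal.ofReal (μ y)) *
      laverage (volume.restrict (Metric.ball c r)) (fun y => (ENNReal.ofReal (μ y))⁻¹)

/-- The Muckenhoupt class `A₂(ℝ)`. The clause `pos_ae` only rules out the weight that vanishes
almost everywhere (for which the product `0 * ∞` above would be read as `0`). -/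
structure IsA2Weight (μ : ℝ → ℝ) : Prop where
  nonneg : ∀ y, 0 ≤ μ y
  locallyIntegrable : LocallyIntegrable μ volume
  pos_ae : ∀ᵐ y, 0 < μ y
  const_lt_top : a2Const μ < ⊤

/-- Points `X = (x, y)` of `ℝⁿ⁺¹ = ℝⁿ × ℝ`. -/
abbrev Pt (n : ℕ) : Type := EuclideanSpace ℝ (Fin n) × ℝ

/-- Vectors `ξ = (ξ_x, ξ_y)` of `ℝⁿ⁺¹` with the Euclidean norm: the coordinates `Sum.inl i` are the
`x`-coordinates, the coordinate `Sum.inr ()` is the `y`-coordinate. -/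
abbrev Vec (n : ℕ) : Type := EuclideanSpace ℝ (Fin n ⊕ Unit)

/-- The classical gradient `(∇ₓ φ, ∂_y φ)`. -/
def classicalGrad {n : ℕ} (φ : Pt n → ℝ) (X : Pt n) : Vec n :=
  WithLp.toLp 2 (Sum.elim
    (fun i => fderiv ℝ φ X (EuclideanSpace.single i (1 : ℝ), (0 : ℝ)))
    (fun _ => fderiv ℝ φ X (0, (1 : ℝ))))

/-- The cylinder `Ω_R = Ω × (0, R)`. -/
def cyl {n : ℕ} (Ω : Set (EuclideanSpace ℝ (Fin n))) (R : ℝ) : Set (Pt n) :=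
  Ω ×ˢ Ioo 0 R

/-- The ball `B_r` of `ℝⁿ` centred at the origin. -/
def baseBall (n : ℕ) (r : ℝ) : Set (EuclideanSpace ℝ (Fin n)) := Metric.ball 0 r

/-- The index of the last coordinate `x_n` of `x = (x', x_n) ∈ ℝⁿ`, `n ≥ 1`. -/
def lastIdx (n : ℕ) [NeZero n] : Fin n := ⟨n - 1, Nat.sub_lt (NeZero.pos n) Nat.one_pos⟩

/-- The half ball `B_r⁺ = {x ∈ B_r : x_n > 0}`. -/
def halfBall (n : ℕ) [NeZero n] (r : ℝ) : Set (EuclideanSpace ℝ (Fin n)) :=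
  {x | x ∈ baseBall n r ∧ 0 < x (lastIdx n)}

/-- The flat part `T_r = {x ∈ B_r : x_n = 0}` of the boundary of `B_r⁺`. -/
def flatPart (n : ℕ) [NeZero n] (r : ℝ) : Set (EuclideanSpace ℝ (Fin n)) :=
  {x | x ∈ baseBall n r ∧ x (lastIdx n) = 0}

/-- The measure `μ(y) dx dy` on `U ⊆ ℝⁿ⁺¹`. -/
def weightedMeasure {n : ℕ} (μ : ℝ → ℝ) (U : Set (Pt n)) : Measure (Pt n) :=
  (volume.restrict U).withDensity (fun X => ENNReal.ofReal (μ X.2))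

/-- `μ̂(U) = ∫_U μ(y) dx dy`. -/
def muHat {n : ℕ} (μ : ℝ → ℝ) (U : Set (Pt n)) : ℝ := ∫ X in U, μ X.2

/-- `G` is the weak (distributional) gradient of `u` in `U`. -/
structure HasWeakGrad {n : ℕ} (U : Set (Pt n)) (u : Pt n → ℝ) (G : Pt n → Vec n) : Prop where
  locallyIntegrableOn : LocallyIntegrableOn u U volume
  grad_locallyIntegrableOn : LocallyIntegrableOn G U volume
  integral_eq : ∀ φ : Pt n → ℝ, ContDiff ℝ ∞ φ → HasCompactSupport φ → tsupport φ ⊆ U →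
    ∀ i, ∫ X in U, u X * classicalGrad φ X i = -∫ X in U, G X i * φ X

/-- `u ∈ W^{1,2}(U, μ)`, with weak gradient `∇u = G`. -/
structure MemW12 {n : ℕ} (U : Set (Pt n)) (μ : ℝ → ℝ) (u : Pt n → ℝ) (G : Pt n → Vec n) :
    Prop where
  hasWeakGrad : HasWeakGrad U u G
  memLp : MemLp u 2 (weightedMeasure μ U)
  grad_memLp : MemLp G 2 (weightedMeasure μ U)

/-- `u ∈ W^{1,2}(U, μ)`, with weak gradient `G`, lies in the closure in `W^{1,2}(U, μ)` of the
class `S` of smooth functions. -/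
def MemW12Closure {n : ℕ} (U : Set (Pt n)) (μ : ℝ → ℝ) (S : Set (Pt n → ℝ))
    (u : Pt n → ℝ) (G : Pt n → Vec n) : Prop :=
  MemW12 U μ u G ∧ ∃ φ : ℕ → Pt n → ℝ, (∀ k, φ k ∈ S) ∧
    Tendsto (fun k => eLpNorm (fun X => φ k X - u X) 2 (weightedMeasure μ U)
      + eLpNorm (fun X => classicalGrad (φ k) X - G X) 2 (weightedMeasure μ U)) atTop (𝓝 0)

/-- Smooth functions vanishing on the lateral boundary `∂Ω × (0, R)` and on the top `Ω × {R}`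
(no condition on the bottom `Ω × {0}`). -/
def starTest {n : ℕ} (Ω : Set (EuclideanSpace ℝ (Fin n))) (R : ℝ) : Set (Pt n → ℝ) :=
  {φ | ContDiff ℝ ∞ φ ∧ ∀ X ∈ (frontier Ω ×ˢ Ioo 0 R) ∪ (Ω ×ˢ {R}), φ X = 0}

/-- Smooth functions vanishing on `T_R × (0, R)`. -/
def flatZero (n : ℕ) [NeZero n] (R : ℝ) : Set (Pt n → ℝ) :=
  {φ | ContDiff ℝ ∞ φ ∧ ∀ X ∈ flatPart n R ×ˢ Ioo 0 R, φ X = 0}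

/-- The weak formulation `∫_{Ω_R} ⟨A(y) ∇u, ∇ψ⟩ dX = 0` for all `ψ` in the closure of `starTest Ω R`
in `W^{1,2}(Ω_R, μ)`; here `G = ∇u` and `H = ∇ψ`. -/
def WeakEq {n : ℕ} (Ω : Set (EuclideanSpace ℝ (Fin n))) (R : ℝ) (μ : ℝ → ℝ)
    (A : ℝ → Matrix (Fin n ⊕ Unit) (Fin n ⊕ Unit) ℝ) (G : Pt n → Vec n) : Prop :=
  ∀ (ψ : Pt n → ℝ) (H : Pt n → Vec n), MemW12Closure (cyl Ω R) μ (starTest Ω R) ψ H →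
    ∫ X in cyl Ω R, (A X.2 *ᵥ (G X).ofLp) ⬝ᵥ (H X).ofLp = 0

/-- `v`, with weak gradient `G`, is a weak solution in `W^{1,2}(Q_R, μ)` of `div[A(y) ∇v] = 0` in
`Q_R = B_R × (0, R)` with zero conormal derivative on `B_R × {0}`. -/
def IsWeakSolutionQ {n : ℕ} (R : ℝ) (μ : ℝ → ℝ)
    (A : ℝ → Matrix (Fin n ⊕ Unit) (Fin n ⊕ Unit) ℝ) (v : Pt n → ℝ) (G : Pt n → Vec n) : Prop :=
  MemW12 (cyl (baseBall n R) R) μ v G ∧ WeakEq (baseBall n R) R μ A G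

/-- `v`, with weak gradient `G`, is a weak solution in `W^{1,2}(Q_R⁺, μ)` of `div[A(y) ∇v] = 0` in
`Q_R⁺ = B_R⁺ × (0, R)`, with `v = 0` on `T_R × (0, R)` and zero conormal derivative on
`B_R⁺ × {0}`. -/
def IsWeakSolutionHalfQ {n : ℕ} [NeZero n] (R : ℝ) (μ : ℝ → ℝ)
    (A : ℝ → Matrix (Fin n ⊕ Unit) (Fin n ⊕ Unit) ℝ) (v : Pt n → ℝ) (G : Pt n → Vec n) : Prop :=
  MemW12Closure (cyl (halfBall n R) R) μ (flatZero n R) v G ∧ WeakEq (halfBall n R) R μ A G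

/-- The coefficient matrix `μ(y) diag(B(y), b(y))`. -/
def blockCoeff {n : ℕ} (μ : ℝ → ℝ) (B : ℝ → Matrix (Fin n) (Fin n) ℝ) (b : ℝ → ℝ) (y : ℝ) :
    Matrix (Fin n ⊕ Unit) (Fin n ⊕ Unit) ℝ :=
  μ y • Matrix.fromBlocks (B y) 0 0 (Matrix.diagonal fun _ => b y)

/-- `A(y)` is measurable and symmetric for `y ∈ (0, τ)` and
`Λ⁻¹ μ(y) |ξ|² ≤ ⟨A(y) ξ, ξ⟩ ≤ Λ μ(y) |ξ|²` for all `ξ` and almost every `y ∈ (0, τ)`. -/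
structure IsDegElliptic {n : ℕ} (τ Λ : ℝ) (μ : ℝ → ℝ)
    (A : ℝ → Matrix (Fin n ⊕ Unit) (Fin n ⊕ Unit) ℝ) : Prop where
  aemeasurable : ∀ i j, AEMeasurable (fun y => A y i j) (volume.restrict (Ioo 0 τ))
  isSymm : ∀ᵐ y ∂(volume.restrict (Ioo 0 τ)), (A y).IsSymm
  elliptic : ∀ᵐ y ∂(volume.restrict (Ioo 0 τ)), ∀ ξ : Vec n,
    Λ⁻¹ * μ y * ‖ξ‖ ^ 2 ≤ (A y *ᵥ ξ.ofLp) ⬝ᵥ ξ.ofLp ∧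
      (A y *ᵥ ξ.ofLp) ⬝ᵥ ξ.ofLp ≤ Λ * μ y * ‖ξ‖ ^ 2

/-- The growth condition `∫₀^{τy} μ ≤ C₀ τ μ(τy)` for almost every `y ∈ (0, 1)`. -/
def GrowthCond (C₀ τ : ℝ) (μ : ℝ → ℝ) : Prop :=
  ∀ᵐ y ∂(volume.restrict (Ioo (0 : ℝ) 1)), ∫ s in Ioo 0 (τ * y), μ s ≤ C₀ * τ * μ (τ * y)

end

/-! The coefficients depend on y alone, so operations on the x-variables turn solutions into
solutions. The proof uses this by mollifying in x only. For w = v * k (`convX`) the function w(·, y)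
is smooth, its x-derivatives are again mollifications of v, by derivatives of k, and at each fixed x
the equation is an ordinary one in y: since the flux vanishes at y = 0, d ∂_y w = -∫₀^y Σ a_ij ∂_ij
w (`SliceSol.flux_eq`). Kernels have no prescribed sign or mass, so an estimate proved for every
kernel applies to w and to all its x-derivatives at once.

Tangential derivatives. Testing with a cutoff squared times w gives a Caccioppoli inequality
(`SliceSol.exists_caccioppoli`). Its iteration over shrinking cylinders bounds all x-derivatives of
w and of ∂_y w in weighted L² by the energy of w. As μ⁻¹ is integrable, Cauchy–Schwarz converts this
into L¹ bounds. An elementary Sobolev inequality in x, using mixed derivatives in L¹, and the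
fundamental theorem of calculus in y then bound w pointwise by (∫ μ⁻¹ · energy)^(1/2)
(`SliceSol.exists_enorm_convX_le`). With ∂_i w and ∂_ij w in place of w, this bounds the first and
second tangential derivatives by the energy of ∇_x v, because ∂_i w is the mollification of ∂_i v
and averaging does not increase energy.

Vertical derivative. The formula for the flux gives |d ∂_y w| ≤ C sup |D_x² w| ∫₀^y μ. The growth
condition bounds the last integral by C₀ μ(y), and d is comparable to μ(y), so ∂_y w is bounded. The
bounds do not involve the mollification parameter, hence pass to ∇v
(`SliceSol.exists_gradient_bound`).

Scaling. A homothety of ratio τ reduces to height one. There the A₂ condition bounds ∫ μ⁻¹ by a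
constant over ∫ μ, which is what turns ∫ μ⁻¹ times the energy into the average of |∇v|²
(`LocalSol.exists_gradient_bound`). Applying the result in balls around each point gives (a).

Flat boundary. In (b) put c = B e_n / B_nn. The oblique reflection x ↦ x - 2 x_n c fixes {x_n = 0}
and leaves the constant quadratic form invariant (`form_reflVec`), so the odd extension of v is a
weak solution in full balls centred on the flat boundary (`IsWeakSolutionHalfQ.localSol_reflect`).
The interior estimate applies to it near the flat part and to v itself away from it. -/

open scoped ENNReal

/-! ### One-dimensional weak derivatives on `(0, 1)` -/

/-- Fubini on the triangle `0 < t < y < 1`. -/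
theorem integral_mul_primitive_swap {f h : ℝ → ℝ} (hf : IntegrableOn f (Ioo 0 1))
    (hh : IntegrableOn h (Ioo 0 1)) :
    ∫ y in Ioo (0 : ℝ) 1, f y * ∫ t in Ioo 0 y, h t =
      ∫ t in Ioo (0 : ℝ) 1, h t * ∫ y in Ioo t 1, f y := by
  have hm : MeasurableSet {z : ℝ × ℝ | z.2 < z.1} := measurableSet_lt measurable_snd measurable_fst
  have hI : Integrable (fun z : ℝ × ℝ => {z : ℝ × ℝ | z.2 < z.1}.indicator
      (fun z => f z.1 * h z.2) z)
      ((volume.restrict (Ioo (0 : ℝ) 1)).prod (volume.restrict (Ioo (0 : ℝ) 1))) :=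
    (Integrable.mul_prod hf hh).indicator hm
  have hs := integral_integral_swap (f := fun y t => {z : ℝ × ℝ | z.2 < z.1}.indicator
      (fun z => f z.1 * h z.2) (y, t)) hI
  have h1 : ∀ y ∈ Ioo (0 : ℝ) 1, (∫ t in Ioo (0 : ℝ) 1, {z : ℝ × ℝ | z.2 < z.1}.indicator
      (fun z => f z.1 * h z.2) (y, t)) = f y * ∫ t in Ioo 0 y, h t := by
    intro y hy
    rw [← integral_const_mul, ← integral_indicator measurableSet_Ioo,
      ← integral_indicator measurableSet_Ioo]
    congr 1; ext t
    by_cases h0 : 0 < t <;> by_cases h2 : t < y <;> simp [indicator, h0, h2]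
    exact fun h3 => absurd (h2.trans hy.2) (not_lt.2 h3)
  have h2 : ∀ t ∈ Ioo (0 : ℝ) 1, (∫ y in Ioo (0 : ℝ) 1, {z : ℝ × ℝ | z.2 < z.1}.indicator
      (fun z => f z.1 * h z.2) (y, t)) = h t * ∫ y in Ioo t 1, f y := by
    intro t ht
    rw [← integral_const_mul, ← integral_indicator measurableSet_Ioo,
      ← integral_indicator measurableSet_Ioo]
    congr 1; ext y
    by_cases h0 : y < 1 <;> by_cases h2 : t < y <;> simp [indicator, h0, h2, mul_comm]
    exact fun h3 => absurd (ht.1.trans h2) (not_lt.2 h3)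
  rw [setIntegral_congr_fun measurableSet_Ioo h1, setIntegral_congr_fun measurableSet_Ioo h2] at hs
  exact hs

theorem integrableOn_Ioo_of_continuous {h : ℝ → ℝ} (hh : Continuous h) (a b : ℝ) :
    IntegrableOn h (Ioo a b) :=
  (hh.continuousOn.integrableOn_compact isCompact_Icc).mono_set Ioo_subset_Icc_self

theorem Continuous.bddOn_Icc {h : ℝ → ℝ} (hh : Continuous h) (a b : ℝ) :
    ∃ K, ∀ y ∈ Icc a b, |h y| ≤ K := by
  obtain ⟨K, hK⟩ := (isCompact_Icc (a := a) (b := b)).exists_bound_of_continuousOn hh.continuousOn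
  exact ⟨K, fun y hy => by simpa using hK y hy⟩

theorem MeasureTheory.IntegrableOn.mul_continuous_Ioo {f h : ℝ → ℝ}
    (hf : IntegrableOn f (Ioo 0 1)) (hh : Continuous h) :
    IntegrableOn (fun y => f y * h y) (Ioo 0 1) := by
  obtain ⟨K, hK⟩ := hh.bddOn_Icc 0 1
  refine Integrable.mul_bdd (c := K) hf hh.aestronglyMeasurable ?_
  filter_upwards [ae_restrict_mem measurableSet_Ioo] with y hy
  exact hK y (Ioo_subset_Icc_self hy)

theorem contDiff_primitive {h : ℝ → ℝ} (hh : ContDiff ℝ ∞ h) (a : ℝ) :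
    ContDiff ℝ ∞ (fun y => ∫ t in a..y, h t) := by
  have hd : deriv (fun y => ∫ t in a..y, h t) = h := by
    ext y; exact hh.continuous.deriv_integral h a y
  rw [contDiff_infty_iff_deriv, hd]
  exact ⟨fun y => (hh.continuous.integral_hasStrictDerivAt a y).hasDerivAt.differentiableAt, hh⟩

theorem integrableOn_primitive_right {f : ℝ → ℝ} (hf : IntegrableOn f (Ioo 0 1)) :
    IntegrableOn (fun t => ∫ y in Ioo t 1, f y) (Ioo 0 1) := by
  have hm : MeasurableSet {z : ℝ × ℝ | z.1 < z.2} := measurableSet_lt measurable_fst measurable_snd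
  have hI : Integrable (fun z : ℝ × ℝ => {z : ℝ × ℝ | z.1 < z.2}.indicator
      (fun z => (1 : ℝ) * f z.2) z)
      ((volume.restrict (Ioo (0 : ℝ) 1)).prod (volume.restrict (Ioo (0 : ℝ) 1))) :=
    (Integrable.mul_prod (integrable_const (1 : ℝ)) hf).indicator hm
  refine hI.integral_prod_left.congr ?_
  filter_upwards [ae_restrict_mem measurableSet_Ioo] with t ht
  rw [← integral_indicator measurableSet_Ioo, ← integral_indicator measurableSet_Ioo]
  congr 1; ext y
  by_cases h0 : y < 1 <;> by_cases h2 : t < y <;> simp [indicator, h0, h2]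
  exact fun h3 => absurd (ht.1.trans h2) (not_lt.2 h3)

theorem integrableOn_primitive_left {f : ℝ → ℝ} (hf : IntegrableOn f (Ioo 0 1)) :
    IntegrableOn (fun t => ∫ y in Ioo 0 t, f y) (Ioo 0 1) := by
  have hm : MeasurableSet {z : ℝ × ℝ | z.2 < z.1} := measurableSet_lt measurable_snd measurable_fst
  have hI : Integrable (fun z : ℝ × ℝ => {z : ℝ × ℝ | z.2 < z.1}.indicator
      (fun z => (1 : ℝ) * f z.2) z)
      ((volume.restrict (Ioo (0 : ℝ) 1)).prod (volume.restrict (Ioo (0 : ℝ) 1))) :=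
    (Integrable.mul_prod (integrable_const (1 : ℝ)) hf).indicator hm
  refine hI.integral_prod_left.congr ?_
  filter_upwards [ae_restrict_mem measurableSet_Ioo] with t ht
  rw [← integral_indicator measurableSet_Ioo, ← integral_indicator measurableSet_Ioo]
  congr 1; ext y
  by_cases h0 : 0 < y <;> by_cases h2 : y < t <;> simp [indicator, h0, h2]
  exact fun h3 => absurd (h2.trans ht.2) (not_lt.2 h3)

theorem ae_eq_zero_Ioo_of_tests {F : ℝ → ℝ} (hF : IntegrableOn F (Ioo 0 1))
    (h : ∀ ζ : ℝ → ℝ, ContDiff ℝ ∞ ζ → HasCompactSupport ζ → tsupport ζ ⊆ Ioo 0 1 →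
      ∫ y in Ioo (0 : ℝ) 1, F y * ζ y = 0) :
    ∀ᵐ y ∂(volume.restrict (Ioo (0 : ℝ) 1)), F y = 0 := by
  rw [ae_restrict_iff' measurableSet_Ioo]
  refine isOpen_Ioo.ae_eq_zero_of_integral_contDiff_smul_eq_zero hF.locallyIntegrableOn
    fun ζ h1 h2 h3 => ?_
  rw [← h ζ h1 h2 h3, ← integral_indicator measurableSet_Ioo]
  congr 1; ext y
  by_cases hy : y ∈ Ioo (0 : ℝ) 1
  · simp [hy, mul_comm]
  · simp [hy, image_eq_zero_of_notMem_tsupport fun hh => hy (h3 hh)]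

theorem exists_margin_of_tsupport_subset {h : ℝ → ℝ} (hc : HasCompactSupport h)
    (hs : tsupport h ⊆ Ioo 0 1) :
    ∃ δ > 0, δ < 1 ∧ (∀ y ≤ δ, h y = 0) ∧ ∀ y ≥ 1 - δ, h y = 0 := by
  rcases (tsupport h).eq_empty_or_nonempty with he | hne
  · refine ⟨1 / 2, by norm_num, by norm_num, fun y _ => ?_, fun y _ => ?_⟩ <;>
    exact image_eq_zero_of_notMem_tsupport (by simp [he])
  · obtain ⟨a, ha, hamin⟩ := hc.isCompact.exists_isLeast hne
    obtain ⟨b, hb, hbmax⟩ := hc.isCompact.exists_isGreatest hne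
    have ha' := hs ha
    have hb' := hs hb
    simp only [mem_Ioo] at ha' hb'
    refine ⟨min (a / 2) ((1 - b) / 2), by apply lt_min <;> linarith, ?_, fun y hy => ?_,
      fun y hy => ?_⟩
    · exact (min_le_left _ _).trans_lt (by linarith)
    · refine image_eq_zero_of_notMem_tsupport fun hh => ?_
      have := hamin hh
      have := min_le_left (a / 2) ((1 - b) / 2)
      linarith
    · refine image_eq_zero_of_notMem_tsupport fun hh => ?_
      have := hbmax hh
      have := min_le_right (a / 2) ((1 - b) / 2)
      linarith

/-- Test functions vanishing near the top see the flux `p` and its source `q`: then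
`p(y) = - ∫₀^y q`. -/
theorem eq_integral_of_weak_flux {p q : ℝ → ℝ} (hp : IntegrableOn p (Ioo 0 1))
    (hq : IntegrableOn q (Ioo 0 1))
    (h : ∀ ζ : ℝ → ℝ, ContDiff ℝ ∞ ζ → (∃ S < 1, ∀ y ≥ S, ζ y = 0) →
      ∫ y in Ioo (0 : ℝ) 1, p y * deriv ζ y = ∫ y in Ioo (0 : ℝ) 1, q y * ζ y) :
    ∀ᵐ y ∂(volume.restrict (Ioo (0 : ℝ) 1)), p y = -∫ s in Ioo 0 y, q s := by
  have key : ∀ᵐ y ∂(volume.restrict (Ioo (0 : ℝ) 1)), p y + ∫ s in Ioo 0 y, q s = 0 := by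
    refine ae_eq_zero_Ioo_of_tests (hp.add (integrableOn_primitive_left hq)) fun η h1 h2 h3 => ?_
    obtain ⟨δ, hδ, hδ1, -, hr⟩ := exists_margin_of_tsupport_subset h2 h3
    -- The test function is the primitive of η that vanishes near 1. Near 0 it is a constant, in
    -- general not zero; admitting such tests is what encodes zero flux at y = 0 and excludes a
    -- constant of integration.
    have hcd := contDiff_primitive h1 1
    have hder : deriv (fun y => ∫ t in (1 : ℝ)..y, η t) = η := by
      ext y; exact h1.continuous.deriv_integral η 1 y
    have hz := h _ hcd ⟨1 - δ, by linarith, fun y hy => by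
      rw [intervalIntegral.integral_congr (g := fun _ => 0)]
      · simp
      · intro t ht
        have : min 1 y ≤ t := ht.1
        exact hr t (le_trans (le_min (by linarith) hy) this)⟩
    rw [hder] at hz
    have hint := integral_mul_primitive_swap (integrableOn_Ioo_of_continuous h1.continuous 0 1) hq
    have e1 : ∫ y in Ioo (0 : ℝ) 1, q y * ∫ t in (1 : ℝ)..y, η t =
        - ∫ t in Ioo (0 : ℝ) 1, q t * ∫ y in Ioo t 1, η y := by
      rw [← integral_neg]
      refine setIntegral_congr_fun measurableSet_Ioo fun t ht => ?_
      rw [intervalIntegral.integral_symm, intervalIntegral.integral_of_le ht.2.le,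
        integral_Ioc_eq_integral_Ioo]
      ring
    rw [e1, ← hint] at hz
    simp only [add_mul]
    rw [integral_add (hp.mul_continuous_Ioo h1.continuous)
      ((integrableOn_primitive_left hq).mul_continuous_Ioo h1.continuous), hz]
    simp [mul_comm]
  filter_upwards [key] with y hy
  linarith

/-- A function with weak derivative `g` multiplied by a cutoff vanishing near the top is the integral
of its weak derivative. -/
theorem eq_integral_of_weak_deriv {f g χ : ℝ → ℝ} (hf : IntegrableOn f (Ioo 0 1))
    (hg : IntegrableOn g (Ioo 0 1)) (hχ : ContDiff ℝ ∞ χ) (hS : ∃ S < 1, ∀ y ≥ S, χ y = 0)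
    (h : ∀ ζ : ℝ → ℝ, ContDiff ℝ ∞ ζ → HasCompactSupport ζ → tsupport ζ ⊆ Ioo 0 1 →
      ∫ y in Ioo (0 : ℝ) 1, f y * deriv ζ y = -∫ y in Ioo (0 : ℝ) 1, g y * ζ y) :
    ∀ᵐ y ∂(volume.restrict (Ioo (0 : ℝ) 1)),
      χ y * f y = -∫ s in Ioo y 1, (χ s * g s + deriv χ s * f s) := by
  obtain ⟨S, hS, hχS⟩ := hS
  have hχ' : Continuous (deriv χ) := hχ.continuous_deriv (by simp)
  have hF : IntegrableOn (fun s => χ s * g s + deriv χ s * f s) (Ioo 0 1) :=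
    ((hg.mul_continuous_Ioo hχ.continuous).add (hf.mul_continuous_Ioo hχ')).congr
      (Eventually.of_forall fun s => by simp [mul_comm])
  have hχf : IntegrableOn (fun s => χ s * f s) (Ioo 0 1) :=
    (hf.mul_continuous_Ioo hχ.continuous).congr (Eventually.of_forall fun s => by simp [mul_comm])
  have key : ∀ᵐ y ∂(volume.restrict (Ioo (0 : ℝ) 1)),
      χ y * f y + ∫ s in Ioo y 1, (χ s * g s + deriv χ s * f s) = 0 := by
    refine ae_eq_zero_Ioo_of_tests (hχf.add (integrableOn_primitive_right hF))
      fun η h1 h2 h3 => ?_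
    obtain ⟨δ, hδ, hδ1, hl, hr⟩ := exists_margin_of_tsupport_subset h2 h3
    -- The primitive H vanishes near 0 and χ vanishes near 1, so χ H has compact support in (0, 1)
    -- and may be used as a test although H may not.
    set H : ℝ → ℝ := fun y => ∫ t in (0 : ℝ)..y, η t with hH
    have hcd : ContDiff ℝ ∞ H := contDiff_primitive h1 0
    have hder : deriv H = η := by
      ext y; exact h1.continuous.deriv_integral η 0 y
    have hsupp : ∀ y, y ∉ Icc δ S → χ y * H y = 0 := by
      intro y hy
      by_cases hy1 : S ≤ y
      · rw [hχS y hy1, zero_mul]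
      · have : y < δ := by
          by_contra hc
          exact hy ⟨not_lt.1 hc, (not_le.1 hy1).le⟩
        rw [hH]; simp only
        rw [intervalIntegral.integral_congr (g := fun _ => 0)]
        · simp
        · intro t ht
          have : t ≤ max 0 y := ht.2
          exact hl t (this.trans (max_le hδ.le (by linarith)))
    have hts : tsupport (fun y => χ y * H y) ⊆ Icc δ S :=
      closure_minimal (fun y hy => by
        by_contra hc; exact hy (hsupp y hc)) isClosed_Icc
    have hz := h (fun y => χ y * H y) (hχ.mul hcd)
      (HasCompactSupport.of_support_subset_isCompact isCompact_Icc
        (subset_closure.trans hts))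
      (hts.trans fun y hy => ⟨by linarith [hy.1], by linarith [hy.2]⟩)
    have hd : ∀ y, deriv (fun y => χ y * H y) y = deriv χ y * H y + χ y * η y := by
      intro y
      have := ((hχ.differentiable (by simp)).differentiableAt (x := y)).hasDerivAt.mul
        ((hcd.differentiable (by simp)).differentiableAt (x := y)).hasDerivAt
      rw [hder] at this
      exact this.deriv
    simp only [hd] at hz
    have hηi := integrableOn_Ioo_of_continuous h1.continuous 0 1
    have hsw := integral_mul_primitive_swap hF hηi
    have e1 : ∫ y in Ioo (0 : ℝ) 1, (χ y * g y + deriv χ y * f y) * ∫ t in Ioo 0 y, η t =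
        ∫ y in Ioo (0 : ℝ) 1, (χ y * g y + deriv χ y * f y) * H y := by
      refine setIntegral_congr_fun measurableSet_Ioo fun t ht => ?_
      simp only [hH]
      rw [intervalIntegral.integral_of_le ht.1.le, integral_Ioc_eq_integral_Ioo]
    have i1 : IntegrableOn (fun y => f y * (deriv χ y * H y)) (Ioo 0 1) :=
      hf.mul_continuous_Ioo (hχ'.mul hcd.continuous)
    have i2 : IntegrableOn (fun y => f y * (χ y * η y)) (Ioo 0 1) :=
      hf.mul_continuous_Ioo (hχ.continuous.mul h1.continuous)
    have i3 : IntegrableOn (fun y => g y * (χ y * H y)) (Ioo 0 1) :=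
      hg.mul_continuous_Ioo (hχ.continuous.mul hcd.continuous)
    simp only [mul_add] at hz
    rw [integral_add i1 i2] at hz
    have e2 : ∫ y in Ioo (0 : ℝ) 1, (χ y * g y + deriv χ y * f y) * H y =
        (∫ y in Ioo (0 : ℝ) 1, g y * (χ y * H y)) +
          ∫ y in Ioo (0 : ℝ) 1, f y * (deriv χ y * H y) := by
      rw [← integral_add i3 i1]
      congr 1; ext y; ring
    simp only [add_mul]
    rw [integral_add (hχf.mul_continuous_Ioo h1.continuous)
      ((integrableOn_primitive_right hF).mul_continuous_Ioo h1.continuous)]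
    have e3 : ∫ y in Ioo (0 : ℝ) 1, χ y * f y * η y =
        ∫ y in Ioo (0 : ℝ) 1, f y * (χ y * η y) := by
      congr 1; ext y; ring
    have e4 : ∫ y in Ioo (0 : ℝ) 1, (∫ s in Ioo y 1, (χ s * g s + deriv χ s * f s)) * η y =
        ∫ y in Ioo (0 : ℝ) 1, η y * ∫ s in Ioo y 1, (χ s * g s + deriv χ s * f s) := by
      congr 1; ext y; ring
    rw [e3, e4, ← hsw, e1, e2]
    linarith
  filter_upwards [key] with y hy
  linarith

/-! ### A Sobolev inequality on cubes -/

/-- Write f(t) = f(s) + ∫ₛᵗ f' and average over s in (-c, c); the factor 1 / (2c) comes from the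
length of the interval. -/
theorem enorm_le_lintegral_Ioo_of_hasDerivAt {f f' : ℝ → ℝ} {c t : ℝ} (ht : t ∈ Ioo (-c) c)
    (hf : ∀ s, HasDerivAt f (f' s) s) (hf' : Continuous f') :
    ‖f t‖ₑ ≤ ∫⁻ s in Ioo (-c) c, (ENNReal.ofReal (1 / (2 * c)) * ‖f s‖ₑ + ‖f' s‖ₑ) := by
  have hc : 0 < c := by linarith [ht.1, ht.2]
  have hfc : Continuous f := continuous_iff_continuousAt.2 fun s => (hf s).continuousAt
  set D := ∫⁻ s in Ioo (-c) c, ‖f' s‖ₑ with hD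
  have hdiff : ∀ s ∈ Ioo (-c) c, ‖f t‖ₑ ≤ ‖f s‖ₑ + D := by
    intro s hs
    have h1 := intervalIntegral.integral_eq_sub_of_hasDerivAt (a := s) (b := t)
      (fun x _ => hf x) (hf'.intervalIntegrable s t)
    have h2 : ‖f t - f s‖ₑ ≤ D := by
      rw [← h1, ← ofReal_norm, intervalIntegral.norm_intervalIntegral_eq,
        ofReal_norm]
      refine (enorm_integral_le_lintegral_enorm _).trans (lintegral_mono_set ?_)
      intro z hz
      rw [uIoc, mem_Ioc] at hz
      exact ⟨lt_of_le_of_lt (le_min hs.1.le ht.1.le) hz.1,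
        lt_of_le_of_lt hz.2 (max_lt hs.2 ht.2)⟩
    calc ‖f t‖ₑ = ‖f s + (f t - f s)‖ₑ := by congr 1; ring
      _ ≤ _ := (enorm_add_le _ _).trans (by gcongr)
  have hvol : ENNReal.ofReal (1 / (2 * c)) * volume (Ioo (-c) c) = 1 := by
    rw [Real.volume_Ioo, ← ENNReal.ofReal_mul (by positivity), show 1 / (2 * c) * (c - -c) = 1 by
      field_simp; ring, ENNReal.ofReal_one]
  calc ‖f t‖ₑ = ENNReal.ofReal (1 / (2 * c)) * ∫⁻ _ in Ioo (-c) c, ‖f t‖ₑ := by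
        rw [setLIntegral_const, mul_left_comm, hvol, mul_one]
    _ ≤ ENNReal.ofReal (1 / (2 * c)) * ∫⁻ s in Ioo (-c) c, (‖f s‖ₑ + D) := by
        exact mul_le_mul_right (setLIntegral_mono' measurableSet_Ioo hdiff) _
    _ = ENNReal.ofReal (1 / (2 * c)) * (∫⁻ s in Ioo (-c) c, ‖f s‖ₑ) + D := by
        rw [lintegral_add_right _ measurable_const, setLIntegral_const, mul_add,
          mul_left_comm _ D, hvol, mul_one]
    _ = _ := by
        rw [lintegral_add_right _ hf'.measurable.enorm, lintegral_const_mul _ hfc.measurable.enorm]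

/-- The sum of the sizes of the mixed derivatives `u (t ++ l)`, `t` a sublist of `s`, with powers of
`K` as weights. -/
noncomputable def mixedSum {ι α : Type*} (K : ℝ≥0∞) (u : List ι → α → ℝ) :
    List ι → List ι → α → ℝ≥0∞
  | [], l, x => ‖u l x‖ₑ
  | a :: s, l, x => K * mixedSum K u s l x + mixedSum K u s (a :: l) x

theorem measurable_mixedSum {ι α : Type*} [MeasurableSpace α] {K : ℝ≥0∞} {u : List ι → α → ℝ}
    (hu : ∀ l, Measurable (u l)) : ∀ s l, Measurable (mixedSum K u s l)
  | [], l => (hu l).enorm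
  | _ :: s, l => ((measurable_mixedSum hu s l).const_mul K).add (measurable_mixedSum hu s _)

/-- The one-dimensional inequality is applied to one variable after another. Each variable in `s` is
integrated out and either contributes a factor 1 / (2c) or adds a derivative to the list `l`;
`mixedSum` records all these alternatives. No variable is differentiated twice because `s` has no
repetitions. -/
theorem enorm_le_lmarginal_mixedSum {ι : Type*} [DecidableEq ι] {c : ℝ}
    {u : List ι → (ι → ℝ) → ℝ} (hm : ∀ l, Measurable (u l))
    (hc : ∀ l i x, Continuous fun t => u l (Function.update x i t))
    (hd : ∀ l i x t, HasDerivAt (fun t => u l (Function.update x i t))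
      (u (i :: l) (Function.update x i t)) t) :
    ∀ s : List ι, s.Nodup → ∀ l x, (∀ i, x i ∈ Ioo (-c) c) →
      ‖u l x‖ₑ ≤ (∫⋯∫⁻_s.toFinset, mixedSum (ENNReal.ofReal (1 / (2 * c))) u s l
        ∂(fun _ => volume.restrict (Ioo (-c) c))) x := by
  intro s
  induction s with
  | nil => intro _ l x _; simp [mixedSum]
  | cons a s ih =>
    intro hs l x hx
    rw [List.nodup_cons] at hs
    have h1 := enorm_le_lintegral_Ioo_of_hasDerivAt (hx a) (hd l a x) (hc (a :: l) a x)
    rw [Function.update_eq_self] at h1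
    rw [List.toFinset_cons, lmarginal_insert _ (measurable_mixedSum hm _ _) (by simpa using hs.1)]
    refine h1.trans (setLIntegral_mono' measurableSet_Ioo fun t ht => ?_)
    have hx' : ∀ i, Function.update x a t i ∈ Ioo (-c) c := by
      intro i
      by_cases hi : i = a
      · subst hi; simpa using ht
      · simpa [hi] using hx i
    have h2 := ih hs.2 l _ hx'
    have h3 := ih hs.2 (a :: l) _ hx'
    refine (add_le_add (mul_le_mul_right h2 _) h3).trans (le_of_eq ?_)
    simp only [lmarginal, mixedSum]
    have hmu : ∀ l, Measurable fun y => mixedSum (ENNReal.ofReal (1 / (2 * c))) u s l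
        (Function.updateFinset (Function.update x a t) s.toFinset y) := fun l =>
      (measurable_mixedSum hm s l).comp measurable_updateFinset
    rw [lintegral_add_right _ (hmu _), lintegral_const_mul _ (hmu _)]

theorem mixedSum_comp {ι α β : Type*} (K : ℝ≥0∞) (u : List ι → α → ℝ) (g : β → α) :
    ∀ s l x, mixedSum K (fun l x => u l (g x)) s l x = mixedSum K u s l (g x)
  | [], _, _ => rfl
  | _ :: s, l, x => by simp only [mixedSum, mixedSum_comp K u g s]

/-- Pointwise control of a smooth function by its mixed derivatives in `L¹` of a larger ball. -/
theorem exists_enorm_le_lintegral_ball_mixedSum (n : ℕ) {r : ℝ} (hr : 0 < r) :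
    ∃ c : ℝ, 0 < c ∧ c ≤ r ∧ ∀ u : List (Fin n) → EuclideanSpace ℝ (Fin n) → ℝ,
      (∀ l, ContDiff ℝ 1 (u l)) →
      (∀ l i x, fderiv ℝ (u l) x (EuclideanSpace.single i 1) = u (i :: l) x) →
      ∀ l, ∀ x ∈ Metric.ball (0 : EuclideanSpace ℝ (Fin n)) c,
        ‖u l x‖ₑ ≤ ∫⁻ z in Metric.ball (0 : EuclideanSpace ℝ (Fin n)) r,
          mixedSum (ENNReal.ofReal (1 / (2 * c))) u (List.finRange n) l z := by
  -- With this c the ball of radius c lies in the cube (-c, c)ⁿ, and the cube lies in the ball of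
  -- radius r because √n c < (n + 1) c.
  refine ⟨r / (n + 1), by positivity, div_le_self hr.le (by simp), fun u hu hd l x hx => ?_⟩
  set c := r / (n + 1) with hc
  have hcpos : 0 < c := by positivity
  let U : List (Fin n) → (Fin n → ℝ) → ℝ := fun l x => u l (WithLp.toLp 2 x)
  have hlp : Measurable (WithLp.toLp 2 : (Fin n → ℝ) → EuclideanSpace ℝ (Fin n)) :=
    (PiLp.continuous_toLp 2 _).measurable
  have hup : ∀ (x : Fin n → ℝ) (i : Fin n) (t : ℝ),
      (WithLp.toLp 2 (Function.update x i t) : EuclideanSpace ℝ (Fin n)) =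
        WithLp.toLp 2 x + (t - x i) • EuclideanSpace.single i 1 := by
    intro x i t
    ext j
    by_cases hj : j = i
    · subst hj; simp
    · simp [hj]
  have hcont : ∀ l i x, Continuous fun t => U l (Function.update x i t) := by
    intro l i x
    simp only [U, hup]
    exact (hu l).continuous.comp (by fun_prop)
  have hder : ∀ l i x t, HasDerivAt (fun t => U l (Function.update x i t))
      (U (i :: l) (Function.update x i t)) t := by
    intro l i x t
    simp only [U]
    rw [← hd]
    simp only [hup]
    have h1 : HasDerivAt (fun t : ℝ => (WithLp.toLp 2 x : EuclideanSpace ℝ (Fin n)) +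
        (t - x i) • EuclideanSpace.single i (1 : ℝ)) (EuclideanSpace.single i 1) t := by
      simpa using (((hasDerivAt_id t).sub_const (x i)).smul_const
        (EuclideanSpace.single i (1 : ℝ))).const_add (WithLp.toLp 2 x)
    exact (((hu l).differentiable (by simp)) _).hasFDerivAt.comp_hasDerivAt t h1
  have hcube : ∀ i, x.ofLp i ∈ Ioo (-c) c := by
    intro i
    have h1 : |x.ofLp i| ≤ ‖x‖ := by simpa using PiLp.norm_apply_le x i
    have h2 : ‖x‖ < c := by simpa using hx
    exact abs_lt.1 (h1.trans_lt h2)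
  have key := enorm_le_lmarginal_mixedSum (u := U) (c := c)
    (fun l => (hu l).continuous.measurable.comp hlp) hcont hder (List.finRange n)
    (List.nodup_finRange n) l x.ofLp hcube
  have huniv : (List.finRange n).toFinset = Finset.univ := by ext; simp
  rw [huniv, lmarginal_univ, ← Measure.restrict_pi_pi, ← volume_pi] at key
  have e : ∀ z, mixedSum (ENNReal.ofReal (1 / (2 * c))) U (List.finRange n) l z =
      mixedSum (ENNReal.ofReal (1 / (2 * c))) u (List.finRange n) l (WithLp.toLp 2 z) :=
    mixedSum_comp _ u _ _ _
  simp only [e] at key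
  refine key.trans ?_
  rw [← (PiLp.volume_preserving_toLp (Fin n)).setLIntegral_comp_preimage
    Metric.isOpen_ball.measurableSet (measurable_mixedSum (fun l => (hu l).continuous.measurable) _ _)]
  refine lintegral_mono_set ?_
  intro z hz
  simp only [mem_preimage, Metric.mem_ball, dist_zero_right, EuclideanSpace.norm_eq]
  have hz' : ∀ i, ‖z i‖ ^ 2 ≤ c ^ 2 := by
    intro i
    have := hz i (mem_univ i)
    rw [Real.norm_eq_abs]
    exact pow_le_pow_left₀ (abs_nonneg _) (abs_lt.2 this).le 2
  have hsum : ∑ i, ‖z i‖ ^ 2 ≤ n * c ^ 2 := by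
    simpa using Finset.sum_le_card_nsmul Finset.univ (fun i => ‖z i‖ ^ 2) _ (fun i _ => hz' i)
  rw [Real.sqrt_lt' hr]
  have : r = (n + 1) * c := by rw [hc]; field_simp
  rw [this]
  have hn : (0 : ℝ) ≤ n := Nat.cast_nonneg n
  nlinarith [sq_nonneg c, mul_pos hcpos hcpos]

/-! ### Mollification in `x` -/

/-- The convolution in the `x`-variable of `f(·, y)` with `k`. -/
noncomputable def convX {n : ℕ} (f : Pt n → ℝ) (k : EuclideanSpace ℝ (Fin n) → ℝ)
    (x : EuclideanSpace ℝ (Fin n)) (y : ℝ) : ℝ := ∫ z, f (z, y) * k (x - z)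

/-- The partial derivative `∂ᵢ k`. -/
noncomputable def partialX {n : ℕ} (i : Fin n) (k : EuclideanSpace ℝ (Fin n) → ℝ) :
    EuclideanSpace ℝ (Fin n) → ℝ := fun z => fderiv ℝ k z (EuclideanSpace.single i 1)

/-- Iterated partial derivatives. -/
noncomputable def partialsX {n : ℕ} (l : List (Fin n)) (k : EuclideanSpace ℝ (Fin n) → ℝ) :
    EuclideanSpace ℝ (Fin n) → ℝ := l.foldr partialX k

/-- Smooth kernels supported in the closed ball of radius `ε`. -/
structure IsKernel {n : ℕ} (ε : ℝ) (k : EuclideanSpace ℝ (Fin n) → ℝ) : Prop where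
  contDiff : ContDiff ℝ ∞ k
  tsupport_subset : tsupport k ⊆ Metric.closedBall 0 ε

namespace IsKernel

variable {n : ℕ} {ε : ℝ} {k : EuclideanSpace ℝ (Fin n) → ℝ}

theorem hasCompactSupport (hk : IsKernel ε k) : HasCompactSupport k :=
  HasCompactSupport.of_support_subset_isCompact (isCompact_closedBall 0 ε)
    (subset_closure.trans hk.tsupport_subset)

/-- This closure under differentiation is the reason why kernels are required neither to be positive
nor to have mass one: every estimate for mollifications holds for their x-derivatives as well. -/
theorem partialX (hk : IsKernel ε k) (i : Fin n) : IsKernel ε (partialX i k) where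
  contDiff := (hk.contDiff.fderiv_right (m := ∞) (by simp)).clm_apply contDiff_const
  tsupport_subset := (tsupport_fderiv_apply_subset ℝ _).trans hk.tsupport_subset

theorem partialsX (hk : IsKernel ε k) : ∀ l : List (Fin n), IsKernel ε (partialsX l k)
  | [] => hk
  | i :: l => (hk.partialsX l).partialX i

theorem exists_bound (hk : IsKernel ε k) : ∃ K, 0 ≤ K ∧ ∀ z, |k z| ≤ K := by
  obtain ⟨K, hK⟩ := hk.hasCompactSupport.exists_bound_of_continuous hk.contDiff.continuous
  exact ⟨K, (norm_nonneg _).trans (hK 0), fun z => by simpa using hK z⟩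

theorem contDiff_reflect (hk : IsKernel ε k) (x : EuclideanSpace ℝ (Fin n)) :
    ContDiff ℝ ∞ fun z => k (x - z) := hk.contDiff.comp (contDiff_const.sub contDiff_id)

theorem tsupport_reflect (hk : IsKernel ε k) (x : EuclideanSpace ℝ (Fin n)) :
    tsupport (fun z => k (x - z)) ⊆ Metric.closedBall x ε := by
  refine closure_minimal (fun z hz => ?_) Metric.isClosed_closedBall
  have := hk.tsupport_subset (subset_closure (show x - z ∈ Function.support k from hz))
  rw [mem_closedBall_zero_iff] at this
  rwa [Metric.mem_closedBall, dist_comm, dist_eq_norm]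

theorem hasCompactSupport_reflect (hk : IsKernel ε k) (x : EuclideanSpace ℝ (Fin n)) :
    HasCompactSupport fun z => k (x - z) :=
  HasCompactSupport.of_support_subset_isCompact (isCompact_closedBall x ε)
    (subset_closure.trans (hk.tsupport_reflect x))

theorem fderiv_reflect (hk : IsKernel ε k) (x z e : EuclideanSpace ℝ (Fin n)) :
    fderiv ℝ (fun z => k (x - z)) z e = - fderiv ℝ k (x - z) e := by
  have h1 : HasFDerivAt (fun z => x - z) (-ContinuousLinearMap.id ℝ (EuclideanSpace ℝ (Fin n))) z :=
    (hasFDerivAt_id z).const_sub x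
  have h2 := ((hk.contDiff.differentiable (by simp)) (x - z)).hasFDerivAt.comp z h1
  rw [show (fun z => k (x - z)) = k ∘ (fun z => x - z) from rfl, h2.fderiv]
  simp

end IsKernel

/-- The `L¹`-norm of the slice `f(·, y)`. -/
noncomputable def sliceNorm {n : ℕ} (f : Pt n → ℝ) (y : ℝ) : ℝ := ∫ z, |f (z, y)|

/-- An integrable weight on `(0, 1)` with integrable inverse. -/
structure UnitWeight (μ : ℝ → ℝ) : Prop where
  integrable : IntegrableOn μ (Ioo 0 1)
  inv_integrable : IntegrableOn (fun y => (μ y)⁻¹) (Ioo 0 1)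
  pos : ∀ᵐ y ∂(volume.restrict (Ioo (0 : ℝ) 1)), 0 < μ y

/-- Measurable functions with integrable slices whose norms are square integrable for `μ`. -/
structure HasSlices {n : ℕ} (μ : ℝ → ℝ) (f : Pt n → ℝ) : Prop where
  measurable : Measurable f
  integrable : ∀ y, Integrable fun z => f (z, y)
  sq_integrable : IntegrableOn (fun y => sliceNorm f y ^ 2 * μ y) (Ioo 0 1)

/-! ### Integrability of slices and of their mollifications -/

section slices

variable {n : ℕ} {μ : ℝ → ℝ} {f h : Pt n → ℝ} {ε ε' : ℝ} {k k' : EuclideanSpace ℝ (Fin n) → ℝ}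

theorem sliceNorm_nonneg (f : Pt n → ℝ) (y : ℝ) : 0 ≤ sliceNorm f y :=
  integral_nonneg fun _ => abs_nonneg _

theorem HasSlices.measurable_sliceNorm (hf : HasSlices μ f) : Measurable (sliceNorm f) := by
  have : StronglyMeasurable (Function.uncurry fun (y : ℝ) (z : EuclideanSpace ℝ (Fin n)) =>
      |f (z, y)|) := by
    refine Measurable.stronglyMeasurable ?_
    exact (hf.measurable.comp measurable_swap).abs
  exact this.integral_prod_right.measurable

theorem HasSlices.integrable_mul_weight (hμ : UnitWeight μ) (hf : HasSlices μ f)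
    (hh : HasSlices μ h) :
    IntegrableOn (fun y => sliceNorm f y * sliceNorm h y * μ y) (Ioo 0 1) := by
  refine Integrable.mono' (hf.sq_integrable.add hh.sq_integrable)
    ((hf.measurable_sliceNorm.mul hh.measurable_sliceNorm).aestronglyMeasurable.mul
      hμ.integrable.aestronglyMeasurable) ?_
  filter_upwards [hμ.pos] with y hy
  have h1 := sliceNorm_nonneg f y
  have h2 := sliceNorm_nonneg h y
  rw [Real.norm_of_nonneg (by positivity)]
  simp only [Pi.add_apply]
  rw [← add_mul]
  gcongr
  nlinarith [sq_nonneg (sliceNorm f y - sliceNorm h y)]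

theorem HasSlices.integrable_weight (hμ : UnitWeight μ) (hf : HasSlices μ f) :
    IntegrableOn (fun y => sliceNorm f y * μ y) (Ioo 0 1) := by
  refine Integrable.mono' (hf.sq_integrable.add hμ.integrable)
    (hf.measurable_sliceNorm.aestronglyMeasurable.mul hμ.integrable.aestronglyMeasurable) ?_
  filter_upwards [hμ.pos] with y hy
  have h1 := sliceNorm_nonneg f y
  rw [Real.norm_of_nonneg (by positivity)]
  simp only [Pi.add_apply]
  nlinarith [mul_nonneg (sq_nonneg (sliceNorm f y - 1)) hy.le]

/-- Integrability without the weight comes from 2 s ≤ s² μ + μ⁻¹, that is, from (s μ - 1)² μ⁻¹ ≥ 0.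
Here the integrability of μ⁻¹ enters. -/
theorem HasSlices.integrable_sliceNorm (hμ : UnitWeight μ) (hf : HasSlices μ f) :
    IntegrableOn (sliceNorm f) (Ioo 0 1) := by
  refine Integrable.mono' (hf.sq_integrable.add hμ.inv_integrable)
    hf.measurable_sliceNorm.aestronglyMeasurable ?_
  filter_upwards [hμ.pos] with y hy
  have h1 := sliceNorm_nonneg f y
  rw [Real.norm_of_nonneg (by positivity)]
  simp only [Pi.add_apply]
  have h2 : 0 < (μ y)⁻¹ := by positivity
  have h3 : μ y * (μ y)⁻¹ = 1 := mul_inv_cancel₀ hy.ne'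
  have h4 : 0 ≤ (sliceNorm f y * μ y - 1) ^ 2 * (μ y)⁻¹ := by positivity
  have h5 : (sliceNorm f y * μ y - 1) ^ 2 * (μ y)⁻¹ =
      sliceNorm f y ^ 2 * μ y - 2 * sliceNorm f y + (μ y)⁻¹ := by
    field_simp; ring
  linarith

theorem abs_convX_le (hf : HasSlices μ f) {K : ℝ} (hK : ∀ z, |k z| ≤ K)
    (x : EuclideanSpace ℝ (Fin n)) (y : ℝ) : |convX f k x y| ≤ K * sliceNorm f y := by
  rw [convX, sliceNorm, ← integral_const_mul, ← Real.norm_eq_abs]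
  refine norm_integral_le_of_norm_le ((hf.integrable y).abs.const_mul K)
    (Eventually.of_forall fun z => ?_)
  simp only [norm_mul, Real.norm_eq_abs]
  rw [mul_comm]
  gcongr
  exact hK _

theorem measurable_convX (hf : Measurable f) (hk : Continuous k) :
    Measurable fun X : Pt n => convX f k X.1 X.2 := by
  have : StronglyMeasurable (Function.uncurry fun (X : Pt n) (z : EuclideanSpace ℝ (Fin n)) =>
      f (z, X.2) * k (X.1 - z)) := by
    refine Measurable.stronglyMeasurable ?_
    refine Measurable.mul (hf.comp (by fun_prop)) (hk.measurable.comp (by fun_prop))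
  exact this.integral_prod_right.measurable

theorem measurable_convX_right (hf : Measurable f) (hk : Continuous k)
    (x : EuclideanSpace ℝ (Fin n)) : Measurable fun y => convX f k x y :=
  (measurable_convX hf hk).comp measurable_prodMk_left

theorem contDiff_convX (hf : HasSlices μ f) (hk : IsKernel ε k) (y : ℝ) :
    ContDiff ℝ ∞ fun x => convX f k x y :=
  hk.hasCompactSupport.contDiff_convolution_right (n := ⊤) (ContinuousLinearMap.mul ℝ ℝ)
    (hf.integrable y).locallyIntegrable hk.contDiff

theorem fderiv_convX (hf : HasSlices μ f) (hk : IsKernel ε k) (x : EuclideanSpace ℝ (Fin n))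
    (y : ℝ) (i : Fin n) :
    fderiv ℝ (fun x => convX f k x y) x (EuclideanSpace.single i 1) =
      convX f (partialX i k) x y := by
  have h1 := hk.hasCompactSupport.hasFDerivAt_convolution_right (ContinuousLinearMap.mul ℝ ℝ)
    (hf.integrable y).locallyIntegrable (hk.contDiff.of_le (by simp)) x
  have h2 : fderiv ℝ (fun x => convX f k x y) x = _ := h1.fderiv
  rw [h2, convolution_precompR_apply (ContinuousLinearMap.mul ℝ ℝ)
    (hf.integrable y).locallyIntegrable (hk.hasCompactSupport.fderiv ℝ)
    (hk.contDiff.continuous_fderiv (by simp))]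
  rfl

/-- Products `m(y) (f * k)(x, y)` with `m = O(μ)` or `m = O(1)` are integrable in `y`. -/
theorem integrable_mul_convX (hμ : UnitWeight μ) (hf : HasSlices μ f) (hk : IsKernel ε k)
    {m : ℝ → ℝ} (hm : AEStronglyMeasurable m (volume.restrict (Ioo 0 1))) {C : ℝ}
    (hC : ∀ᵐ y ∂(volume.restrict (Ioo (0 : ℝ) 1)), |m y| ≤ C * μ y)
    (x : EuclideanSpace ℝ (Fin n)) : IntegrableOn (fun y => m y * convX f k x y) (Ioo 0 1) := by
  obtain ⟨K, hK0, hK⟩ := hk.exists_bound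
  refine Integrable.mono' ((hf.integrable_weight hμ).const_mul (C * K))
    (hm.mul (measurable_convX_right hf.measurable hk.contDiff.continuous x).aestronglyMeasurable) ?_
  filter_upwards [hC] with y hy
  rw [norm_mul]
  calc ‖m y‖ * ‖convX f k x y‖ ≤ (C * μ y) * (K * sliceNorm f y) :=
        mul_le_mul hy (abs_convX_le hf hK x y) (abs_nonneg _) ((abs_nonneg _).trans hy)
    _ = _ := by ring

theorem integrable_convX (hμ : UnitWeight μ) (hf : HasSlices μ f) (hk : IsKernel ε k)
    (x : EuclideanSpace ℝ (Fin n)) : IntegrableOn (fun y => convX f k x y) (Ioo 0 1) := by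
  obtain ⟨K, hK0, hK⟩ := hk.exists_bound
  refine Integrable.mono' ((hf.integrable_sliceNorm hμ).const_mul K)
    (measurable_convX_right hf.measurable hk.contDiff.continuous x).aestronglyMeasurable ?_
  exact Eventually.of_forall fun y => abs_convX_le hf hK x y

/-- Every term of the energy identity has this shape. Bounded kernels reduce it to |α(x)| times a
product of two slice norms times μ, which is integrable by the square integrability of the slice
norms. -/
theorem integrable_mul_convX_mul_convX (hμ : UnitWeight μ) (hf : HasSlices μ f)
    (hh : HasSlices μ h) (hk : IsKernel ε k) (hk' : IsKernel ε' k')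
    {α : EuclideanSpace ℝ (Fin n) → ℝ} (hα : Integrable α) {m : ℝ → ℝ}
    (hm : AEStronglyMeasurable m (volume.restrict (Ioo 0 1))) {C : ℝ}
    (hC : ∀ᵐ y ∂(volume.restrict (Ioo (0 : ℝ) 1)), |m y| ≤ C * μ y) :
    Integrable (fun X : Pt n => α X.1 * (m X.2 * (convX f k X.1 X.2 * convX h k' X.1 X.2)))
      (volume.prod (volume.restrict (Ioo (0 : ℝ) 1))) := by
  obtain ⟨K, hK0, hK⟩ := hk.exists_bound
  obtain ⟨K', hK0', hK'⟩ := hk'.exists_bound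
  refine Integrable.mono' (Integrable.mul_prod hα.norm
    ((hf.integrable_mul_weight hμ hh).const_mul (C * K * K'))) ?_ ?_
  · exact hα.aestronglyMeasurable.comp_fst.mul (hm.comp_snd.mul
      ((measurable_convX hf.measurable hk.contDiff.continuous).mul
      (measurable_convX hh.measurable hk'.contDiff.continuous)).aestronglyMeasurable)
  · have := Measure.quasiMeasurePreserving_snd (μ := (volume : Measure (EuclideanSpace ℝ (Fin n))))
      (ν := volume.restrict (Ioo (0 : ℝ) 1)) |>.ae hC
    filter_upwards [this] with X hX
    rw [norm_mul]
    gcongr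
    simp only [norm_mul]
    calc ‖m X.2‖ * (‖convX f k X.1 X.2‖ * ‖convX h k' X.1 X.2‖)
        ≤ (C * μ X.2) * ((K * sliceNorm f X.2) * (K' * sliceNorm h X.2)) := by
          refine mul_le_mul hX (mul_le_mul (abs_convX_le hf hK _ _) (abs_convX_le hh hK' _ _)
            (abs_nonneg _) ?_) (by positivity) ((abs_nonneg _).trans hX)
          exact mul_nonneg hK0 (sliceNorm_nonneg _ _)
      _ = _ := by ring

end slices

/-- Weak solutions at unit scale, tested against products `φ(x) ζ(y)`: `v` has the weak gradient
`(G, g)` in `B_ρ × (0, 1)` and `div_x (a ∇_x v) + ∂_y (d ∂_y v) = 0` with zero flux at `y = 0`. -/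
structure SliceSol {n : ℕ} (ρ Λ : ℝ) (μ : ℝ → ℝ) (a : Fin n → Fin n → ℝ → ℝ) (d : ℝ → ℝ)
    (v g : Pt n → ℝ) (G : Fin n → Pt n → ℝ) : Prop where
  pos : 0 < Λ
  weight : UnitWeight μ
  a_meas : ∀ i j, AEMeasurable (a i j) (volume.restrict (Ioo 0 1))
  d_meas : AEMeasurable d (volume.restrict (Ioo 0 1))
  symm : ∀ᵐ y ∂(volume.restrict (Ioo (0 : ℝ) 1)), ∀ i j, a i j y = a j i y
  elliptic : ∀ᵐ y ∂(volume.restrict (Ioo (0 : ℝ) 1)), ∀ (ξ : Fin n → ℝ) (t : ℝ),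
    Λ⁻¹ * μ y * (∑ i, ξ i ^ 2 + t ^ 2) ≤ ∑ i, ∑ j, a i j y * ξ i * ξ j + d y * t ^ 2 ∧
      ∑ i, ∑ j, a i j y * ξ i * ξ j + d y * t ^ 2 ≤ Λ * μ y * (∑ i, ξ i ^ 2 + t ^ 2)
  slices_v : HasSlices μ v
  slices_g : HasSlices μ g
  slices_G : ∀ i, HasSlices μ (G i)
  weak_x : ∀ φ : EuclideanSpace ℝ (Fin n) → ℝ, ContDiff ℝ ∞ φ → HasCompactSupport φ →
    tsupport φ ⊆ Metric.ball 0 ρ → ∀ ζ : ℝ → ℝ, ContDiff ℝ ∞ ζ → HasCompactSupport ζ →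
    tsupport ζ ⊆ Ioo 0 1 → ∀ i,
    ∫ y in Ioo (0 : ℝ) 1, (∫ z, v (z, y) * fderiv ℝ φ z (EuclideanSpace.single i 1)) * ζ y =
      -∫ y in Ioo (0 : ℝ) 1, (∫ z, G i (z, y) * φ z) * ζ y
  weak_y : ∀ φ : EuclideanSpace ℝ (Fin n) → ℝ, ContDiff ℝ ∞ φ → HasCompactSupport φ →
    tsupport φ ⊆ Metric.ball 0 ρ → ∀ ζ : ℝ → ℝ, ContDiff ℝ ∞ ζ → HasCompactSupport ζ →
    tsupport ζ ⊆ Ioo 0 1 →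
    ∫ y in Ioo (0 : ℝ) 1, (∫ z, v (z, y) * φ z) * deriv ζ y =
      -∫ y in Ioo (0 : ℝ) 1, (∫ z, g (z, y) * φ z) * ζ y
  eq : ∀ φ : EuclideanSpace ℝ (Fin n) → ℝ, ContDiff ℝ ∞ φ → HasCompactSupport φ →
    tsupport φ ⊆ Metric.ball 0 ρ → ∀ ζ : ℝ → ℝ, ContDiff ℝ ∞ ζ → (∃ S < 1, ∀ y ≥ S, ζ y = 0) →
    ∫ y in Ioo (0 : ℝ) 1,
      ((∑ i, ∑ j, a i j y * ∫ z, G j (z, y) * fderiv ℝ φ z (EuclideanSpace.single i 1)) * ζ y +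
        d y * (∫ z, g (z, y) * φ z) * deriv ζ y) = 0

/-- Polarisation: evaluate the form at e_i, e_j and e_i + e_j, the last of which has square norm at
most 4. -/
theorem abs_entry_le_of_form_bounds {n : ℕ} {Λ m d : ℝ} {a : Fin n → Fin n → ℝ} (hΛ₀ : 0 < Λ)
    (hpos : 0 < m) (hsymm : ∀ i j, a i j = a j i)
    (hy : ∀ (ξ : Fin n → ℝ) (t : ℝ),
      Λ⁻¹ * m * (∑ i, ξ i ^ 2 + t ^ 2) ≤ ∑ i, ∑ j, a i j * ξ i * ξ j + d * t ^ 2 ∧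
      ∑ i, ∑ j, a i j * ξ i * ξ j + d * t ^ 2 ≤ Λ * m * (∑ i, ξ i ^ 2 + t ^ 2)) (i j : Fin n) :
    |a i j| ≤ 2 * Λ * m := by
  have hΛ : 0 < Λ * m := mul_pos hΛ₀ hpos
  have hΛ' : 0 < Λ⁻¹ * m := mul_pos (inv_pos.2 hΛ₀) hpos
  have hq : ∀ p q : Fin n, ∑ i, ∑ j, a i j * (Pi.single p (1 : ℝ) : Fin n → ℝ) i *
      (Pi.single q (1 : ℝ) : Fin n → ℝ) j = a p q := by
    intro p q
    simp [Pi.single_apply, Finset.sum_ite_eq']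
  have hs : ∀ p q : Fin n, ∑ i, (Pi.single p (1 : ℝ) : Fin n → ℝ) i *
      (Pi.single q (1 : ℝ) : Fin n → ℝ) i ≤ 1 := by
    intro p q
    by_cases hpq : p = q
    · simp [Pi.single_apply, Finset.sum_ite_eq', hpq]
    · simp [Pi.single_apply, Finset.sum_ite_eq', Ne.symm hpq]
  have hs1 : ∀ p : Fin n, ∑ i, (Pi.single p (1 : ℝ) : Fin n → ℝ) i ^ 2 = 1 := by
    intro p
    simp [Pi.single_apply]
  have h1 := hy (Pi.single i 1) 0
  have h2 := hy (Pi.single j 1) 0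
  have h3 := hy (Pi.single i 1 + Pi.single j 1) 0
  have e3 : ∑ k, (Pi.single i (1 : ℝ) + Pi.single j 1 : Fin n → ℝ) k ^ 2 =
      2 + 2 * ∑ k, (Pi.single i (1 : ℝ) : Fin n → ℝ) k * (Pi.single j (1 : ℝ) : Fin n → ℝ) k := by
    have e (p q : Fin n → ℝ) : ∑ k, (p + q) k ^ 2 =
        ∑ k, p k ^ 2 + ∑ k, q k ^ 2 + 2 * ∑ k, p k * q k := by
      rw [Finset.mul_sum, ← Finset.sum_add_distrib, ← Finset.sum_add_distrib]
      refine Finset.sum_congr rfl fun k _ => ?_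
      simp only [Pi.add_apply]; ring
    rw [e, hs1, hs1]; norm_num
  have e4 : ∑ k, ∑ l, a k l * (Pi.single i (1 : ℝ) + Pi.single j 1 : Fin n → ℝ) k *
      (Pi.single i (1 : ℝ) + Pi.single j 1 : Fin n → ℝ) l =
      a i i + a i j + a j i + a j j := by
    rw [← hq i i, ← hq i j, ← hq j i, ← hq j j]
    simp only [← Finset.sum_add_distrib]
    refine Finset.sum_congr rfl fun k _ => Finset.sum_congr rfl fun l _ => ?_
    simp only [Pi.add_apply]; ring
  rw [e3, e4] at h3
  rw [hq, hs1] at h1 h2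
  have hsij := hs i j
  have hsij0 : 0 ≤ ∑ k, (Pi.single i (1 : ℝ) : Fin n → ℝ) k * (Pi.single j (1 : ℝ) : Fin n → ℝ) k :=
    Finset.sum_nonneg fun k _ => by
      by_cases h1 : k = i <;> by_cases h2 : k = j <;> simp [Pi.single_apply, h1, h2] <;>
        split_ifs <;> norm_num
  set t := ∑ k, (Pi.single i (1 : ℝ) : Fin n → ℝ) k * (Pi.single j (1 : ℝ) : Fin n → ℝ) k
  have hji := hsymm i j
  have u1 : Λ * m * (2 + 2 * t + 0 ^ 2) ≤ Λ * m * 4 := by gcongr; linarith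
  have u2 : 0 ≤ Λ⁻¹ * m * (2 + 2 * t + 0 ^ 2) := by positivity
  have u3 : 0 ≤ Λ⁻¹ * m * (1 + 0 ^ 2) := by positivity
  rw [abs_le]
  constructor <;> linarith [h1.1, h1.2, h2.1, h2.2, h3.1, h3.2]

/-! ### The mollified equation as an ordinary differential equation in y -/

namespace SliceSol

variable {n : ℕ} {ρ Λ : ℝ} {μ : ℝ → ℝ} {a : Fin n → Fin n → ℝ → ℝ} {d : ℝ → ℝ}
  {v g : Pt n → ℝ} {G : Fin n → Pt n → ℝ} {ε : ℝ} {k : EuclideanSpace ℝ (Fin n) → ℝ}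

theorem d_bounds (h : SliceSol ρ Λ μ a d v g G) :
    ∀ᵐ y ∂(volume.restrict (Ioo (0 : ℝ) 1)), Λ⁻¹ * μ y ≤ d y ∧ d y ≤ Λ * μ y := by
  filter_upwards [h.elliptic] with y hy
  simpa using hy 0 1

theorem abs_d_le (h : SliceSol ρ Λ μ a d v g G) :
    ∀ᵐ y ∂(volume.restrict (Ioo (0 : ℝ) 1)), |d y| ≤ Λ * μ y := by
  filter_upwards [h.d_bounds, h.weight.pos] with y hy hpos
  rw [abs_of_nonneg]
  · exact hy.2
  · exact le_trans (mul_nonneg (inv_nonneg.2 h.pos.le) hpos.le) hy.1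

theorem abs_a_le (h : SliceSol ρ Λ μ a d v g G) :
    ∀ᵐ y ∂(volume.restrict (Ioo (0 : ℝ) 1)), ∀ i j, |a i j y| ≤ 2 * Λ * μ y := by
  filter_upwards [h.elliptic, h.weight.pos, h.symm] with y hy hpos hsymm
  exact abs_entry_le_of_form_bounds (a := fun i j => a i j y) h.pos hpos hsymm hy

/-- The `x`-derivatives of the mollified solution are mollifications of `G`. -/
theorem convX_partialX (h : SliceSol ρ Λ μ a d v g G) (hk : IsKernel ε k)
    {x : EuclideanSpace ℝ (Fin n)} (hx : x ∈ Metric.ball 0 (ρ - ε)) (i : Fin n) :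
    ∀ᵐ y ∂(volume.restrict (Ioo (0 : ℝ) 1)), convX v (partialX i k) x y = convX (G i) k x y := by
  have hsub : tsupport (fun z => k (x - z)) ⊆ Metric.ball 0 ρ :=
    (hk.tsupport_reflect x).trans (Metric.closedBall_subset_ball' (by
      rw [Metric.mem_ball] at hx; linarith))
  have h1 := integrable_convX h.weight h.slices_v (hk.partialX i) x
  have h2 := integrable_convX h.weight (h.slices_G i) hk x
  have key := ae_eq_zero_Ioo_of_tests (h1.sub h2) fun ζ z1 z2 z3 => by
    -- For fixed x the function z ↦ k(x - z) is itself an admissible test function. Its support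
    -- stays in the ball of radius ρ because x keeps the distance ε from the boundary.
    have hw := h.weak_x _ (hk.contDiff_reflect x) (hk.hasCompactSupport_reflect x) hsub ζ z1 z2 z3 i
    simp only [Pi.sub_apply, sub_mul]
    rw [integral_sub (h1.mul_continuous_Ioo z1.continuous) (h2.mul_continuous_Ioo z1.continuous)]
    have : ∀ y, ∫ z, v (z, y) * fderiv ℝ (fun z => k (x - z)) z (EuclideanSpace.single i 1) =
        - convX v (partialX i k) x y := by
      intro y
      rw [convX, ← integral_neg]
      congr 1; ext z
      rw [hk.fderiv_reflect, partialX]; ring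
    simp only [this, neg_mul, integral_neg] at hw
    rw [neg_inj.1 hw]
    exact sub_self _
  filter_upwards [key] with y hy
  exact sub_eq_zero.1 hy

/-- Nothing is known about v at y = 1. The cutoff removes the boundary value there, so that w is
recovered below the cutoff from integrals of w and of its vertical derivative alone. -/
theorem cutoff_mul_convX (h : SliceSol ρ Λ μ a d v g G) (hk : IsKernel ε k)
    {x : EuclideanSpace ℝ (Fin n)} (hx : x ∈ Metric.ball 0 (ρ - ε)) {χ : ℝ → ℝ}
    (hχ : ContDiff ℝ ∞ χ) (hS : ∃ S < 1, ∀ y ≥ S, χ y = 0) :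
    ∀ᵐ y ∂(volume.restrict (Ioo (0 : ℝ) 1)), χ y * convX v k x y =
      -∫ s in Ioo y 1, (χ s * convX g k x s + deriv χ s * convX v k x s) := by
  have hsub : tsupport (fun z => k (x - z)) ⊆ Metric.ball 0 ρ :=
    (hk.tsupport_reflect x).trans (Metric.closedBall_subset_ball' (by
      rw [Metric.mem_ball] at hx; linarith))
  exact eq_integral_of_weak_deriv (integrable_convX h.weight h.slices_v hk x)
    (integrable_convX h.weight h.slices_g hk x) hχ hS
    fun ζ z1 z2 z3 => h.weak_y _ (hk.contDiff_reflect x) (hk.hasCompactSupport_reflect x) hsub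
      ζ z1 z2 z3

/-- The tangential part `∑ aᵢⱼ ∂ᵢⱼ w` of the mollified equation. -/
noncomputable def source (a : Fin n → Fin n → ℝ → ℝ) (v : Pt n → ℝ)
    (k : EuclideanSpace ℝ (Fin n) → ℝ) (x : EuclideanSpace ℝ (Fin n)) (y : ℝ) : ℝ :=
  ∑ i, ∑ j, a i j y * convX v (partialX j (partialX i k)) x y

theorem integrable_a_mul (h : SliceSol ρ Λ μ a d v g G) {f : Pt n → ℝ} (hf : HasSlices μ f)
    (hk : IsKernel ε k) (x : EuclideanSpace ℝ (Fin n)) (i j : Fin n) :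
    IntegrableOn (fun y => a i j y * convX f k x y) (Ioo 0 1) :=
  integrable_mul_convX h.weight hf hk (h.a_meas i j).aestronglyMeasurable
    (by filter_upwards [h.abs_a_le] with y hy using hy i j) x

theorem integrable_d_mul (h : SliceSol ρ Λ μ a d v g G) {f : Pt n → ℝ} (hf : HasSlices μ f)
    (hk : IsKernel ε k) (x : EuclideanSpace ℝ (Fin n)) :
    IntegrableOn (fun y => d y * convX f k x y) (Ioo 0 1) :=
  integrable_mul_convX h.weight hf hk h.d_meas.aestronglyMeasurable h.abs_d_le x

theorem integrable_source (h : SliceSol ρ Λ μ a d v g G) (hk : IsKernel ε k)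
    (x : EuclideanSpace ℝ (Fin n)) : IntegrableOn (fun y => source a v k x y) (Ioo 0 1) :=
  integrable_finsetSum _ fun i _ => integrable_finsetSum _ fun j _ =>
    h.integrable_a_mul h.slices_v ((hk.partialX i).partialX j) x i j

/-- The flux of the mollified solution. -/
theorem flux_eq (h : SliceSol ρ Λ μ a d v g G) (hk : IsKernel ε k)
    {x : EuclideanSpace ℝ (Fin n)} (hx : x ∈ Metric.ball 0 (ρ - ε)) :
    ∀ᵐ y ∂(volume.restrict (Ioo (0 : ℝ) 1)),
      d y * convX g k x y = -∫ s in Ioo 0 y, source a v k x s := by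
  have hsub : tsupport (fun z => k (x - z)) ⊆ Metric.ball 0 ρ :=
    (hk.tsupport_reflect x).trans (Metric.closedBall_subset_ball' (by
      rw [Metric.mem_ball] at hx; linarith))
  -- The equation pairs G_j with one derivative of the kernel. Moving the other derivative onto the
  -- kernel too expresses the tangential part by v alone.
  have hcong : ∀ᵐ y ∂(volume.restrict (Ioo (0 : ℝ) 1)), ∀ i j,
      convX v (partialX j (partialX i k)) x y = convX (G j) (partialX i k) x y := by
    simp only [ae_all_iff]
    exact fun i j => h.convX_partialX (hk.partialX i) hx j
  have i1 := h.integrable_d_mul h.slices_g hk x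
  have i2 := h.integrable_source hk x
  refine eq_integral_of_weak_flux i1 i2 fun ζ z1 z2 => ?_
  have he := h.eq _ (hk.contDiff_reflect x) (hk.hasCompactSupport_reflect x) hsub ζ z1 z2
  have e1 : ∀ᵐ y ∂(volume.restrict (Ioo (0 : ℝ) 1)),
      ((∑ i, ∑ j, a i j y * ∫ z, G j (z, y) *
        fderiv ℝ (fun z => k (x - z)) z (EuclideanSpace.single i 1)) * ζ y +
        d y * (∫ z, g (z, y) * k (x - z)) * deriv ζ y) =
      d y * convX g k x y * deriv ζ y - source a v k x y * ζ y := by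
    filter_upwards [hcong] with y hy
    have : ∀ i j, ∫ z, G j (z, y) * fderiv ℝ (fun z => k (x - z)) z (EuclideanSpace.single i 1) =
        - convX v (partialX j (partialX i k)) x y := by
      intro i j
      rw [hy, convX, ← integral_neg]
      congr 1; ext z
      rw [hk.fderiv_reflect, partialX]; ring
    simp only [this, source, convX]
    simp only [mul_neg, Finset.sum_neg_distrib]
    ring
  rw [integral_congr_ae e1, integral_sub
    (i1.mul_continuous_Ioo (z1.continuous_deriv (by simp)))
    (i2.mul_continuous_Ioo z1.continuous)] at he
  exact sub_eq_zero.1 he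

/-- The mollified equation multiplied by `χ² w`, integrated in `y`. -/
theorem integral_flux_mul (h : SliceSol ρ Λ μ a d v g G) (hk : IsKernel ε k)
    {x : EuclideanSpace ℝ (Fin n)} (hx : x ∈ Metric.ball 0 (ρ - ε)) {χ : ℝ → ℝ}
    (hχ : ContDiff ℝ ∞ χ) (hS : ∃ S < 1, ∀ y ≥ S, χ y = 0) :
    ∫ y in Ioo (0 : ℝ) 1, d y * convX g k x y *
        (χ y ^ 2 * convX g k x y + 2 * χ y * deriv χ y * convX v k x y) =
      ∫ y in Ioo (0 : ℝ) 1, source a v k x y * (χ y ^ 2 * convX v k x y) := by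
  have hχ2 : ContDiff ℝ ∞ fun y => χ y ^ 2 := hχ.pow 2
  have hd2 : ∀ y, deriv (fun y => χ y ^ 2) y = 2 * χ y * deriv χ y := by
    intro y
    simpa using (((hχ.differentiable (by simp)) y).hasDerivAt.fun_pow 2).deriv
  have hcut := h.cutoff_mul_convX hk hx hχ2 (by
    obtain ⟨S, hS, h0⟩ := hS
    exact ⟨S, hS, fun y hy => by simp [h0 y hy]⟩)
  simp only [hd2] at hcut
  have hflux := h.flux_eq hk hx
  have i1 : IntegrableOn (fun y => χ y ^ 2 * convX g k x y + 2 * χ y * deriv χ y * convX v k x y)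
      (Ioo 0 1) := by
    have c1 : Continuous fun y => 2 * χ y * deriv χ y :=
      (continuous_const.mul hχ.continuous).mul (hχ.continuous_deriv (by simp))
    refine Integrable.add ?_ ?_
    · exact ((integrable_convX h.weight h.slices_g hk x).mul_continuous_Ioo hχ2.continuous).congr
        (Eventually.of_forall fun y => mul_comm _ _)
    · exact ((integrable_convX h.weight h.slices_v hk x).mul_continuous_Ioo c1).congr
        (Eventually.of_forall fun y => mul_comm _ _)
  -- The flux is a primitive from 0 and χ² w is minus a primitive ending at 1, so integration by
  -- parts in y is Fubini on a triangle and there are no boundary terms.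
  have hs := integral_mul_primitive_swap i1 (h.integrable_source hk x)
  have e1 : ∫ y in Ioo (0 : ℝ) 1, d y * convX g k x y *
        (χ y ^ 2 * convX g k x y + 2 * χ y * deriv χ y * convX v k x y) =
      -∫ y in Ioo (0 : ℝ) 1, (χ y ^ 2 * convX g k x y + 2 * χ y * deriv χ y * convX v k x y) *
        ∫ s in Ioo 0 y, source a v k x s := by
    rw [← integral_neg]
    refine integral_congr_ae ?_
    filter_upwards [hflux] with y hy
    rw [hy]; ring
  have e2 : ∫ y in Ioo (0 : ℝ) 1, source a v k x y * (χ y ^ 2 * convX v k x y) =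
      -∫ t in Ioo (0 : ℝ) 1, source a v k x t * ∫ y in Ioo t 1,
        (χ y ^ 2 * convX g k x y + 2 * χ y * deriv χ y * convX v k x y) := by
    rw [← integral_neg]
    refine integral_congr_ae ?_
    filter_upwards [hcut] with y hy
    rw [hy]; ring
  rw [e1, e2, hs]

end SliceSol

/-! ### The Caccioppoli inequality -/

/-- The weighted energy of the mollification `f * k` on `B_r × (0, s)`. -/
noncomputable def convEnergy {n : ℕ} (μ : ℝ → ℝ) (f : Pt n → ℝ)
    (k : EuclideanSpace ℝ (Fin n) → ℝ) (r s : ℝ) : ℝ≥0∞ :=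
  ∫⁻ X in Metric.ball (0 : EuclideanSpace ℝ (Fin n)) r ×ˢ Ioo 0 s,
    ENNReal.ofReal (μ X.2 * convX f k X.1 X.2 ^ 2)

/-- Absorbing the cross terms of a nonnegative quadratic form. -/
theorem quadForm_absorb {n : ℕ} {a : Fin n → Fin n → ℝ} {d : ℝ} (hs : ∀ i j, a i j = a j i)
    (hpos : ∀ (ξ : Fin n → ℝ) (t : ℝ), 0 ≤ ∑ i, ∑ j, a i j * ξ i * ξ j + d * t ^ 2)
    (ξ β : Fin n → ℝ) (t s η w : ℝ) :
    η ^ 2 * (∑ i, ∑ j, a i j * ξ i * ξ j + d * t ^ 2) ≤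
      2 * (η ^ 2 * (∑ i, ∑ j, a i j * ξ i * ξ j + d * t ^ 2) +
        2 * η * w * (∑ i, ∑ j, a i j * ξ i * β j + d * t * s)) +
      4 * w ^ 2 * (∑ i, ∑ j, a i j * β i * β j + d * s ^ 2) := by
  -- With Q the form in all variables, the claim is exactly 0 ≤ Q(η ξ + 2 w β) = η² Q(ξ) + 4 η w
  -- Q(ξ, β) + 4 w² Q(β), after adding η² Q(ξ) to both sides.
  have h := hpos (fun i => η * ξ i + 2 * w * β i) (η * t + 2 * w * s)
  have hsym : ∑ i, ∑ j, a i j * β i * ξ j = ∑ i, ∑ j, a i j * ξ i * β j := by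
    rw [Finset.sum_comm]
    refine Finset.sum_congr rfl fun i _ => Finset.sum_congr rfl fun j _ => ?_
    rw [hs j i]; ring
  have e : ∑ i, ∑ j, a i j * (η * ξ i + 2 * w * β i) * (η * ξ j + 2 * w * β j) =
      η ^ 2 * ∑ i, ∑ j, a i j * ξ i * ξ j + 2 * η * w * ∑ i, ∑ j, a i j * ξ i * β j +
      2 * η * w * ∑ i, ∑ j, a i j * β i * ξ j + 4 * w ^ 2 * ∑ i, ∑ j, a i j * β i * β j := by
    simp only [Finset.mul_sum, ← Finset.sum_add_distrib]
    refine Finset.sum_congr rfl fun i _ => Finset.sum_congr rfl fun j _ => ?_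
    ring
  rw [e, hsym] at h
  linarith

/-- A smooth cutoff in `y`. -/
theorem exists_cutoff {s S : ℝ} (hsS : s < S) : ∃ χ : ℝ → ℝ, ContDiff ℝ ∞ χ ∧
    (∀ y ≤ s, χ y = 1) ∧ (∀ y ≥ S, χ y = 0) ∧ ∀ y, 0 ≤ χ y ∧ χ y ≤ 1 := by
  refine ⟨fun y => Real.smoothTransition ((S - y) / (S - s)), ?_, fun y hy => ?_, fun y hy => ?_,
    fun y => ⟨Real.smoothTransition.nonneg _, Real.smoothTransition.le_one _⟩⟩
  · exact Real.smoothTransition.contDiff.comp ((contDiff_const.sub contDiff_id).div_const _)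
  · exact Real.smoothTransition.one_of_one_le ((one_le_div (by linarith)).2 (by linarith))
  · exact Real.smoothTransition.zero_of_nonpos
      (div_nonpos_of_nonpos_of_nonneg (by linarith) (by linarith))

namespace SliceSol

variable {n : ℕ} {ρ Λ : ℝ} {μ : ℝ → ℝ} {a : Fin n → Fin n → ℝ → ℝ} {d : ℝ → ℝ}
  {v g : Pt n → ℝ} {G : Fin n → Pt n → ℝ} {ε : ℝ} {k : EuclideanSpace ℝ (Fin n) → ℝ}

/-- Integration by parts in `x` of the term with two derivatives. -/
theorem integral_mul_second_derivative (h : SliceSol ρ Λ μ a d v g G) (hk : IsKernel ε k)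
    {α : EuclideanSpace ℝ (Fin n) → ℝ} (hα : ContDiff ℝ ∞ α) (hαc : HasCompactSupport α)
    {m : ℝ → ℝ} (hm : AEStronglyMeasurable m (volume.restrict (Ioo 0 1))) {C : ℝ}
    (hC : ∀ᵐ y ∂(volume.restrict (Ioo (0 : ℝ) 1)), |m y| ≤ C * μ y) (i j : Fin n) :
    ∫ X, α X.1 ^ 2 * (m X.2 * (convX v (partialX j (partialX i k)) X.1 X.2 * convX v k X.1 X.2))
        ∂((volume : Measure (EuclideanSpace ℝ (Fin n))).prod (volume.restrict (Ioo (0 : ℝ) 1))) =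
      -(∫ X, (2 * α X.1 * partialX j α X.1) *
          (m X.2 * (convX v (partialX i k) X.1 X.2 * convX v k X.1 X.2))
        ∂((volume : Measure (EuclideanSpace ℝ (Fin n))).prod (volume.restrict (Ioo (0 : ℝ) 1)))) -
      ∫ X, α X.1 ^ 2 *
          (m X.2 * (convX v (partialX i k) X.1 X.2 * convX v (partialX j k) X.1 X.2))
        ∂((volume : Measure (EuclideanSpace ℝ (Fin n))).prod (volume.restrict (Ioo (0 : ℝ) 1))) := by
  have hv := h.slices_v
  have hα1 : Continuous (partialX j α) := by
    exact (hα.continuous_fderiv (by simp)).clm_apply continuous_const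
  have a1 : Integrable fun x => α x ^ 2 := by
    have : HasCompactSupport fun x => α x * α x := hαc.mul_left
    simp only [sq]
    exact (hα.continuous.mul hα.continuous).integrable_of_hasCompactSupport this
  have a2 : Integrable fun x => 2 * α x * partialX j α x := by
    have : HasCompactSupport fun x => 2 * α x * partialX j α x :=
      (hαc.mul_left (f := fun _ => (2 : ℝ))).mul_right
    exact ((continuous_const.mul hα.continuous).mul hα1).integrable_of_hasCompactSupport this
  have I1 := integrable_mul_convX_mul_convX h.weight hv hv ((hk.partialX i).partialX j) hk a1 hm hC
  have I2 := integrable_mul_convX_mul_convX h.weight hv hv (hk.partialX i) hk a2 hm hC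
  have I3 := integrable_mul_convX_mul_convX h.weight hv hv (hk.partialX i) (hk.partialX j) a1 hm hC
  rw [integral_prod_symm _ I1, integral_prod_symm _ I2, integral_prod_symm _ I3, ← integral_neg,
    ← integral_sub I2.integral_prod_right.fun_neg I3.integral_prod_right]
  refine integral_congr_ae ?_
  filter_upwards [I2.prod_left_ae, I3.prod_left_ae] with y hy2 hy3
  have c0 := contDiff_convX hv hk y
  have c1 := contDiff_convX hv (hk.partialX i) y
  have c2 := contDiff_convX hv (hk.partialX j) y
  have c3 := contDiff_convX hv ((hk.partialX i).partialX j) y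
  have cp : ContDiff ℝ ∞ fun x => α x ^ 2 * convX v k x y := (hα.pow 2).mul c0
  have cps : HasCompactSupport fun x => α x ^ 2 * convX v k x y := by
    have : HasCompactSupport fun x => α x * (α x * convX v k x y) := hαc.mul_right
    simpa [sq, mul_assoc] using this
  have hder : ∀ x, fderiv ℝ (fun x => α x ^ 2 * convX v k x y) x (EuclideanSpace.single j 1) =
      2 * α x * partialX j α x * convX v k x y + α x ^ 2 * convX v (partialX j k) x y := by
    intro x
    have d1 := (((hα.differentiable (by simp)) x).hasFDerivAt.pow 2).mul
      ((c0.differentiable (by simp)) x).hasFDerivAt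
    have d2 : HasFDerivAt (fun x => α x ^ 2 * convX v k x y) _ x := d1
    rw [d2.fderiv, ← fderiv_convX hv hk]
    simp [partialX]
    ring
  -- At a fixed height everything is smooth in x and α² w has compact support, so one x-derivative
  -- is moved from ∂_ij w onto α² w. The coefficient m(y) is constant in x and comes along.
  have ibp := integral_mul_fderiv_eq_neg_fderiv_mul_of_integrable (μ := volume)
    (f := fun x => α x ^ 2 * convX v k x y)
    (g := fun x => convX v (partialX i k) x y) (v := EuclideanSpace.single j 1)
    (by
      refine Continuous.integrable_of_hasCompactSupport ?_ ?_
      · exact ((cp.continuous_fderiv (by simp)).clm_apply continuous_const).mul c1.continuous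
      · exact (cps.fderiv_apply ℝ _).mul_right)
    (by
      refine Continuous.integrable_of_hasCompactSupport ?_ cps.mul_right
      exact cp.continuous.mul ((c1.continuous_fderiv (by simp)).clm_apply continuous_const))
    ((cp.continuous.mul c1.continuous).integrable_of_hasCompactSupport cps.mul_right)
    (fun x _ => (cp.differentiable (by simp)) x) (fun x _ => (c1.differentiable (by simp)) x)
  simp only [hder, fderiv_convX hv (hk.partialX i)] at ibp
  have e1 : ∫ x, α x ^ 2 * (m y * (convX v (partialX j (partialX i k)) x y * convX v k x y)) =
      m y * ∫ x, α x ^ 2 * convX v k x y * convX v (partialX j (partialX i k)) x y := by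
    rw [← integral_const_mul]
    congr 1; ext x; ring
  rw [e1, ibp, mul_neg, ← integral_const_mul, ← integral_neg, ← integral_neg,
    ← integral_sub hy2.fun_neg hy3]
  congr 1; ext x
  ring

/-- The mollified equation tested with `α² χ² w`. -/
theorem energy_identity (h : SliceSol ρ Λ μ a d v g G) (hk : IsKernel ε k)
    {α : EuclideanSpace ℝ (Fin n) → ℝ} (hα : ContDiff ℝ ∞ α) (hαc : HasCompactSupport α)
    (hαs : ∀ x, x ∉ Metric.ball 0 (ρ - ε) → α x = 0)
    {χ : ℝ → ℝ} (hχ : ContDiff ℝ ∞ χ) (hS : ∃ S < 1, ∀ y ≥ S, χ y = 0) :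
    let F : Pt n → ℝ := fun X =>
      (α X.1 * χ X.2) ^ 2 * (∑ i, ∑ j, a i j X.2 * convX v (partialX i k) X.1 X.2 *
        convX v (partialX j k) X.1 X.2 + d X.2 * convX g k X.1 X.2 ^ 2) +
      2 * (α X.1 * χ X.2) * convX v k X.1 X.2 *
        (∑ i, ∑ j, a i j X.2 * convX v (partialX i k) X.1 X.2 * (χ X.2 * partialX j α X.1) +
          d X.2 * convX g k X.1 X.2 * (α X.1 * deriv χ X.2))
    Integrable F (volume.prod (volume.restrict (Ioo (0 : ℝ) 1))) ∧
      ∫ X, F X ∂(volume.prod (volume.restrict (Ioo (0 : ℝ) 1))) = 0 := by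
  intro F
  have hv := h.slices_v
  have hg := h.slices_g
  have hχ' : Continuous (deriv χ) := hχ.continuous_deriv (by simp)
  have hα1 : ∀ j, Continuous (partialX j α) := fun j =>
    (hα.continuous_fderiv (by simp)).clm_apply continuous_const
  have a1 : Integrable fun x => α x ^ 2 := by
    have : HasCompactSupport fun x => α x * α x := hαc.mul_left
    simp only [sq]
    exact (hα.continuous.mul hα.continuous).integrable_of_hasCompactSupport this
  have a2 : ∀ j, Integrable fun x => 2 * α x * partialX j α x := fun j => by
    have : HasCompactSupport fun x => 2 * α x * partialX j α x :=
      (hαc.mul_left (f := fun _ => (2 : ℝ))).mul_right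
    exact ((continuous_const.mul hα.continuous).mul (hα1 j)).integrable_of_hasCompactSupport this
  obtain ⟨K1, hK1⟩ := (hχ.continuous.pow 2).bddOn_Icc 0 1
  obtain ⟨K2, hK2⟩ := ((continuous_const (y := (2 : ℝ))).mul
    (hχ.continuous.mul hχ')).bddOn_Icc 0 1
  have m1 : ∀ᵐ y ∂(volume.restrict (Ioo (0 : ℝ) 1)), |d y * χ y ^ 2| ≤ K1 * Λ * μ y := by
    filter_upwards [h.abs_d_le, ae_restrict_mem measurableSet_Ioo] with y h1 h2
    have h3 := hK1 y (Ioo_subset_Icc_self h2)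
    rw [abs_mul]
    calc _ ≤ (Λ * μ y) * K1 := mul_le_mul h1 h3 (abs_nonneg _) ((abs_nonneg _).trans h1)
      _ = _ := by ring
  have m2 : ∀ᵐ y ∂(volume.restrict (Ioo (0 : ℝ) 1)),
      |d y * (2 * (χ y * deriv χ y))| ≤ K2 * Λ * μ y := by
    filter_upwards [h.abs_d_le, ae_restrict_mem measurableSet_Ioo] with y h1 h2
    have h3 := hK2 y (Ioo_subset_Icc_self h2)
    rw [abs_mul]
    calc _ ≤ (Λ * μ y) * K2 := mul_le_mul h1 h3 (abs_nonneg _) ((abs_nonneg _).trans h1)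
      _ = _ := by ring
  have m3 : ∀ i j, ∀ᵐ y ∂(volume.restrict (Ioo (0 : ℝ) 1)),
      |a i j y * χ y ^ 2| ≤ K1 * (2 * Λ) * μ y := by
    intro i j
    filter_upwards [h.abs_a_le, ae_restrict_mem measurableSet_Ioo] with y h1 h2
    have h3 := hK1 y (Ioo_subset_Icc_self h2)
    rw [abs_mul]
    calc _ ≤ (2 * Λ * μ y) * K1 :=
          mul_le_mul (h1 i j) h3 (abs_nonneg _) ((abs_nonneg _).trans (h1 i j))
      _ = _ := by ring
  have s1 : AEStronglyMeasurable (fun y => d y * χ y ^ 2) (volume.restrict (Ioo 0 1)) :=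
    h.d_meas.aestronglyMeasurable.mul (hχ.continuous.pow 2).aestronglyMeasurable
  have s2 : AEStronglyMeasurable (fun y => d y * (2 * (χ y * deriv χ y)))
      (volume.restrict (Ioo 0 1)) := h.d_meas.aestronglyMeasurable.mul
    (continuous_const.mul (hχ.continuous.mul hχ')).aestronglyMeasurable
  have s3 : ∀ i j, AEStronglyMeasurable (fun y => a i j y * χ y ^ 2)
      (volume.restrict (Ioo 0 1)) := fun i j =>
    (h.a_meas i j).aestronglyMeasurable.mul (hχ.continuous.pow 2).aestronglyMeasurable
  have I1 := integrable_mul_convX_mul_convX h.weight hg hg hk hk a1 s1 m1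
  have I2 := integrable_mul_convX_mul_convX h.weight hg hv hk hk a1 s2 m2
  have I3 := fun i j => integrable_mul_convX_mul_convX h.weight hv hv (hk.partialX i)
    (hk.partialX j) a1 (s3 i j) (m3 i j)
  have I4 := fun i j => integrable_mul_convX_mul_convX h.weight hv hv (hk.partialX i)
    hk (a2 j) (s3 i j) (m3 i j)
  have I5 := fun i j => integrable_mul_convX_mul_convX h.weight hv hv
    ((hk.partialX i).partialX j) hk a1 (s3 i j) (m3 i j)
  have hF : F = fun X : Pt n =>
      (α X.1 ^ 2 * (d X.2 * χ X.2 ^ 2 * (convX g k X.1 X.2 * convX g k X.1 X.2)) +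
      α X.1 ^ 2 * (d X.2 * (2 * (χ X.2 * deriv χ X.2)) *
        (convX g k X.1 X.2 * convX v k X.1 X.2))) +
      ∑ i, ∑ j, (α X.1 ^ 2 * (a i j X.2 * χ X.2 ^ 2 *
        (convX v (partialX i k) X.1 X.2 * convX v (partialX j k) X.1 X.2)) +
        2 * α X.1 * partialX j α X.1 * (a i j X.2 * χ X.2 ^ 2 *
        (convX v (partialX i k) X.1 X.2 * convX v k X.1 X.2))) := by
    ext X
    simp only [F, mul_add, Finset.mul_sum, Finset.sum_add_distrib]
    have b1 : ∀ i j, (α X.1 * χ X.2) ^ 2 * (a i j X.2 * convX v (partialX i k) X.1 X.2 *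
        convX v (partialX j k) X.1 X.2) = α X.1 ^ 2 * (a i j X.2 * χ X.2 ^ 2 *
        (convX v (partialX i k) X.1 X.2 * convX v (partialX j k) X.1 X.2)) := fun i j => by ring
    have b2 : ∀ i j, 2 * (α X.1 * χ X.2) * convX v k X.1 X.2 * (a i j X.2 *
        convX v (partialX i k) X.1 X.2 * (χ X.2 * partialX j α X.1)) =
        2 * α X.1 * partialX j α X.1 * (a i j X.2 * χ X.2 ^ 2 *
        (convX v (partialX i k) X.1 X.2 * convX v k X.1 X.2)) := fun i j => by ring
    simp only [b1, b2]
    ring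
  have IS := integrable_finsetSum Finset.univ fun i _ => integrable_finsetSum Finset.univ
    fun j _ => (I3 i j).fun_add (I4 i j)
  refine ⟨by rw [hF]; exact (I1.fun_add I2).add IS, ?_⟩
  -- The tangential terms of F are put back into the form with second derivatives of w. For each x
  -- what remains is α² times the difference of the two sides of `integral_flux_mul`, hence zero.
  have hsum : ∫ X, F X ∂(volume.prod (volume.restrict (Ioo (0 : ℝ) 1))) =
      (∫ X : Pt n, α X.1 ^ 2 * (d X.2 * χ X.2 ^ 2 * (convX g k X.1 X.2 * convX g k X.1 X.2))
        ∂(volume.prod (volume.restrict (Ioo (0 : ℝ) 1)))) +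
      (∫ X : Pt n, α X.1 ^ 2 * (d X.2 * (2 * (χ X.2 * deriv χ X.2)) *
        (convX g k X.1 X.2 * convX v k X.1 X.2))
        ∂(volume.prod (volume.restrict (Ioo (0 : ℝ) 1)))) -
      ∑ i, ∑ j, ∫ X : Pt n, α X.1 ^ 2 * (a i j X.2 * χ X.2 ^ 2 *
        (convX v (partialX j (partialX i k)) X.1 X.2 * convX v k X.1 X.2))
        ∂(volume.prod (volume.restrict (Ioo (0 : ℝ) 1))) := by
    rw [hF, integral_add (I1.fun_add I2) IS, integral_add I1 I2,
      integral_finsetSum _ fun i _ => integrable_finsetSum Finset.univ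
        fun j _ => (I3 i j).fun_add (I4 i j), sub_eq_add_neg, ← Finset.sum_neg_distrib]
    congr 1
    refine Finset.sum_congr rfl fun i _ => ?_
    rw [integral_finsetSum _ fun j _ => (I3 i j).fun_add (I4 i j), ← Finset.sum_neg_distrib]
    refine Finset.sum_congr rfl fun j _ => ?_
    rw [h.integral_mul_second_derivative hk hα hαc (s3 i j) (m3 i j) i j]
    rw [integral_add (I3 i j) (I4 i j)]
    ring
  have IS5 := integrable_finsetSum Finset.univ fun i _ => integrable_finsetSum Finset.univ
    fun j _ => (I5 i j)
  rw [hsum]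
  have : ∑ i, ∑ j, ∫ X : Pt n, α X.1 ^ 2 * (a i j X.2 * χ X.2 ^ 2 *
        (convX v (partialX j (partialX i k)) X.1 X.2 * convX v k X.1 X.2))
        ∂(volume.prod (volume.restrict (Ioo (0 : ℝ) 1))) =
      ∫ X : Pt n, ∑ i, ∑ j, α X.1 ^ 2 * (a i j X.2 * χ X.2 ^ 2 *
        (convX v (partialX j (partialX i k)) X.1 X.2 * convX v k X.1 X.2))
        ∂(volume.prod (volume.restrict (Ioo (0 : ℝ) 1))) := by
    rw [integral_finsetSum _ fun i _ => integrable_finsetSum Finset.univ fun j _ => I5 i j]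
    refine Finset.sum_congr rfl fun i _ => ?_
    rw [integral_finsetSum _ fun j _ => I5 i j]
  rw [this, ← integral_add I1 I2, ← integral_sub (I1.fun_add I2) IS5,
    integral_prod _ ((I1.fun_add I2).sub' IS5)]
  refine integral_eq_zero_of_ae ?_
  filter_upwards [(I1.fun_add I2).prod_right_ae, IS5.prod_right_ae] with x hx1 hx2
  by_cases hx : x ∈ Metric.ball 0 (ρ - ε)
  · have hz := h.integral_flux_mul hk hx hχ hS
    rw [Pi.zero_apply, integral_sub hx1 hx2]
    have e1 : ∀ y, α x ^ 2 * (d y * χ y ^ 2 * (convX g k x y * convX g k x y)) +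
        α x ^ 2 * (d y * (2 * (χ y * deriv χ y)) * (convX g k x y * convX v k x y)) =
        α x ^ 2 * (d y * convX g k x y *
          (χ y ^ 2 * convX g k x y + 2 * χ y * deriv χ y * convX v k x y)) := fun y => by ring
    have e2 : ∀ y, ∑ i, ∑ j, α x ^ 2 * (a i j y * χ y ^ 2 *
        (convX v (partialX j (partialX i k)) x y * convX v k x y)) =
        α x ^ 2 * (source a v k x y * (χ y ^ 2 * convX v k x y)) := fun y => by
      simp only [source, Finset.mul_sum, Finset.sum_mul]
      refine Finset.sum_congr rfl fun i _ => Finset.sum_congr rfl fun j _ => ?_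
      ring
    simp only [e1, e2, integral_const_mul, hz, sub_self]
  · simp [hαs x hx]

/-- The Caccioppoli inequality for the mollified solutions. -/
theorem exists_caccioppoli (n : ℕ) {Λ r R s S : ℝ} (hr : 0 < r) (hrR : r < R)
    (hsS : s < S) (hS1 : S ≤ 1) :
    ∃ C : ℝ≥0∞, C ≠ ⊤ ∧ ∀ {ρ : ℝ} {μ : ℝ → ℝ} {a : Fin n → Fin n → ℝ → ℝ} {d : ℝ → ℝ}
      {v g : Pt n → ℝ} {G : Fin n → Pt n → ℝ} {ε : ℝ} {k : EuclideanSpace ℝ (Fin n) → ℝ},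
      SliceSol ρ Λ μ a d v g G → IsKernel ε k → R + ε ≤ ρ →
      convEnergy μ g k r s ≤ C * convEnergy μ v k R S ∧
      ∀ i, convEnergy μ v (partialX i k) r s ≤ C * convEnergy μ v k R S := by
  -- Both cutoffs are already zero at the midpoints of (s, S) and (r, R). Hence their derivatives
  -- vanish too for y ≥ S and outside the ball of radius R.
  obtain ⟨χ, hχ, hχ1, hχ0, hχb⟩ := exists_cutoff (show s < (s + S) / 2 by linarith)
  have hχ' : Continuous (deriv χ) := hχ.continuous_deriv (by simp)
  let α : ContDiffBump (0 : EuclideanSpace ℝ (Fin n)) := ⟨r, (r + R) / 2, hr, by linarith⟩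
  have hα : ContDiff ℝ ∞ α := α.contDiff
  have hαc : HasCompactSupport α := α.hasCompactSupport
  have hα0 : ∀ x, x ∉ Metric.ball (0 : EuclideanSpace ℝ (Fin n)) R → α x = 0 := by
    intro x hx
    refine α.zero_of_le_dist ?_
    simp only [Metric.mem_ball, not_lt] at hx
    simp only [α]; linarith
  have hαd0 : ∀ x, x ∉ Metric.ball (0 : EuclideanSpace ℝ (Fin n)) R → ∀ j,
      partialX j α x = 0 := by
    intro x hx j
    have h1 : x ∉ tsupport α := by
      rw [α.tsupport_eq, Metric.mem_closedBall]
      simp only [Metric.mem_ball, not_lt] at hx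
      simp only [α]; linarith
    have := image_eq_zero_of_notMem_tsupport fun h => h1 (tsupport_fderiv_subset ℝ h)
    simp [partialX, this]
  have hα1 : ∀ j, Continuous (partialX j α) := fun j =>
    (hα.continuous_fderiv (by simp)).clm_apply continuous_const
  obtain ⟨K, hK⟩ : ∃ K : ℝ, ∀ x : EuclideanSpace ℝ (Fin n), ∀ y ∈ Icc (0 : ℝ) 1,
      ∑ j, (χ y * partialX j α x) ^ 2 + (α x * deriv χ y) ^ 2 ≤ K := by
    obtain ⟨K, hK⟩ := ((isCompact_closedBall (0 : EuclideanSpace ℝ (Fin n)) R).prod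
      (isCompact_Icc (a := (0 : ℝ)) (b := 1))).exists_bound_of_continuousOn
      (f := fun X : Pt n => ∑ j, (χ X.2 * partialX j α X.1) ^ 2 + (α X.1 * deriv χ X.2) ^ 2)
      (by
        refine Continuous.continuousOn (Continuous.add (continuous_finsetSum _ fun j _ => ?_) ?_)
        · exact ((hχ.continuous.comp continuous_snd).mul ((hα1 j).comp continuous_fst)).pow 2
        · exact ((hα.continuous.comp continuous_fst).mul (hχ'.comp continuous_snd)).pow 2)
    refine ⟨max K 0, fun x y hy => ?_⟩
    by_cases hx : x ∈ Metric.ball (0 : EuclideanSpace ℝ (Fin n)) R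
    · exact (le_abs_self _).trans ((hK (x, y) ⟨Metric.ball_subset_closedBall hx, hy⟩).trans
        (le_max_left _ _))
    · simp [hα0 x hx, hαd0 x hx]
  -- The error term left by `quadForm_absorb` is 4 w² Q(β) ≤ 4 Λ K μ w², where K bounds the squared
  -- derivatives of the cutoffs. Another factor Λ comes from the lower ellipticity bound. K depends
  -- on the cutoffs only, so the constant is chosen before the weight, the coefficients and the
  -- solution.
  refine ⟨ENNReal.ofReal (4 * Λ ^ 2 * K), ENNReal.ofReal_ne_top, ?_⟩
  intro ρ μ a d v g G ε k h hk hRε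
  have hv := h.slices_v
  have hg := h.slices_g
  have hsub : ∀ x, x ∉ Metric.ball (0 : EuclideanSpace ℝ (Fin n)) (ρ - ε) → α x = 0 :=
    fun x hx => hα0 x fun hx' => hx (Metric.ball_subset_ball (by linarith) hx')
  set ν : Measure ℝ := volume.restrict (Ioo (0 : ℝ) 1) with hν
  obtain ⟨F, hF', hFi, hF0⟩ : ∃ F : Pt n → ℝ, (∀ X, F X = (α X.1 * χ X.2) ^ 2 *
        (∑ i, ∑ j, a i j X.2 * convX v (partialX i k) X.1 X.2 *
        convX v (partialX j k) X.1 X.2 + d X.2 * convX g k X.1 X.2 ^ 2) +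
      2 * (α X.1 * χ X.2) * convX v k X.1 X.2 *
        (∑ i, ∑ j, a i j X.2 * convX v (partialX i k) X.1 X.2 * (χ X.2 * partialX j α X.1) +
          d X.2 * convX g k X.1 X.2 * (α X.1 * deriv χ X.2))) ∧
      Integrable F (volume.prod ν) ∧ ∫ X, F X ∂(volume.prod ν) = 0 :=
    ⟨_, fun _ => rfl, h.energy_identity hk hα hαc hsub hχ ⟨(s + S) / 2, by linarith, hχ0⟩⟩
  have hΛ := h.pos
  -- the error term
  have IE : Integrable (fun X : Pt n => (Metric.ball (0 : EuclideanSpace ℝ (Fin n)) R).indicator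
      (fun _ => (1 : ℝ)) X.1 * ((Iio S).indicator (fun _ => (1 : ℝ)) X.2 * μ X.2 *
        (convX v k X.1 X.2 * convX v k X.1 X.2))) (volume.prod ν) := by
    refine integrable_mul_convX_mul_convX (C := 1)
      (α := (Metric.ball (0 : EuclideanSpace ℝ (Fin n)) R).indicator fun _ => (1 : ℝ))
      (m := fun y => (Iio S).indicator (fun _ => (1 : ℝ)) y * μ y)
      h.weight hv hv hk hk ?_ ?_ ?_
    · exact (integrable_indicator_iff Metric.isOpen_ball.measurableSet).2
        (integrableOn_const (measure_ball_lt_top.ne))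
    · exact (measurable_const.indicator measurableSet_Iio).aestronglyMeasurable.mul
        h.weight.integrable.aestronglyMeasurable
    · filter_upwards [h.weight.pos] with y hy
      by_cases hyS : y ∈ Iio S <;> simp [hyS, abs_of_pos hy, hy.le]
  set E : Pt n → ℝ := fun X => (Metric.ball (0 : EuclideanSpace ℝ (Fin n)) R).indicator
      (fun _ => (1 : ℝ)) X.1 * ((Iio S).indicator (fun _ => (1 : ℝ)) X.2 * μ X.2 *
        (convX v k X.1 X.2 * convX v k X.1 X.2)) with hE
  have hEpos : ∀ᵐ X ∂(volume.prod ν), 0 ≤ E X := by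
    have := Measure.quasiMeasurePreserving_snd
      (μ := (volume : Measure (EuclideanSpace ℝ (Fin n)))) (ν := ν) |>.ae h.weight.pos
    filter_upwards [this] with X hX
    refine mul_nonneg (indicator_nonneg (fun _ _ => zero_le_one) _) (mul_nonneg (mul_nonneg
      (indicator_nonneg (fun _ _ => zero_le_one) _) hX.le) (mul_self_nonneg _))
  -- Once this pointwise inequality is integrated, the multiple of F disappears since ∫ F = 0, and
  -- only the error term supported in the larger cylinder is left.
  have hpt : ∀ᵐ X ∂(volume.prod ν), (α X.1 * χ X.2) ^ 2 * μ X.2 *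
      (∑ i, convX v (partialX i k) X.1 X.2 ^ 2 + convX g k X.1 X.2 ^ 2) ≤
      2 * Λ * F X + 4 * Λ ^ 2 * K * E X := by
    have hell := Measure.quasiMeasurePreserving_snd
      (μ := (volume : Measure (EuclideanSpace ℝ (Fin n)))) (ν := ν) |>.ae
      (h.elliptic.and (h.symm.and (h.weight.pos.and (ae_restrict_mem measurableSet_Ioo))))
    filter_upwards [hell, hEpos] with X hX hEX
    obtain ⟨h1, h2, h3, h4⟩ := hX
    have hpos : ∀ (ξ : Fin n → ℝ) (t : ℝ), 0 ≤ ∑ i, ∑ j, a i j X.2 * ξ i * ξ j + d X.2 * t ^ 2 :=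
      fun ξ t => le_trans (by have := inv_pos.2 hΛ; positivity) (h1 ξ t).1
    have hab := quadForm_absorb h2 hpos (fun i => convX v (partialX i k) X.1 X.2)
      (fun j => χ X.2 * partialX j α X.1) (convX g k X.1 X.2) (α X.1 * deriv χ X.2)
      (α X.1 * χ X.2) (convX v k X.1 X.2)
    have hlow := (h1 (fun i => convX v (partialX i k) X.1 X.2) (convX g k X.1 X.2)).1
    have hup := (h1 (fun j => χ X.2 * partialX j α X.1) (α X.1 * deriv χ X.2)).2
    have hKX := hK X.1 X.2 (Ioo_subset_Icc_self h4)
    have herr : convX v k X.1 X.2 ^ 2 * (∑ i, ∑ j, a i j X.2 * (χ X.2 * partialX i α X.1) *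
        (χ X.2 * partialX j α X.1) + d X.2 * (α X.1 * deriv χ X.2) ^ 2) ≤ Λ * K * E X := by
      by_cases hx : X.1 ∈ Metric.ball (0 : EuclideanSpace ℝ (Fin n)) R ∧ X.2 ∈ Iio S
      · have e1 : E X = μ X.2 * convX v k X.1 X.2 ^ 2 := by
          simp only [hE, indicator_of_mem hx.1, indicator_of_mem hx.2]; ring
        rw [e1]
        calc _ ≤ convX v k X.1 X.2 ^ 2 * (Λ * μ X.2 * K) := by
              refine mul_le_mul_of_nonneg_left (hup.trans ?_) (sq_nonneg _)
              exact mul_le_mul_of_nonneg_left hKX (by positivity)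
          _ = _ := by ring
      · have hz : (∀ j, χ X.2 * partialX j α X.1 = 0) ∧ α X.1 * deriv χ X.2 = 0 := by
          rw [not_and_or] at hx
          rcases hx with hx | hx
          · exact ⟨fun j => by rw [hαd0 _ hx, mul_zero], by rw [hα0 _ hx, zero_mul]⟩
          · have hy : S ≤ X.2 := not_lt.1 hx
            have hev : χ =ᶠ[𝓝 X.2] fun _ => 0 := by
              filter_upwards [Ioi_mem_nhds (show (s + S) / 2 < X.2 by linarith)] with y hy
              exact hχ0 y (le_of_lt hy)
            exact ⟨fun j => by rw [hχ0 _ (by linarith), zero_mul], by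
              rw [hev.deriv_eq]; simp⟩
        have hK0 : 0 ≤ K := le_trans (by positivity) hKX
        have : ∑ i, ∑ j, a i j X.2 * (χ X.2 * partialX i α X.1) *
            (χ X.2 * partialX j α X.1) + d X.2 * (α X.1 * deriv χ X.2) ^ 2 = 0 := by
          simp [hz.1, hz.2]
        rw [this, mul_zero]
        positivity
    rw [← hF'] at hab
    have hl2 := mul_le_mul_of_nonneg_left hlow (sq_nonneg (α X.1 * χ X.2))
    have hfin : (α X.1 * χ X.2) ^ 2 * (Λ⁻¹ * μ X.2 *
        (∑ i, convX v (partialX i k) X.1 X.2 ^ 2 + convX g k X.1 X.2 ^ 2)) ≤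
        2 * F X + 4 * (Λ * K * E X) := by
      refine hl2.trans (hab.trans ?_)
      have := mul_le_mul_of_nonneg_left herr (show (0 : ℝ) ≤ 4 by norm_num)
      linarith
    have hm := mul_le_mul_of_nonneg_left hfin hΛ.le
    have e1 : Λ * ((α X.1 * χ X.2) ^ 2 * (Λ⁻¹ * μ X.2 *
        (∑ i, convX v (partialX i k) X.1 X.2 ^ 2 + convX g k X.1 X.2 ^ 2))) =
        (α X.1 * χ X.2) ^ 2 * μ X.2 *
        (∑ i, convX v (partialX i k) X.1 X.2 ^ 2 + convX g k X.1 X.2 ^ 2) := by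
      field_simp
    rw [e1] at hm
    refine hm.trans (le_of_eq ?_)
    ring
  have hvolp : ∀ A : Set (EuclideanSpace ℝ (Fin n)), ∀ t ≤ 1, (volume : Measure (Pt n)).restrict
      (A ×ˢ Ioo 0 t) ≤ volume.prod ν := by
    intro A t ht
    have : (volume : Measure (EuclideanSpace ℝ (Fin n))).prod ν =
        (volume : Measure (Pt n)).restrict (univ ×ˢ Ioo 0 1) := by
      rw [Measure.volume_eq_prod, ← Measure.prod_restrict, Measure.restrict_univ]
    rw [this]
    exact Measure.restrict_mono (prod_mono (subset_univ _) (Ioo_subset_Ioo_right ht)) le_rfl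
  have hE2 : ENNReal.ofReal (∫ X, E X ∂(volume.prod ν)) ≤ convEnergy μ v k R S := by
    rw [ofReal_integral_eq_lintegral_ofReal IE hEpos, convEnergy]
    have hν' : (volume : Measure (EuclideanSpace ℝ (Fin n))).prod ν =
        (volume : Measure (Pt n)).restrict (univ ×ˢ Ioo 0 1) := by
      rw [Measure.volume_eq_prod, ← Measure.prod_restrict, Measure.restrict_univ]
    rw [hν', ← lintegral_indicator (MeasurableSet.univ.prod measurableSet_Ioo),
      ← lintegral_indicator (Metric.isOpen_ball.measurableSet.prod measurableSet_Ioo)]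
    refine lintegral_mono fun X => ?_
    by_cases h1 : X.1 ∈ Metric.ball (0 : EuclideanSpace ℝ (Fin n)) R <;>
      by_cases h2 : X.2 < S <;> by_cases h3 : 0 < X.2 <;> by_cases h4 : X.2 < 1 <;>
      simp [indicator, hE, h1, h2, h3, h4, -Metric.mem_ball, sq]
  have hmain : ∀ p : Pt n → ℝ, (∀ X, p X ≤ ∑ i, convX v (partialX i k) X.1 X.2 ^ 2 +
      convX g k X.1 X.2 ^ 2) →
      ∫⁻ X in Metric.ball (0 : EuclideanSpace ℝ (Fin n)) r ×ˢ Ioo 0 s,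
        ENNReal.ofReal (μ X.2 * p X) ≤
        ENNReal.ofReal (4 * Λ ^ 2 * K) * convEnergy μ v k R S := by
    intro p hp
    have hK0 : 0 ≤ K := le_trans (by positivity) (hK 0 0 (by simp))
    have hint : Integrable (fun X => 2 * Λ * F X + 4 * Λ ^ 2 * K * E X) (volume.prod ν) :=
      (hFi.const_mul _).fun_add (IE.const_mul _)
    have hnn : ∀ᵐ X ∂(volume.prod ν), 0 ≤ 2 * Λ * F X + 4 * Λ ^ 2 * K * E X := by
      have := Measure.quasiMeasurePreserving_snd
        (μ := (volume : Measure (EuclideanSpace ℝ (Fin n)))) (ν := ν) |>.ae h.weight.pos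
      filter_upwards [hpt, this] with X hX h3
      exact le_trans (by positivity) hX
    calc _ ≤ ∫⁻ X in Metric.ball (0 : EuclideanSpace ℝ (Fin n)) r ×ˢ Ioo 0 s,
          ENNReal.ofReal (2 * Λ * F X + 4 * Λ ^ 2 * K * E X) := by
          refine lintegral_mono_ae ?_
          have := Measure.quasiMeasurePreserving_snd
            (μ := (volume : Measure (EuclideanSpace ℝ (Fin n)))) (ν := ν) |>.ae h.weight.pos
          filter_upwards [ae_mono (hvolp _ s (by linarith)) hpt,
            ae_mono (hvolp _ s (by linarith)) this,
            ae_restrict_mem (Metric.isOpen_ball.measurableSet.prod measurableSet_Ioo)] with X hX h3 h4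
          refine ENNReal.ofReal_le_ofReal (le_trans ?_ hX)
          have e1 : α X.1 = 1 := α.one_of_mem_closedBall (Metric.ball_subset_closedBall h4.1)
          rw [e1, hχ1 _ h4.2.2.le]
          have h3' : 0 < μ X.2 := h3
          nlinarith [mul_le_mul_of_nonneg_left (hp X) h3'.le]
      _ ≤ ∫⁻ X, ENNReal.ofReal (2 * Λ * F X + 4 * Λ ^ 2 * K * E X) ∂(volume.prod ν) :=
          lintegral_mono' (hvolp _ s (by linarith)) le_rfl
      _ = ENNReal.ofReal (4 * Λ ^ 2 * K * ∫ X, E X ∂(volume.prod ν)) := by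
          rw [← ofReal_integral_eq_lintegral_ofReal hint hnn,
            integral_add (hFi.const_mul _) (IE.const_mul _), integral_const_mul,
            integral_const_mul, hF0]
          simp
      _ ≤ _ := by
          rw [ENNReal.ofReal_mul (by positivity)]
          exact mul_le_mul_right hE2 _
  refine ⟨hmain _ fun X => ?_, fun i => hmain _ fun X => ?_⟩
  · have : 0 ≤ ∑ i, convX v (partialX i k) X.1 X.2 ^ 2 := Finset.sum_nonneg fun i _ => sq_nonneg _
    linarith
  · have := Finset.single_le_sum (f := fun i => convX v (partialX i k) X.1 X.2 ^ 2)
      (fun i _ => sq_nonneg _) (Finset.mem_univ i)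
    have h2 := sq_nonneg (convX g k X.1 X.2)
    linarith

end SliceSol

/-! ### Pointwise bounds at unit scale -/

theorem convEnergy_mono {n : ℕ} {μ : ℝ → ℝ} {f : Pt n → ℝ} {k : EuclideanSpace ℝ (Fin n) → ℝ}
    {r R s S : ℝ} (hr : r ≤ R) (hs : s ≤ S) : convEnergy μ f k r s ≤ convEnergy μ f k R S :=
  lintegral_mono_set (prod_mono (Metric.ball_subset_ball hr) (Ioo_subset_Ioo_right hs))

theorem volume_restrict_prod {n : ℕ} (A : Set (EuclideanSpace ℝ (Fin n))) (B : Set ℝ) :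
    (volume : Measure (Pt n)).restrict (A ×ˢ B) = (volume.restrict A).prod (volume.restrict B) := by
  rw [Measure.volume_eq_prod, Measure.prod_restrict]

/-- All `x`-derivatives of mollified solutions are controlled in energy. -/
theorem SliceSol.exists_energy_partials (n : ℕ) (Λ : ℝ) (l : List (Fin n)) :
    ∀ {r R s S : ℝ}, 0 < r → r < R → s < S → S ≤ 1 →
    ∃ C : ℝ≥0∞, C ≠ ⊤ ∧ ∀ {ρ : ℝ} {μ : ℝ → ℝ} {a : Fin n → Fin n → ℝ → ℝ} {d : ℝ → ℝ}
      {v g : Pt n → ℝ} {G : Fin n → Pt n → ℝ} {ε : ℝ} {k : EuclideanSpace ℝ (Fin n) → ℝ},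
      SliceSol ρ Λ μ a d v g G → IsKernel ε k → R + ε ≤ ρ →
      convEnergy μ v (partialsX l k) r s ≤ C * convEnergy μ v k R S := by
  induction l with
  | nil =>
    intro r R s S hr hrR hsS hS
    refine ⟨1, ENNReal.one_ne_top, fun h hk hRε => ?_⟩
    rw [one_mul]
    exact convEnergy_mono hrR.le hsS.le
  | cons i l ih =>
    intro r R s S hr hrR hsS hS
    -- The outermost derivative costs one Caccioppoli inequality, for the kernel that already
    -- carries the other derivatives; it uses half of the room between the cylinders and leaves half
    -- to the induction.
    obtain ⟨C1, hC1, h1⟩ := exists_caccioppoli n (Λ := Λ) hr (show r < (r + R) / 2 by linarith)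
      (show s < (s + S) / 2 by linarith) (by linarith)
    obtain ⟨C2, hC2, h2⟩ := ih (show 0 < (r + R) / 2 by linarith)
      (show (r + R) / 2 < R by linarith) (show (s + S) / 2 < S by linarith) hS
    refine ⟨C1 * C2, ENNReal.mul_ne_top hC1 hC2, fun h hk hRε => ?_⟩
    calc _ ≤ C1 * _ := (h1 h (hk.partialsX l) (by linarith)).2 i
      _ ≤ C1 * (C2 * _) := mul_le_mul_right (h2 h hk hRε) _
      _ = _ := (mul_assoc _ _ _).symm

/-- The Caccioppoli inequality controls the vertical derivative along with the tangential ones, so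
one more application of it, after the bound for the x-derivatives of w, treats those of ∂_y w. -/
theorem SliceSol.exists_energy_partials_vertical (n : ℕ) (Λ : ℝ) (l : List (Fin n))
    {r R s S : ℝ} (hr : 0 < r) (hrR : r < R) (hsS : s < S) (hS : S ≤ 1) :
    ∃ C : ℝ≥0∞, C ≠ ⊤ ∧ ∀ {ρ : ℝ} {μ : ℝ → ℝ} {a : Fin n → Fin n → ℝ → ℝ} {d : ℝ → ℝ}
      {v g : Pt n → ℝ} {G : Fin n → Pt n → ℝ} {ε : ℝ} {k : EuclideanSpace ℝ (Fin n) → ℝ},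
      SliceSol ρ Λ μ a d v g G → IsKernel ε k → R + ε ≤ ρ →
      convEnergy μ g (partialsX l k) r s ≤ C * convEnergy μ v k R S := by
  obtain ⟨C1, hC1, h1⟩ := exists_caccioppoli n (Λ := Λ) hr (show r < (r + R) / 2 by linarith)
    (show s < (s + S) / 2 by linarith) (by linarith)
  obtain ⟨C2, hC2, h2⟩ := exists_energy_partials n Λ l (show 0 < (r + R) / 2 by linarith)
    (show (r + R) / 2 < R by linarith) (show (s + S) / 2 < S by linarith) hS
  refine ⟨C1 * C2, ENNReal.mul_ne_top hC1 hC2, fun h hk hRε => ?_⟩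
  calc _ ≤ C1 * _ := (h1 h (hk.partialsX l) (by linarith)).1
    _ ≤ C1 * (C2 * _) := mul_le_mul_right (h2 h hk hRε) _
    _ = _ := (mul_assoc _ _ _).symm

/-- The integral of `μ⁻¹` over `(0, 1)`. -/
noncomputable def invMass (μ : ℝ → ℝ) : ℝ≥0∞ := ∫⁻ y in Ioo 0 1, ENNReal.ofReal (μ y)⁻¹

/-- Cauchy–Schwarz: the `L¹`-norm is controlled by the weighted energy. -/
theorem lintegral_convX_le {n : ℕ} {μ : ℝ → ℝ} (hμ : UnitWeight μ) {f : Pt n → ℝ}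
    (hf : Measurable f) {k : EuclideanSpace ℝ (Fin n) → ℝ} (hk : Continuous k) {r s : ℝ}
    (hs : s ≤ 1) :
    ∫⁻ X in Metric.ball (0 : EuclideanSpace ℝ (Fin n)) r ×ˢ Ioo 0 s, ‖convX f k X.1 X.2‖ₑ ≤
      volume (Metric.ball (0 : EuclideanSpace ℝ (Fin n)) r) ^ (1 / 2 : ℝ) *
        (invMass μ * convEnergy μ f k r s) ^ (1 / 2 : ℝ) := by
  set A := Metric.ball (0 : EuclideanSpace ℝ (Fin n)) r
  have hsub : Ioo 0 s ⊆ Ioo (0 : ℝ) 1 := Ioo_subset_Ioo_right hs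
  have hμm : AEMeasurable μ (volume.restrict (Ioo 0 s)) :=
    (hμ.integrable.mono_set hsub).aestronglyMeasurable.aemeasurable
  have hm1 : AEMeasurable (fun X : Pt n => ENNReal.ofReal (Real.sqrt (μ X.2)⁻¹))
      (volume.restrict (A ×ˢ Ioo 0 s)) := by
    rw [volume_restrict_prod]
    exact (hμm.inv.sqrt.ennreal_ofReal).comp_snd
  have hm2 : AEMeasurable (fun X : Pt n => ENNReal.ofReal
      (Real.sqrt (μ X.2) * |convX f k X.1 X.2|)) (volume.restrict (A ×ˢ Ioo 0 s)) := by
    refine (AEMeasurable.mul ?_ (measurable_convX hf hk).abs.aemeasurable).ennreal_ofReal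
    rw [volume_restrict_prod]
    exact hμm.sqrt.comp_snd
  have hpos : ∀ᵐ X : Pt n ∂(volume.restrict (A ×ˢ Ioo 0 s)), 0 < μ X.2 := by
    rw [volume_restrict_prod]
    exact Measure.quasiMeasurePreserving_snd.ae (ae_mono (Measure.restrict_mono hsub le_rfl) hμ.pos)
  -- The factorisation is |w| = μ^(-1/2) · μ^(1/2) |w|.
  have hcs := ENNReal.lintegral_mul_le_Lp_mul_Lq (volume.restrict (A ×ˢ Ioo 0 s))
    Real.HolderConjugate.two_two hm1 hm2
  have e0 : ∫⁻ X in A ×ˢ Ioo 0 s, ‖convX f k X.1 X.2‖ₑ = ∫⁻ X in A ×ˢ Ioo 0 s,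
      ((fun X : Pt n => ENNReal.ofReal (Real.sqrt (μ X.2)⁻¹)) * fun X : Pt n => ENNReal.ofReal
      (Real.sqrt (μ X.2) * |convX f k X.1 X.2|)) X := by
    refine lintegral_congr_ae ?_
    filter_upwards [hpos] with X hX
    rw [Pi.mul_apply, ← ENNReal.ofReal_mul (Real.sqrt_nonneg _), ← mul_assoc,
      ← Real.sqrt_mul (inv_nonneg.2 hX.le), inv_mul_cancel₀ hX.ne', Real.sqrt_one, one_mul,
      ← Real.norm_eq_abs, ofReal_norm]
  have e1 : ∫⁻ X in A ×ˢ Ioo 0 s, ENNReal.ofReal (Real.sqrt (μ X.2)⁻¹) ^ (2 : ℝ) ≤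
      volume A * invMass μ := by
    have : ∀ᵐ X : Pt n ∂(volume.restrict (A ×ˢ Ioo 0 s)),
        ENNReal.ofReal (Real.sqrt (μ X.2)⁻¹) ^ (2 : ℝ) = ENNReal.ofReal (μ X.2)⁻¹ := by
      filter_upwards [hpos] with X hX
      rw [ENNReal.rpow_two, ← ENNReal.ofReal_pow (Real.sqrt_nonneg _),
        Real.sq_sqrt (inv_nonneg.2 hX.le)]
    have hm3 : AEMeasurable (fun X : Pt n => ENNReal.ofReal (μ X.2)⁻¹)
        ((volume.restrict A).prod (volume.restrict (Ioo 0 s))) := hμm.inv.ennreal_ofReal.comp_snd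
    rw [lintegral_congr_ae this, volume_restrict_prod, lintegral_prod _ hm3]
    simp only [lintegral_const, Measure.restrict_apply_univ]
    rw [mul_comm]
    exact mul_le_mul_right (lintegral_mono_set hsub) _
  have e2 : ∫⁻ X in A ×ˢ Ioo 0 s, ENNReal.ofReal (Real.sqrt (μ X.2) *
      |convX f k X.1 X.2|) ^ (2 : ℝ) = convEnergy μ f k r s := by
    refine lintegral_congr_ae ?_
    filter_upwards [hpos] with X hX
    rw [ENNReal.rpow_two, ← ENNReal.ofReal_pow (by positivity), mul_pow, Real.sq_sqrt hX.le, sq_abs]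
  have hhalf : (0 : ℝ) ≤ 1 / 2 := by norm_num
  rw [e0]
  refine hcs.trans ?_
  rw [e2, ENNReal.mul_rpow_of_nonneg (invMass μ) _ hhalf, ← mul_assoc,
    ← ENNReal.mul_rpow_of_nonneg (volume A) _ hhalf]
  exact mul_le_mul_left (ENNReal.rpow_le_rpow e1 hhalf) _

namespace SliceSol

/-- Mixed sums of derivatives of `f ∈ {v, g}` in `L¹`. -/
theorem exists_lintegral_mixedSum_le {n : ℕ} {r s : ℝ} {K : ℝ≥0∞} (hK : K ≠ ⊤) (hs : s ≤ 1)
    {Cs : List (Fin n) → ℝ≥0∞} (hCs : ∀ l, Cs l ≠ ⊤) (t : List (Fin n)) : ∀ l : List (Fin n),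
    ∃ C : ℝ≥0∞, C ≠ ⊤ ∧ ∀ {μ : ℝ → ℝ} {f : Pt n → ℝ} {ε : ℝ}
      {k : EuclideanSpace ℝ (Fin n) → ℝ} {E : ℝ≥0∞}, UnitWeight μ → Measurable f → IsKernel ε k →
      (∀ l, convEnergy μ f (partialsX l k) r s ≤ Cs l * E) →
      ∫⁻ X in Metric.ball (0 : EuclideanSpace ℝ (Fin n)) r ×ˢ Ioo 0 s,
        mixedSum K (fun l X => convX f (partialsX l k) X.1 X.2) t l X ≤
        C * (invMass μ * E) ^ (1 / 2 : ℝ) := by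
  induction t with
  | nil =>
    intro l
    refine ⟨volume (Metric.ball (0 : EuclideanSpace ℝ (Fin n)) r) ^ (1 / 2 : ℝ) *
      Cs l ^ (1 / 2 : ℝ), ENNReal.mul_ne_top ?_ ?_, fun hμ hf hk hE => ?_⟩
    · exact ENNReal.rpow_ne_top_of_nonneg (by norm_num) measure_ball_lt_top.ne
    · exact ENNReal.rpow_ne_top_of_nonneg (by norm_num) (hCs l)
    · refine (lintegral_convX_le hμ hf (hk.partialsX l).contDiff.continuous hs).trans ?_
      rw [mul_assoc, ← ENNReal.mul_rpow_of_nonneg (Cs l) _ (by norm_num : (0 : ℝ) ≤ 1 / 2),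
        mul_left_comm (Cs l)]
      exact mul_le_mul_right (ENNReal.rpow_le_rpow (mul_le_mul_right (hE l) _)
        (by norm_num : (0 : ℝ) ≤ 1 / 2)) _
  | cons i t ih =>
    intro l
    obtain ⟨C1, hC1, h1⟩ := ih l
    obtain ⟨C2, hC2, h2⟩ := ih (i :: l)
    refine ⟨K * C1 + C2, ENNReal.add_ne_top.2 ⟨ENNReal.mul_ne_top hK hC1, hC2⟩,
      fun {μ f ε k E} hμ hf hk hE => ?_⟩
    have hm := measurable_mixedSum (K := K)
      (u := fun (l : List (Fin n)) (X : Pt n) => convX f (partialsX l k) X.1 X.2)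
      (fun l => measurable_convX hf (hk.partialsX l).contDiff.continuous)
    simp only [mixedSum]
    rw [lintegral_add_left ((hm _ _).const_mul _), lintegral_const_mul _ (hm _ _), add_mul,
      mul_assoc]
    exact add_le_add (mul_le_mul_right (h1 hμ hf hk hE) _) (h2 hμ hf hk hE)

/-- The Sobolev inequality in x is applied at each height and integrated in y: the result is
pointwise in x and L¹ in y. The radius c is chosen before the energy constants so that one c serves
both w and ∂_y w. -/
theorem exists_lintegral_slice_le (n : ℕ) {r s : ℝ} (hr : 0 < r) (hs : s ≤ 1) :
    ∃ c : ℝ, 0 < c ∧ c ≤ r ∧ ∀ {Cs : List (Fin n) → ℝ≥0∞}, (∀ l, Cs l ≠ ⊤) →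
    ∃ C : ℝ≥0∞, C ≠ ⊤ ∧ ∀ {μ : ℝ → ℝ} {f : Pt n → ℝ} {ε : ℝ}
      {k : EuclideanSpace ℝ (Fin n) → ℝ} {E : ℝ≥0∞}, UnitWeight μ → HasSlices μ f → IsKernel ε k →
      (∀ l, convEnergy μ f (partialsX l k) r s ≤ Cs l * E) →
      ∀ x ∈ Metric.ball (0 : EuclideanSpace ℝ (Fin n)) c,
        ∫⁻ y in Ioo 0 s, ‖convX f k x y‖ₑ ≤ C * (invMass μ * E) ^ (1 / 2 : ℝ) := by
  obtain ⟨c, hc, hcr, h⟩ := exists_enorm_le_lintegral_ball_mixedSum n hr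
  refine ⟨c, hc, hcr, fun {Cs} hCs => ?_⟩
  obtain ⟨C, hC, hmix⟩ := exists_lintegral_mixedSum_le (r := r) (s := s)
    (K := ENNReal.ofReal (1 / (2 * c))) ENNReal.ofReal_ne_top hs hCs (List.finRange n) []
  refine ⟨C, hC, fun {μ f ε k E} hμ hf hk hE x hx => ?_⟩
  refine le_trans ?_ (hmix hμ hf.measurable hk hE)
  rw [volume_restrict_prod, lintegral_prod_symm _ (measurable_mixedSum (fun l =>
    measurable_convX hf.measurable (hk.partialsX l).contDiff.continuous) _ _).aemeasurable]
  refine lintegral_mono fun y => ?_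
  have := h (fun l x => convX f (partialsX l k) x y)
    (fun l => (contDiff_convX hf (hk.partialsX l) y).of_le (by simp))
    (fun l i x => fderiv_convX hf (hk.partialsX l) x y i) [] x hx
  refine this.trans (le_of_eq ?_)
  refine lintegral_congr fun z => ?_
  exact mixedSum_comp _ (fun l (X : Pt n) => convX f (partialsX l k) X.1 X.2) (fun z => (z, y)) _ _ _

/-- Sup bounds for mollified solutions. -/
theorem exists_enorm_convX_le (n : ℕ) (Λ : ℝ) {R s S : ℝ} (hR : 0 < R) (hsS : s < S)
    (hS : S ≤ 1) :
    ∃ c : ℝ, 0 < c ∧ c ≤ R / 2 ∧ ∃ C : ℝ≥0∞, C ≠ ⊤ ∧ ∀ {ρ : ℝ} {μ : ℝ → ℝ}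
      {a : Fin n → Fin n → ℝ → ℝ} {d : ℝ → ℝ}
      {v g : Pt n → ℝ} {G : Fin n → Pt n → ℝ} {ε : ℝ} {k : EuclideanSpace ℝ (Fin n) → ℝ},
      SliceSol ρ Λ μ a d v g G → IsKernel ε k → R + ε ≤ ρ →
      ∀ x ∈ Metric.ball (0 : EuclideanSpace ℝ (Fin n)) c,
      ∀ᵐ y ∂(volume.restrict (Ioo (0 : ℝ) 1)), y < s →
        ‖convX v k x y‖ₑ ≤ C * (invMass μ * convEnergy μ v k R S) ^ (1 / 2 : ℝ) := by
  have hs' : (s + S) / 2 < S := by linarith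
  obtain ⟨χ, hχ, hχ1, hχ0, hχb⟩ := exists_cutoff (show s < (s + S) / 2 by linarith)
  have hχ' : Continuous (deriv χ) := hχ.continuous_deriv (by simp)
  obtain ⟨K1, hK1⟩ := hχ.continuous.bddOn_Icc 0 1
  obtain ⟨K2, hK2⟩ := hχ'.bddOn_Icc 0 1
  -- The cutoff in y ends at the height (s + S) / 2, where L¹ bounds at each x are needed; the room
  -- above it, up to S, and between the radii R / 2 and R pays for the energy estimates.
  obtain ⟨c, hc, hcR, hsl⟩ := exists_lintegral_slice_le n (r := R / 2) (s := (s + S) / 2)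
    (by linarith) (by linarith)
  choose D1 hD1 hE1 using fun l => exists_energy_partials n Λ l (r := R / 2) (R := R)
    (s := (s + S) / 2) (S := S) (by linarith) (by linarith) hs' hS
  choose D2 hD2 hE2 using fun l => exists_energy_partials_vertical n Λ l (r := R / 2) (R := R)
    (s := (s + S) / 2) (S := S) (by linarith) (by linarith) hs' hS
  obtain ⟨C1, hC1, h1⟩ := hsl hD1
  obtain ⟨C2, hC2, h2⟩ := hsl hD2
  refine ⟨c, hc, hcR, ENNReal.ofReal K1 * C2 + ENNReal.ofReal K2 * C1, ?_, ?_⟩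
  · exact ENNReal.add_ne_top.2 ⟨ENNReal.mul_ne_top ENNReal.ofReal_ne_top hC2,
      ENNReal.mul_ne_top ENNReal.ofReal_ne_top hC1⟩
  intro ρ μ a d v g G ε k h hk hRε x hx
  have hxρ : x ∈ Metric.ball (0 : EuclideanSpace ℝ (Fin n)) (ρ - ε) :=
    Metric.ball_subset_ball (by linarith) hx
  have b1 := h1 h.weight h.slices_v hk (fun l => hE1 l h hk hRε) x hx
  have b2 := h2 h.weight h.slices_g hk (fun l => hE2 l h hk hRε) x hx
  -- Fundamental theorem of calculus in y: below height s, where χ = 1, w is minus the integral of χ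
  -- ∂_y w + χ' w, and both terms are bounded in L¹ at this x.
  filter_upwards [h.cutoff_mul_convX hk hxρ hχ ⟨(s + S) / 2, by linarith, hχ0⟩,
    ae_restrict_mem measurableSet_Ioo] with y hy hy01 hys
  rw [hχ1 y hys.le, one_mul] at hy
  rw [hy, enorm_neg]
  have hmv := measurable_convX_right h.slices_v.measurable hk.contDiff.continuous x
  have hmg := measurable_convX_right h.slices_g.measurable hk.contDiff.continuous x
  calc _ ≤ ∫⁻ t in Ioo y 1, ‖χ t * convX g k x t + deriv χ t * convX v k x t‖ₑ :=
        enorm_integral_le_lintegral_enorm _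
    _ ≤ ∫⁻ t in Ioo 0 1, ‖χ t * convX g k x t + deriv χ t * convX v k x t‖ₑ :=
        lintegral_mono_set (Ioo_subset_Ioo_left hy01.1.le)
    _ ≤ ∫⁻ t in Ioo 0 ((s + S) / 2), (ENNReal.ofReal K1 * ‖convX g k x t‖ₑ +
          ENNReal.ofReal K2 * ‖convX v k x t‖ₑ) := by
        rw [← lintegral_indicator measurableSet_Ioo, ← lintegral_indicator measurableSet_Ioo]
        refine lintegral_mono fun t => ?_
        by_cases ht : t ∈ Ioo (0 : ℝ) 1
        · by_cases ht2 : t < (s + S) / 2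
          · rw [indicator_of_mem ht, indicator_of_mem (show t ∈ Ioo 0 ((s + S) / 2) from ⟨ht.1, ht2⟩)]
            refine (enorm_add_le _ _).trans (add_le_add ?_ ?_)
            · rw [enorm_mul, ← ofReal_norm (χ t)]
              exact mul_le_mul_left (ENNReal.ofReal_le_ofReal
                (hK1 t (Ioo_subset_Icc_self ht))) _
            · rw [enorm_mul, ← ofReal_norm (deriv χ t)]
              exact mul_le_mul_left (ENNReal.ofReal_le_ofReal
                (hK2 t (Ioo_subset_Icc_self ht))) _
          · have hd : deriv χ t = 0 := by
              by_cases hlt : (s + S) / 2 < t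
              · have hev : χ =ᶠ[𝓝 t] fun _ => 0 := by
                  filter_upwards [Ioi_mem_nhds hlt] with y hy
                  exact hχ0 y (le_of_lt hy)
                rw [hev.deriv_eq]; simp
              -- At the height where the cutoff ends, χ attains its minimum 0, so the derivative
              -- vanishes there as well.
              · refine IsLocalMin.deriv_eq_zero (Eventually.of_forall fun z => ?_)
                rw [hχ0 t (not_lt.1 ht2)]
                exact (hχb z).1
            rw [indicator_of_mem ht, hd, hχ0 t (not_lt.1 ht2)]
            simp
        · simp [indicator_of_notMem ht]
    _ = ENNReal.ofReal K1 * (∫⁻ t in Ioo 0 ((s + S) / 2), ‖convX g k x t‖ₑ) +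
          ENNReal.ofReal K2 * ∫⁻ t in Ioo 0 ((s + S) / 2), ‖convX v k x t‖ₑ := by
        rw [lintegral_add_left (hmg.enorm.const_mul _), lintegral_const_mul _ hmg.enorm,
          lintegral_const_mul _ hmv.enorm]
    _ ≤ _ := by
        rw [add_mul, mul_assoc, mul_assoc]
        exact add_le_add (mul_le_mul_right b2 _) (mul_le_mul_right b1 _)

end SliceSol

/-! ### The gradient bound at unit scale -/

/-- Mollification does not increase the weighted energy. -/
theorem convEnergy_le_of_integral_eq_one {n : ℕ} {μ : ℝ → ℝ} (hμ : UnitWeight μ) {f : Pt n → ℝ}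
    (hf : HasSlices μ f) {k : EuclideanSpace ℝ (Fin n) → ℝ} (hk : Continuous k)
    (hk0 : ∀ z, 0 ≤ k z) (hk1 : ∫ z, k z = 1) {R s : ℝ} (hs : s ≤ 1) :
    convEnergy μ f k R s ≤ ∫⁻ X in univ ×ˢ Ioo 0 1, ENNReal.ofReal (μ X.2 * f X ^ 2) := by
  have hki : ∫⁻ z, ENNReal.ofReal (k z) = 1 := by
    have hint : Integrable k := by
      by_contra hc
      rw [integral_undef hc] at hk1
      exact zero_ne_one hk1
    rw [← ofReal_integral_eq_lintegral_ofReal hint (Eventually.of_forall hk0), hk1,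
      ENNReal.ofReal_one]
  have hkx : ∀ x, ∫⁻ z, ENNReal.ofReal (k (x - z)) = 1 := fun x => by
    rw [lintegral_sub_left_eq_self (fun z => ENNReal.ofReal (k z)), hki]
  have hkz : ∀ z, ∫⁻ x, ENNReal.ofReal (k (x - z)) = 1 := fun z => by
    rw [lintegral_sub_right_eq_self (fun z => ENNReal.ofReal (k z)), hki]
  have hkm : Measurable fun z => ENNReal.ofReal (k z) := hk.measurable.ennreal_ofReal
  -- Jensen's inequality for the probability density z ↦ k(x - z), in the form of Cauchy–Schwarz
  -- with |f| √k · √k. Integrating in x afterwards removes the kernel, whose integral in x is also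
  -- one. The weight depends on y only and does not interfere.
  have hsq : ∀ x y, ENNReal.ofReal (convX f k x y ^ 2) ≤
      ∫⁻ z, ENNReal.ofReal (f (z, y) ^ 2) * ENNReal.ofReal (k (x - z)) := by
    intro x y
    have hfy : Measurable fun z => f (z, y) := hf.measurable.comp measurable_prodMk_right
    have hkxm : Measurable fun z => k (x - z) := hk.measurable.comp (by fun_prop)
    have h1 : ‖convX f k x y‖ₑ ≤ ∫⁻ z, ((fun z => ENNReal.ofReal (|f (z, y)| * Real.sqrt (k (x - z))))
        * fun z => ENNReal.ofReal (Real.sqrt (k (x - z)))) z := by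
      refine (enorm_integral_le_lintegral_enorm _).trans (le_of_eq (lintegral_congr fun z => ?_))
      rw [Pi.mul_apply, ← ENNReal.ofReal_mul (by positivity), mul_assoc,
        Real.mul_self_sqrt (hk0 _), ← ofReal_norm, norm_mul, Real.norm_eq_abs, Real.norm_eq_abs,
        abs_of_nonneg (hk0 _)]
    have hcs := ENNReal.lintegral_mul_le_Lp_mul_Lq volume Real.HolderConjugate.two_two
      (f := fun z => ENNReal.ofReal (|f (z, y)| * Real.sqrt (k (x - z))))
      (g := fun z => ENNReal.ofReal (Real.sqrt (k (x - z))))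
      (hfy.abs.mul hkxm.sqrt).ennreal_ofReal.aemeasurable hkxm.sqrt.ennreal_ofReal.aemeasurable
    have e2 : ∫⁻ z, ENNReal.ofReal (Real.sqrt (k (x - z))) ^ (2 : ℝ) = 1 := by
      rw [← hkx x]
      refine lintegral_congr fun z => ?_
      rw [ENNReal.rpow_two, ← ENNReal.ofReal_pow (Real.sqrt_nonneg _), Real.sq_sqrt (hk0 _)]
    have e1 : ∫⁻ z, ENNReal.ofReal (|f (z, y)| * Real.sqrt (k (x - z))) ^ (2 : ℝ) =
        ∫⁻ z, ENNReal.ofReal (f (z, y) ^ 2) * ENNReal.ofReal (k (x - z)) := by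
      refine lintegral_congr fun z => ?_
      rw [ENNReal.rpow_two, ← ENNReal.ofReal_pow (by positivity), mul_pow, Real.sq_sqrt (hk0 _),
        sq_abs, ENNReal.ofReal_mul (sq_nonneg _)]
    rw [e2, ENNReal.one_rpow, mul_one, e1] at hcs
    have h2 := ENNReal.rpow_le_rpow (h1.trans hcs) (show (0 : ℝ) ≤ 2 by norm_num)
    rw [← ENNReal.rpow_mul] at h2
    norm_num at h2
    rw [← ofReal_norm, ← ENNReal.ofReal_pow (norm_nonneg _), Real.norm_eq_abs, sq_abs] at h2
    exact h2
  have hsub : Ioo 0 s ⊆ Ioo (0 : ℝ) 1 := Ioo_subset_Ioo_right hs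
  have hμm : AEMeasurable μ (volume.restrict (Ioo 0 1)) :=
    hμ.integrable.aestronglyMeasurable.aemeasurable
  have hm : AEMeasurable (fun X : Pt n => ENNReal.ofReal (μ X.2 * f X ^ 2))
      ((volume : Measure (EuclideanSpace ℝ (Fin n))).prod (volume.restrict (Ioo 0 1))) :=
    (AEMeasurable.mul hμm.comp_snd (hf.measurable.pow_const 2).aemeasurable).ennreal_ofReal
  have hm2 : AEMeasurable (fun X : Pt n => ENNReal.ofReal (μ X.2 * convX f k X.1 X.2 ^ 2))
      ((volume : Measure (EuclideanSpace ℝ (Fin n))).prod (volume.restrict (Ioo 0 1))) :=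
    (AEMeasurable.mul hμm.comp_snd
      ((measurable_convX hf.measurable hk).pow_const 2).aemeasurable).ennreal_ofReal
  refine (lintegral_mono_set (prod_mono (subset_univ _) hsub)).trans ?_
  rw [volume_restrict_prod, Measure.restrict_univ, lintegral_prod_symm _ hm,
    lintegral_prod_symm _ hm2]
  refine lintegral_mono fun y => ?_
  have hfy : Measurable fun z => f (z, y) := hf.measurable.comp measurable_prodMk_right
  have hcy : Measurable fun x => convX f k x y :=
    (measurable_convX hf.measurable hk).comp measurable_prodMk_right
  simp only [ENNReal.ofReal_mul' (sq_nonneg _)]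
  rw [lintegral_const_mul _ (hcy.pow_const 2).ennreal_ofReal,
    lintegral_const_mul _ (hfy.pow_const 2).ennreal_ofReal]
  refine mul_le_mul_right ?_ _
  calc _ ≤ ∫⁻ x, ∫⁻ z, ENNReal.ofReal (f (z, y) ^ 2) * ENNReal.ofReal (k (x - z)) :=
        lintegral_mono fun x => hsq x y
    _ = ∫⁻ z, ∫⁻ x, ENNReal.ofReal (f (z, y) ^ 2) * ENNReal.ofReal (k (x - z)) := by
        refine lintegral_lintegral_swap (Measurable.aemeasurable ?_)
        exact ((hfy.pow_const 2).ennreal_ofReal.comp measurable_snd).mul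
          (hkm.comp (measurable_fst.sub measurable_snd))
    _ = _ := by
        refine lintegral_congr fun z => ?_
        have hkz' : Measurable fun x => ENNReal.ofReal (k (x - z)) :=
          hkm.comp (measurable_id.sub_const z)
        rw [lintegral_const_mul _ hkz', hkz, mul_one]

theorem ae_prod_of_forall_ae {n : ℕ} {A : Set (EuclideanSpace ℝ (Fin n))} (hA : MeasurableSet A)
    {B : Set ℝ} {p : Pt n → Prop} (hp : MeasurableSet {X | p X})
    (h : ∀ x ∈ A, ∀ᵐ y ∂(volume.restrict B), p (x, y)) :
    ∀ᵐ X ∂(volume.restrict (A ×ˢ B)), p X := by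
  rw [volume_restrict_prod, Measure.ae_prod_iff_ae_ae hp]
  filter_upwards [ae_restrict_mem hA] with x hx using h x hx

/-- A bound for all mollifications passes to the function. -/
theorem ae_abs_le_of_mollifications {n : ℕ} {μ : ℝ → ℝ} {f : Pt n → ℝ} (hf : HasSlices μ f)
    {A : Set (EuclideanSpace ℝ (Fin n))} (hA : MeasurableSet A) {B : Set ℝ} {ε₀ K : ℝ}
    (hε₀ : 0 < ε₀)
    (h : ∀ (ε : ℝ) (k : EuclideanSpace ℝ (Fin n) → ℝ), ε ≤ ε₀ → IsKernel ε k → (∀ z, 0 ≤ k z) →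
      ∫ z, k z = 1 → ∀ x ∈ A, ∀ᵐ y ∂(volume.restrict B), |convX f k x y| ≤ K) :
    ∀ᵐ X ∂(volume.restrict (A ×ˢ B)), |f X| ≤ K := by
  -- The ratio of the outer to the inner radius is always 2: a bounded ratio is what convergence
  -- almost everywhere of the mollifications of an integrable slice requires.
  let φ : ℕ → ContDiffBump (0 : EuclideanSpace ℝ (Fin n)) := fun m =>
    ⟨ε₀ / (2 * (m + 1)), ε₀ / (m + 1), by positivity, by
      apply div_lt_div_of_pos_left hε₀ (by positivity)
      linarith [show (0 : ℝ) < m + 1 by positivity]⟩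
  let k : ℕ → EuclideanSpace ℝ (Fin n) → ℝ := fun m => (φ m).normed volume
  have hk : ∀ m : ℕ, IsKernel (ε₀ / (m + 1)) (k m) := fun m =>
    ⟨(φ m).contDiff_normed (n := ⊤), by rw [(φ m).tsupport_normed_eq]⟩
  have hε : ∀ m : ℕ, ε₀ / (m + 1) ≤ ε₀ := fun m =>
    div_le_self hε₀.le (by linarith [show (0 : ℝ) ≤ m from Nat.cast_nonneg m])
  have hb : ∀ m, ∀ᵐ X ∂(volume.restrict (A ×ˢ B)), |convX f (k m) X.1 X.2| ≤ K := fun m =>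
    ae_prod_of_forall_ae hA
      (measurableSet_le (measurable_convX hf.measurable (hk m).contDiff.continuous).abs
        measurable_const)
      (h _ _ (hε m) (hk m) (φ m).nonneg_normed (φ m).integral_normed)
  -- The bounds hold at every x for almost every y, with exceptional heights depending on x, while
  -- convergence takes place at a fixed height for almost every x. Fubini exchanges the order, for
  -- all m together.
  have hb2 : ∀ᵐ y ∂(volume.restrict B), ∀ᵐ x ∂(volume.restrict A), ∀ m,
      |convX f (k m) x y| ≤ K := by
    rw [← Measure.ae_ae_comm]
    · have := ae_all_iff.2 hb
      rw [volume_restrict_prod] at this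
      exact Measure.ae_ae_of_ae_prod this
    · simp only [ofPred_forall]
      exact MeasurableSet.iInter fun m => measurableSet_le
        (measurable_convX hf.measurable (hk m).contDiff.continuous).abs measurable_const
  have hfin : ∀ᵐ y ∂(volume.restrict B), ∀ᵐ x ∂(volume.restrict A), |f (x, y)| ≤ K := by
    filter_upwards [hb2] with y hy
    have hlim := ContDiffBump.ae_convolution_tendsto_right_of_locallyIntegrable
      (μ := (volume : Measure (EuclideanSpace ℝ (Fin n)))) (φ := φ) (l := atTop) (K := 2)
      (g := fun z => f (z, y))
      (by
        have := (tendsto_one_div_add_atTop_nhds_zero_nat (𝕜 := ℝ)).const_mul ε₀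
        simpa [φ, div_eq_mul_inv] using this)
      (Eventually.of_forall fun m => by simp only [φ]; apply le_of_eq; field_simp)
      (hf.integrable y).locallyIntegrable
    filter_upwards [hy, ae_restrict_of_ae hlim] with x hx hx2
    refine le_of_tendsto hx2.abs (Eventually.of_forall fun m => ?_)
    refine le_trans (le_of_eq ?_) (hx m)
    congr 1
    rw [convolution_eq_swap, convX]
    congr 1; ext z
    simp [k, mul_comm]
  rw [volume_restrict_prod, Measure.ae_prod_iff_ae_ae
    (measurableSet_le hf.measurable.abs measurable_const)]
  exact (Measure.ae_ae_comm (p := fun x y => |f (x, y)| ≤ K)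
    (measurableSet_le hf.measurable.abs measurable_const)).2 hfin

theorem abs_le_of_enorm_le_rpow {w K : ℝ} {C D M : ℝ≥0∞} (hC : C ≠ ⊤) (hD : D ≠ ⊤) (hK : 0 ≤ K)
    (h : ‖w‖ₑ ≤ C * M ^ (1 / 2 : ℝ)) (hM : M ≤ D * ENNReal.ofReal (K ^ 2)) :
    |w| ≤ C.toReal * Real.sqrt D.toReal * K := by
  have hh : (0 : ℝ) ≤ 1 / 2 := by norm_num
  have h1 : ‖w‖ₑ ≤ ENNReal.ofReal (C.toReal * Real.sqrt D.toReal * K) := by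
    refine h.trans ((mul_le_mul_right (ENNReal.rpow_le_rpow hM hh) C).trans (le_of_eq ?_))
    rw [ENNReal.mul_rpow_of_nonneg _ _ hh, ENNReal.ofReal_rpow_of_nonneg (sq_nonneg K) hh,
      ← Real.sqrt_eq_rpow, Real.sqrt_sq hK, ENNReal.ofReal_mul (by positivity),
      ENNReal.ofReal_mul (by positivity), ENNReal.ofReal_toReal hC, mul_assoc]
    congr 2
    rw [Real.sqrt_eq_rpow, ← ENNReal.ofReal_rpow_of_nonneg ENNReal.toReal_nonneg hh,
      ENNReal.ofReal_toReal hD]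
  rw [← ofReal_norm, Real.norm_eq_abs] at h1
  exact (ENNReal.ofReal_le_ofReal_iff (by positivity)).1 h1

namespace SliceSol

/-- Since ∂_i w is the mollification of G_i, its energy is at most that of G_i. This is how the
final bound comes to involve the gradient of v and not v itself. -/
theorem convEnergy_partialX_le {n : ℕ} {ρ Λ : ℝ} {μ : ℝ → ℝ} {a : Fin n → Fin n → ℝ → ℝ}
    {d : ℝ → ℝ} {v g : Pt n → ℝ} {G : Fin n → Pt n → ℝ} {ε : ℝ}
    {k : EuclideanSpace ℝ (Fin n) → ℝ} (h : SliceSol ρ Λ μ a d v g G) (hk : IsKernel ε k)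
    (hk0 : ∀ z, 0 ≤ k z) (hk1 : ∫ z, k z = 1) {R : ℝ} (hR : R + ε ≤ ρ) (i : Fin n) :
    convEnergy μ v (partialX i k) R 1 ≤
      ∫⁻ X in univ ×ˢ Ioo 0 1, ENNReal.ofReal (μ X.2 * G i X ^ 2) := by
  refine le_trans (le_of_eq ?_) (convEnergy_le_of_integral_eq_one h.weight (h.slices_G i)
    hk.contDiff.continuous hk0 hk1 (R := R) le_rfl)
  refine lintegral_congr_ae ?_
  have : ∀ᵐ X ∂(volume.restrict (Metric.ball (0 : EuclideanSpace ℝ (Fin n)) R ×ˢ Ioo (0 : ℝ) 1)),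
      convX v (partialX i k) X.1 X.2 = convX (G i) k X.1 X.2 := by
    refine ae_prod_of_forall_ae Metric.isOpen_ball.measurableSet ?_ fun x hx => ?_
    · exact measurableSet_eq_fun
        (measurable_convX h.slices_v.measurable (hk.partialX i).contDiff.continuous)
        (measurable_convX (h.slices_G i).measurable hk.contDiff.continuous)
    · exact h.convX_partialX hk (Metric.ball_subset_ball (by linarith) hx) i
  filter_upwards [this] with X hX
  rw [hX]

/-- The interior gradient bound at unit scale. -/
theorem exists_gradient_bound (n : ℕ) {ρ Λ C₀ θ : ℝ} (hρ : 0 < ρ) (hΛ : 0 < Λ) (hC₀ : 0 < C₀)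
    (hθ : θ < 1) :
    ∃ c : ℝ, 0 < c ∧ c ≤ ρ ∧ ∃ C : ℝ, 0 < C ∧ ∀ {μ : ℝ → ℝ} {a : Fin n → Fin n → ℝ → ℝ}
      {d : ℝ → ℝ} {v g : Pt n → ℝ} {G : Fin n → Pt n → ℝ}, SliceSol ρ Λ μ a d v g G →
      (∀ᵐ y ∂(volume.restrict (Ioo (0 : ℝ) 1)), ∫ s in Ioo 0 y, μ s ≤ C₀ * μ y) →
      ∀ K : ℝ, 0 ≤ K →
      (∀ i, invMass μ * ∫⁻ X in univ ×ˢ Ioo 0 1, ENNReal.ofReal (μ X.2 * G i X ^ 2) ≤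
        ENNReal.ofReal (K ^ 2)) →
      ∀ᵐ X ∂(volume.restrict (Metric.ball (0 : EuclideanSpace ℝ (Fin n)) c ×ˢ Ioo (0 : ℝ) θ)),
        (∀ i, |G i X| ≤ C * K) ∧ |g X| ≤ C * K := by
  obtain ⟨c, hc, hcρ, A, hA, hsup⟩ := exists_enorm_convX_le n Λ (R := ρ / 2) (s := θ)
    (S := (θ + 1) / 2) (by linarith) (by linarith) (by linarith)
  obtain ⟨A', hA', hcac⟩ := exists_caccioppoli n (Λ := Λ) (r := ρ / 2) (R := 3 * ρ / 4)
    (s := (θ + 1) / 2) (S := 1) (by linarith) (by linarith) (by linarith) le_rfl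
  set D1 := A.toReal * Real.sqrt (1 : ℝ≥0∞).toReal with hD1
  set D2 := A.toReal * Real.sqrt A'.toReal with hD2
  have hD1n : 0 ≤ D1 := by positivity
  have hD2n : 0 ≤ D2 := by positivity
  -- D1 bounds the first and D2 the second tangential derivatives, both in units of K. In the
  -- vertical bound 2 n² Λ comes from n² coefficients of size 2 Λ μ, the other Λ from dividing by d
  -- ≥ Λ⁻¹ μ. The summand 1 only makes the constant positive.
  refine ⟨c, hc, by linarith, D1 + 2 * n ^ 2 * Λ ^ 2 * D2 * C₀ + 1, by positivity, ?_⟩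
  intro μ a d v g G h hgr K hK hE
  have key : ∀ (ε : ℝ) (k : EuclideanSpace ℝ (Fin n) → ℝ), ε ≤ ρ / 4 → IsKernel ε k →
      (∀ z, 0 ≤ k z) → ∫ z, k z = 1 → ∀ x ∈ Metric.ball (0 : EuclideanSpace ℝ (Fin n)) c,
      ∀ᵐ y ∂(volume.restrict (Ioo (0 : ℝ) 1)), y < θ → (∀ i, |convX (G i) k x y| ≤ D1 * K) ∧
        |convX g k x y| ≤ 2 * n ^ 2 * Λ ^ 2 * D2 * C₀ * K := by
    intro ε k hε hk hk0 hk1 x hx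
    have hxρ : x ∈ Metric.ball (0 : EuclideanSpace ℝ (Fin n)) (ρ - ε) :=
      Metric.ball_subset_ball (by linarith) hx
    have hEn : ∀ i, invMass μ * convEnergy μ v (partialX i k) (3 * ρ / 4) 1 ≤
        ENNReal.ofReal (K ^ 2) := fun i =>
      (mul_le_mul_right (h.convEnergy_partialX_le hk hk0 hk1 (by linarith) i) _).trans (hE i)
    have b1 : ∀ᵐ y ∂(volume.restrict (Ioo (0 : ℝ) 1)), y < θ →
        ∀ i, |convX v (partialX i k) x y| ≤ D1 * K := by
      have := ae_all_iff.2 fun i => hsup h (hk.partialX i) (by linarith) x hx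
      filter_upwards [this] with y hy hyθ i
      refine abs_le_of_enorm_le_rpow hA ENNReal.one_ne_top hK (hy i hyθ) ?_
      rw [one_mul]
      exact (mul_le_mul_right (convEnergy_mono (by linarith) (by linarith)) _).trans (hEn i)
    -- The sup bound for ∂_ij w involves the energy of ∂_ij w, and one further Caccioppoli
    -- inequality, from radius ρ / 2 to 3 ρ / 4, replaces it by that of ∂_i w.
    have b2 : ∀ᵐ y ∂(volume.restrict (Ioo (0 : ℝ) 1)), y < θ →
        ∀ i j, |convX v (partialX j (partialX i k)) x y| ≤ D2 * K := by
      have := ae_all_iff.2 fun i => ae_all_iff.2 fun j =>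
        hsup h ((hk.partialX i).partialX j) (by linarith) x hx
      filter_upwards [this] with y hy hyθ i j
      refine abs_le_of_enorm_le_rpow hA hA' hK (hy i j hyθ) ?_
      refine (mul_le_mul_right ((hcac h (hk.partialX i) (by linarith)).2 j) _).trans ?_
      rw [mul_left_comm]
      exact mul_le_mul_right (hEn i) _
    have b3 : ∀ᵐ y ∂(volume.restrict (Ioo (0 : ℝ) 1)), y < θ →
        |source a v k x y| ≤ 2 * n ^ 2 * Λ * D2 * K * μ y := by
      filter_upwards [b2, h.abs_a_le, h.weight.pos] with y hy ha hμ hyθ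
      refine (Finset.abs_sum_le_sum_abs _ _).trans ?_
      have : ∀ i, |∑ j, a i j y * convX v (partialX j (partialX i k)) x y| ≤
          n * (2 * Λ * μ y * (D2 * K)) := by
        intro i
        refine (Finset.abs_sum_le_sum_abs _ _).trans ?_
        refine (Finset.sum_le_sum fun j _ => ?_).trans (le_of_eq (by
          rw [Finset.sum_const, Finset.card_univ, Fintype.card_fin, nsmul_eq_mul]))
        rw [abs_mul]
        exact mul_le_mul (ha i j) (hy hyθ i j) (abs_nonneg _) (by positivity)
      refine (Finset.sum_le_sum fun i _ => this i).trans (le_of_eq ?_)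
      rw [Finset.sum_const, Finset.card_univ, Fintype.card_fin, nsmul_eq_mul]
      ring
    filter_upwards [b1, ae_all_iff.2 fun i => h.convX_partialX hk hxρ i, h.flux_eq hk hxρ,
      h.d_bounds, h.weight.pos, hgr, ae_restrict_mem measurableSet_Ioo]
      with y hy1 hy2 hy3 hy4 hy5 hy6 hy7 hyθ
    refine ⟨fun i => by rw [← hy2 i]; exact hy1 hyθ i, ?_⟩
    have hsub : Ioo 0 y ⊆ Ioo (0 : ℝ) 1 := Ioo_subset_Ioo_right hy7.2.le
    have hint : |∫ s in Ioo 0 y, source a v k x s| ≤ ∫ s in Ioo 0 y, 2 * n ^ 2 * Λ * D2 * K * μ s := by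
      rw [← Real.norm_eq_abs]
      refine norm_integral_le_of_norm_le ((h.weight.integrable.mono_set hsub).const_mul _) ?_
      filter_upwards [ae_mono (Measure.restrict_mono hsub le_rfl) b3,
        ae_restrict_mem measurableSet_Ioo] with s hs hs2
      exact hs (hs2.2.trans hyθ)
    rw [integral_const_mul] at hint
    -- Here the growth condition acts: the flux at height y is of the order of ∫₀^y μ, and C₀ μ(y)
    -- bounds this, which the factor d(y) on the left can absorb.
    have h1 : d y * |convX g k x y| ≤ 2 * n ^ 2 * Λ * D2 * K * (C₀ * μ y) := by
      have hd : 0 ≤ d y := le_trans (by have := inv_pos.2 hΛ; positivity) hy4.1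
      calc d y * |convX g k x y| = |∫ s in Ioo 0 y, source a v k x s| := by
            nth_rewrite 1 [← abs_of_nonneg hd]
            rw [← abs_mul, hy3, abs_neg]
        _ ≤ _ := hint.trans (mul_le_mul_of_nonneg_left hy6 (by positivity))
    have h2 : Λ⁻¹ * μ y * |convX g k x y| ≤ 2 * n ^ 2 * Λ * D2 * K * (C₀ * μ y) :=
      (mul_le_mul_of_nonneg_right hy4.1 (abs_nonneg _)).trans h1
    have h3 : 0 < Λ⁻¹ * μ y := mul_pos (inv_pos.2 hΛ) hy5
    refine le_of_mul_le_mul_left (h2.trans (le_of_eq ?_)) h3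
    field_simp
  have hθν : ∀ {p : ℝ → Prop}, (∀ᵐ y ∂(volume.restrict (Ioo (0 : ℝ) 1)), y < θ → p y) →
      ∀ᵐ y ∂(volume.restrict (Ioo (0 : ℝ) θ)), p y := by
    intro p hp
    filter_upwards [ae_mono (Measure.restrict_mono (Ioo_subset_Ioo_right hθ.le) le_rfl) hp,
      ae_restrict_mem measurableSet_Ioo] with y h1 h2 using h1 h2.2
  have hG : ∀ i, ∀ᵐ X ∂(volume.restrict
      (Metric.ball (0 : EuclideanSpace ℝ (Fin n)) c ×ˢ Ioo (0 : ℝ) θ)), |G i X| ≤ D1 * K := fun i =>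
    ae_abs_le_of_mollifications (h.slices_G i) Metric.isOpen_ball.measurableSet
      (show 0 < ρ / 4 by linarith) fun ε k h1 h2 h3 h4 x hx => hθν (by
        filter_upwards [key ε k h1 h2 h3 h4 x hx] with y hy hyθ using (hy hyθ).1 i)
  have hg := ae_abs_le_of_mollifications h.slices_g
    (A := Metric.ball (0 : EuclideanSpace ℝ (Fin n)) c) (B := Ioo (0 : ℝ) θ)
    (K := 2 * n ^ 2 * Λ ^ 2 * D2 * C₀ * K) Metric.isOpen_ball.measurableSet
    (show 0 < ρ / 4 by linarith) fun ε k h1 h2 h3 h4 x hx => hθν (by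
      filter_upwards [key ε k h1 h2 h3 h4 x hx] with y hy hyθ using (hy hyθ).2)
  have p1 : 0 ≤ 2 * n ^ 2 * Λ ^ 2 * D2 * C₀ * K := by positivity
  have p2 : 0 ≤ D1 * K := by positivity
  filter_upwards [ae_all_iff.2 hG, hg] with X hX1 hX2
  constructor
  · intro i
    have := hX1 i
    nlinarith
  · nlinarith

end SliceSol

/-! ### Homotheties -/

section homothety

variable {E : Type*} [NormedAddCommGroup E] [NormedSpace ℝ E] [MeasurableSpace E] [BorelSpace E]
  [FiniteDimensional ℝ E] (m : Measure E) [m.IsAddHaarMeasure] {t : ℝ} (x₀ : E)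

theorem quasiMeasurePreserving_homothety (ht : t ≠ 0) :
    Measure.QuasiMeasurePreserving (fun x : E => t • x + x₀) m m := by
  refine ⟨by fun_prop, ?_⟩
  have : (fun x : E => t • x + x₀) = (fun x => x + x₀) ∘ fun x => t • x := rfl
  rw [this, ← Measure.map_map (by fun_prop) (by fun_prop), Measure.map_addHaar_smul m ht,
    Measure.map_smul, map_add_right_eq_self]
  exact Measure.smul_absolutelyContinuous

theorem setIntegral_comp_homothety (ht : 0 < t) {U : Set E} (hU : MeasurableSet U) (F : E → ℝ) :
    ∫ x in (fun x : E => t • x + x₀) ⁻¹' U, F (t • x + x₀) ∂m =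
      (t ^ Module.finrank ℝ E)⁻¹ * ∫ x in U, F x ∂m := by
  have hm : Measurable fun x : E => t • x + x₀ := by fun_prop
  rw [← integral_indicator (hm hU), ← integral_indicator hU]
  have e1 : ∀ x, ((fun x : E => t • x + x₀) ⁻¹' U).indicator (fun x => F (t • x + x₀)) x =
      (fun z => U.indicator F (z + x₀)) (t • x) := by
    intro x
    by_cases hx : t • x + x₀ ∈ U <;> simp [indicator, hx]
  simp only [e1]
  rw [Measure.integral_comp_smul m (fun z => U.indicator F (z + x₀)),
    integral_add_right_eq_self (μ := m) (U.indicator F), abs_of_pos (by positivity), smul_eq_mul]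

theorem integrableOn_comp_homothety (ht : t ≠ 0) {U : Set E} (hU : MeasurableSet U) {F : E → ℝ}
    (hF : IntegrableOn F U m) :
    IntegrableOn (fun x => F (t • x + x₀)) ((fun x : E => t • x + x₀) ⁻¹' U) m := by
  have hm : Measurable fun x : E => t • x + x₀ := by fun_prop
  rw [← integrable_indicator_iff (hm hU)]
  have e1 : ((fun x : E => t • x + x₀) ⁻¹' U).indicator (fun x => F (t • x + x₀)) =
      fun x => (fun z => U.indicator F (z + x₀)) (t • x) := by
    ext x
    by_cases hx : t • x + x₀ ∈ U <;> simp [indicator, hx]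
  rw [e1, integrable_comp_smul_iff m (fun z => U.indicator F (z + x₀)) ht]
  exact ((integrable_indicator_iff hU).2 hF).comp_add_right x₀

end homothety

instance isAddHaarMeasure_volume_pt (n : ℕ) : (volume : Measure (Pt n)).IsAddHaarMeasure := by
  rw [Measure.volume_eq_prod]; infer_instance

/-! ### Weak solutions on cylinders -/

/-- Weak solutions on `B_r(x₀) × (0, τ)` with zero conormal derivative at the bottom. -/
structure LocalSol {n : ℕ} (x₀ : EuclideanSpace ℝ (Fin n)) (r τ : ℝ) (μ : ℝ → ℝ)
    (A : ℝ → Matrix (Fin n ⊕ Unit) (Fin n ⊕ Unit) ℝ) (v : Pt n → ℝ) (G : Pt n → Vec n) : Prop where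
  aesm : AEStronglyMeasurable v (volume.restrict (Metric.ball x₀ r ×ˢ Ioo 0 τ))
  grad_aesm : AEStronglyMeasurable G (volume.restrict (Metric.ball x₀ r ×ˢ Ioo 0 τ))
  sq_integrable : IntegrableOn (fun X => v X ^ 2 * μ X.2) (Metric.ball x₀ r ×ˢ Ioo 0 τ)
  grad_sq_integrable : IntegrableOn (fun X => ‖G X‖ ^ 2 * μ X.2) (Metric.ball x₀ r ×ˢ Ioo 0 τ)
  weak : ∀ φ : Pt n → ℝ, ContDiff ℝ ∞ φ → HasCompactSupport φ →
    tsupport φ ⊆ Metric.ball x₀ r ×ˢ Ioo 0 τ → ∀ i,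
    ∫ X in Metric.ball x₀ r ×ˢ Ioo 0 τ, v X * classicalGrad φ X i =
      -∫ X in Metric.ball x₀ r ×ˢ Ioo 0 τ, G X i * φ X
  eq : ∀ ψ : Pt n → ℝ, ContDiff ℝ ∞ ψ → tsupport ψ ⊆ Metric.ball x₀ r ×ˢ Iio τ →
    ∫ X in Metric.ball x₀ r ×ˢ Ioo 0 τ,
      (A X.2 *ᵥ (G X).ofLp) ⬝ᵥ (classicalGrad ψ X).ofLp = 0

theorem preimage_homothety_cyl {n : ℕ} (x₀ : EuclideanSpace ℝ (Fin n)) {r τ s t : ℝ} (ht : 0 < t) :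
    (fun X : Pt n => t • X + (x₀, 0)) ⁻¹' (Metric.ball x₀ (r * t) ×ˢ Ioo (s * t) (τ * t)) =
      Metric.ball 0 r ×ˢ Ioo s τ := by
  ext X
  simp only [mem_preimage, mem_prod, Prod.fst_add, Prod.smul_fst, Prod.snd_add, Prod.smul_snd,
    Metric.mem_ball, dist_eq_norm, add_sub_cancel_right, add_zero, sub_zero, norm_smul,
    Real.norm_eq_abs, abs_of_pos ht, mem_Ioo, smul_eq_mul]
  refine and_congr ?_ (and_congr ?_ ?_)
  · rw [mul_comm, mul_lt_mul_iff_left₀ ht]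
  · rw [mul_comm t, mul_lt_mul_iff_left₀ ht]
  · rw [mul_comm t, mul_lt_mul_iff_left₀ ht]

theorem classicalGrad_comp_homothety {n : ℕ} {φ : Pt n → ℝ} (hφ : ContDiff ℝ ∞ φ) (t : ℝ)
    (X₀ X : Pt n) :
    classicalGrad (fun X => φ (t • X + X₀)) X = t • classicalGrad φ (t • X + X₀) := by
  have h1 : HasFDerivAt (fun X : Pt n => t • X + X₀) (t • ContinuousLinearMap.id ℝ (Pt n)) X :=
    ((hasFDerivAt_id X).const_smul t).add_const X₀
  have h2 := ((hφ.differentiable (by simp)) (t • X + X₀)).hasFDerivAt.comp X h1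
  have h3 : fderiv ℝ (fun X => φ (t • X + X₀)) X = _ := h2.fderiv
  ext i
  rcases i with i | i <;> simp [classicalGrad, h3]

/-- Rescaling to unit height. -/
theorem LocalSol.rescale {n : ℕ} {x₀ : EuclideanSpace ℝ (Fin n)} {ρ τ : ℝ} {μ : ℝ → ℝ}
    {A : ℝ → Matrix (Fin n ⊕ Unit) (Fin n ⊕ Unit) ℝ} {v : Pt n → ℝ} {G : Pt n → Vec n}
    (h : LocalSol x₀ (ρ * τ) τ μ A v G) (hτ : 0 < τ) :
    LocalSol 0 ρ 1 (fun y => μ (τ * y)) (fun y => A (τ * y))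
      (fun X => τ⁻¹ * v (τ • X + (x₀, 0))) (fun X => G (τ • X + (x₀, 0))) := by
  set U : Set (Pt n) := Metric.ball x₀ (ρ * τ) ×ˢ Ioo 0 τ with hU
  set X₀ : Pt n := (x₀, 0) with hX₀
  have hUm : MeasurableSet U := Metric.isOpen_ball.measurableSet.prod measurableSet_Ioo
  have hpre : (fun X : Pt n => τ • X + X₀) ⁻¹' U = Metric.ball 0 ρ ×ˢ Ioo 0 1 := by
    have := preimage_homothety_cyl x₀ (r := ρ) (s := 0) (τ := 1) hτ
    simpa using this
  have hq : Measure.QuasiMeasurePreserving (fun X : Pt n => τ • X + X₀)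
      (volume.restrict (Metric.ball 0 ρ ×ˢ Ioo 0 1)) (volume.restrict U) := by
    rw [← hpre]
    exact (quasiMeasurePreserving_homothety volume X₀ hτ.ne').restrict fun X hX => hX
  have hinv : ∀ X : Pt n, τ • (τ⁻¹ • X + -(τ⁻¹ • X₀)) + X₀ = X := by
    intro X
    rw [smul_add, smul_smul, mul_inv_cancel₀ hτ.ne', one_smul, smul_neg, smul_smul,
      mul_inv_cancel₀ hτ.ne', one_smul]
    abel
  have hinv' : ∀ X : Pt n, τ⁻¹ • (τ • X + X₀) + -(τ⁻¹ • X₀) = X := by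
    intro X
    rw [smul_add, smul_smul, inv_mul_cancel₀ hτ.ne', one_smul]
    abel
  have hX2 : ∀ X : Pt n, (τ • X + X₀).2 = τ * X.2 := fun X => by simp [hX₀]
  -- Test functions are carried back to the original cylinder by the inverse homothety. Their
  -- gradients acquire the factor τ⁻¹, which is matched by the factor τ⁻¹ in the rescaled solution;
  -- thus the gradient G is merely composed with the homothety.
  have htest : ∀ φ : Pt n → ℝ, ContDiff ℝ ∞ φ →
      ContDiff ℝ ∞ (fun X => φ (τ⁻¹ • X + -(τ⁻¹ • X₀))) := fun φ hφ =>
    hφ.comp ((contDiff_const_smul _).add contDiff_const)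
  have hts : ∀ φ : Pt n → ℝ, ∀ V W : Set (Pt n), tsupport φ ⊆ V →
      (∀ X, τ⁻¹ • X + -(τ⁻¹ • X₀) ∈ V → X ∈ W) →
      tsupport (fun X => φ (τ⁻¹ • X + -(τ⁻¹ • X₀))) ⊆ W := by
    intro φ V W hV hW X hX
    refine hW X (hV ?_)
    exact tsupport_comp_subset_preimage φ (f := fun X : Pt n => τ⁻¹ • X + -(τ⁻¹ • X₀))
      (by fun_prop) hX
  have hgrad : ∀ φ : Pt n → ℝ, ContDiff ℝ ∞ φ → ∀ X,
      classicalGrad (fun X => φ (τ⁻¹ • X + -(τ⁻¹ • X₀))) (τ • X + X₀) =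
        τ⁻¹ • classicalGrad φ X := by
    intro φ hφ X
    rw [classicalGrad_comp_homothety hφ, hinv']
  have hmem : ∀ X, τ⁻¹ • X + -(τ⁻¹ • X₀) ∈ Metric.ball 0 ρ ×ˢ Ioo 0 1 → X ∈ U := by
    intro X hX
    rw [← hpre, mem_preimage, hinv] at hX
    exact hX
  constructor
  · exact (h.aesm.comp_quasiMeasurePreserving hq).const_mul _
  · exact h.grad_aesm.comp_quasiMeasurePreserving hq
  · have := (integrableOn_comp_homothety volume X₀ hτ.ne' hUm h.sq_integrable).const_mul (τ⁻¹ ^ 2)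
    rw [hpre] at this
    refine this.congr (Eventually.of_forall fun X => ?_)
    simp only [hX2]; ring
  · have := integrableOn_comp_homothety volume X₀ hτ.ne' hUm h.grad_sq_integrable
    rw [hpre] at this
    simpa only [hX2] using this
  · intro φ hφ hφc hφs i
    have hw := h.weak _ (htest φ hφ) (HasCompactSupport.of_support_subset_isCompact
      ((hφc.isCompact).image (f := fun X : Pt n => τ • X + X₀) (by fun_prop)) (by
        intro X hX
        exact ⟨τ⁻¹ • X + -(τ⁻¹ • X₀), subset_closure hX, hinv X⟩))
      (hts φ _ _ hφs hmem) i
    have c1 := setIntegral_comp_homothety volume X₀ hτ hUm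
      (fun X => v X * classicalGrad (fun X => φ (τ⁻¹ • X + -(τ⁻¹ • X₀))) X i)
    have c2 := setIntegral_comp_homothety volume X₀ hτ hUm
      (fun X => G X i * φ (τ⁻¹ • X + -(τ⁻¹ • X₀)))
    rw [hw, mul_neg, ← c2, hpre] at c1
    simp only [hgrad φ hφ, hinv'] at c1
    rw [← c1]
    congr 1; ext X
    simp only [PiLp.smul_apply, smul_eq_mul]
    ring
  · intro ψ hψ hψs
    have hw := h.eq _ (htest ψ hψ) (hts ψ _ _ hψs (by
      intro X hX
      have h2 := hX.2
      simp only [mem_Iio, Prod.snd_add, Prod.smul_snd, Prod.snd_neg, hX₀, smul_eq_mul, mul_zero,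
        neg_zero, add_zero] at h2
      have h1 := hX.1
      refine ⟨?_, ?_⟩
      · rw [← hinv X]
        simp only [Metric.mem_ball, dist_zero_right] at h1
        simp only [Prod.fst_add, Prod.smul_fst, hX₀, Metric.mem_ball, dist_eq_norm,
          add_sub_cancel_right]
        rw [norm_smul, Real.norm_eq_abs, abs_of_pos hτ, mul_comm]
        exact mul_lt_mul_of_pos_right h1 hτ
      · rw [mem_Iio]
        have := mul_lt_mul_of_pos_left h2 hτ
        rwa [← mul_assoc, mul_inv_cancel₀ hτ.ne', one_mul, mul_one] at this))
    have c1 := setIntegral_comp_homothety volume X₀ hτ hUm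
      (fun X => (A X.2 *ᵥ (G X).ofLp) ⬝ᵥ
        (classicalGrad (fun X => ψ (τ⁻¹ • X + -(τ⁻¹ • X₀))) X).ofLp)
    rw [hw, mul_zero, hpre] at c1
    simp only [hgrad ψ hψ, hX2] at c1
    have e : ∀ X : Pt n, (A (τ * X.2) *ᵥ (G (τ • X + X₀)).ofLp) ⬝ᵥ
        (τ⁻¹ • classicalGrad ψ X).ofLp = τ⁻¹ * ((A (τ * X.2) *ᵥ (G (τ • X + X₀)).ofLp) ⬝ᵥ
        (classicalGrad ψ X).ofLp) := fun X => by
      rw [WithLp.ofLp_smul, dotProduct_smul, smul_eq_mul]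
    simp only [e, integral_const_mul] at c1
    exact (mul_eq_zero.1 c1).resolve_left (inv_ne_zero hτ.ne')

/-! ### From weak solutions at unit height to slices -/

theorem sq_lintegral_le_measure_mul {α : Type*} [MeasurableSpace α] (m : Measure α)
    {f : α → ℝ≥0∞} (hf : AEMeasurable f m) : (∫⁻ x, f x ∂m) ^ 2 ≤ m univ * ∫⁻ x, f x ^ 2 ∂m := by
  have h := ENNReal.lintegral_mul_le_Lp_mul_Lq m Real.HolderConjugate.two_two hf
    (aemeasurable_const (b := (1 : ℝ≥0∞)))
  simp only [Pi.mul_apply, mul_one, lintegral_const, ENNReal.rpow_two] at h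
  have h2 := ENNReal.rpow_le_rpow h (show (0 : ℝ) ≤ 2 by norm_num)
  rw [ENNReal.mul_rpow_of_nonneg _ _ (by norm_num), ← ENNReal.rpow_mul, ← ENNReal.rpow_mul] at h2
  norm_num at h2
  rwa [mul_comm] at h2

/-- `HasSlices` asks for integrability at every height, not at almost every one, so that
mollifications are smooth in x at all heights. A measurable representative is set to zero outside
the cylinder and at the heights where its slice is not integrable. Such heights form a null set, and
slice norms are square integrable for μ, by Cauchy–Schwarz on a ball of finite volume. -/
theorem exists_slices {n : ℕ} {ρ : ℝ} {μ : ℝ → ℝ} (hμ : UnitWeight μ) {f : Pt n → ℝ}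
    (hf : AEStronglyMeasurable f
      (volume.restrict (Metric.ball (0 : EuclideanSpace ℝ (Fin n)) ρ ×ˢ Ioo 0 1)))
    (hi : IntegrableOn (fun X => f X ^ 2 * μ X.2)
      (Metric.ball (0 : EuclideanSpace ℝ (Fin n)) ρ ×ˢ Ioo 0 1)) :
    ∃ f' : Pt n → ℝ, HasSlices μ f' ∧
      f' =ᵐ[volume.restrict (Metric.ball (0 : EuclideanSpace ℝ (Fin n)) ρ ×ˢ Ioo 0 1)] f ∧
      ∀ X, X ∉ Metric.ball (0 : EuclideanSpace ℝ (Fin n)) ρ ×ˢ Ioo (0 : ℝ) 1 → f' X = 0 := by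
  set D := Metric.ball (0 : EuclideanSpace ℝ (Fin n)) ρ with hD
  set U : Set (Pt n) := D ×ˢ Ioo 0 1 with hU
  have hDm : MeasurableSet D := Metric.isOpen_ball.measurableSet
  have hUm : MeasurableSet U := hDm.prod measurableSet_Ioo
  set f₁ : Pt n → ℝ := U.indicator (hf.mk f) with hf₁
  have hf₁m : Measurable f₁ := hf.stronglyMeasurable_mk.measurable.indicator hUm
  have hf₁s : ∀ y, Measurable fun z => f₁ (z, y) := fun y => hf₁m.comp measurable_prodMk_right
  have hf₁0 : ∀ X, X ∉ U → f₁ X = 0 := fun X hX => indicator_of_notMem hX _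
  have hae : f₁ =ᵐ[volume.restrict U] f := by
    filter_upwards [hf.ae_eq_mk, ae_restrict_mem hUm] with X h1 h2
    rw [hf₁, indicator_of_mem h2, h1]
  set N : ℝ → ℝ≥0∞ := fun y => ∫⁻ z, ‖f₁ (z, y)‖ₑ with hN
  have hNm : Measurable N := Measurable.lintegral_prod_left' (f := fun X : Pt n => ‖f₁ X‖ₑ) hf₁m.enorm
  set M : ℝ → ℝ≥0∞ := fun y => ∫⁻ z, ‖f₁ (z, y)‖ₑ ^ 2 with hM
  have hNM : ∀ y, N y ^ 2 ≤ volume D * M y := by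
    intro y
    have e1 : N y = ∫⁻ z in D, ‖f₁ (z, y)‖ₑ := by
      rw [hN, ← lintegral_indicator hDm]
      refine lintegral_congr fun z => ?_
      by_cases hz : z ∈ D
      · simp [hz]
      · simp [hz, hf₁0 (z, y) fun h => hz h.1]
    rw [e1]
    refine (sq_lintegral_le_measure_mul _ (hf₁s y).enorm.aemeasurable).trans ?_
    rw [Measure.restrict_apply_univ]
    exact mul_le_mul_right (setLIntegral_le_lintegral _ _) _
  have hμm : AEMeasurable μ (volume.restrict (Ioo 0 1)) :=
    hμ.integrable.aestronglyMeasurable.aemeasurable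
  have hfin : ∫⁻ y in Ioo 0 1, ENNReal.ofReal (μ y) * M y < ⊤ := by
    have h1 := hi.hasFiniteIntegral
    have hm : AEMeasurable (fun X : Pt n => ENNReal.ofReal (μ X.2) * ‖f₁ X‖ₑ ^ 2)
        ((volume : Measure (EuclideanSpace ℝ (Fin n))).prod (volume.restrict (Ioo 0 1))) :=
      hμm.ennreal_ofReal.comp_snd.mul (hf₁m.enorm.pow_const 2).aemeasurable
    have e1 : ∫⁻ y in Ioo 0 1, ENNReal.ofReal (μ y) * M y =
        ∫⁻ X in U, ENNReal.ofReal (μ X.2) * ‖f₁ X‖ₑ ^ 2 := by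
      calc _ = ∫⁻ X in univ ×ˢ Ioo (0 : ℝ) 1, ENNReal.ofReal (μ X.2) * ‖f₁ X‖ₑ ^ 2 := by
            rw [volume_restrict_prod, Measure.restrict_univ, lintegral_prod_symm _ hm]
            refine lintegral_congr fun y => ?_
            exact (lintegral_const_mul _ ((hf₁s y).enorm.pow_const 2)).symm
        _ = _ := by
            rw [← lintegral_indicator (MeasurableSet.univ.prod measurableSet_Ioo),
              ← lintegral_indicator hUm]
            refine lintegral_congr fun X => ?_
            by_cases hX : X ∈ U
            · simp only [indicator_of_mem hX]
              rw [indicator_of_mem (show X ∈ univ ×ˢ Ioo (0 : ℝ) 1 from ⟨mem_univ _, hX.2⟩)]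
            · simp [indicator, hf₁0 X hX]
    rw [e1]
    refine lt_of_le_of_lt (le_of_eq (lintegral_congr_ae ?_)) h1
    have hp : ∀ᵐ X : Pt n ∂(volume.restrict U), 0 < μ X.2 := by
      rw [hU, volume_restrict_prod]
      exact Measure.quasiMeasurePreserving_snd.ae hμ.pos
    filter_upwards [hae, hp] with X hX hX2
    rw [hX, ← ofReal_norm, ← ofReal_norm, norm_mul, Real.norm_of_nonneg (sq_nonneg _),
      Real.norm_of_nonneg hX2.le, ENNReal.ofReal_mul (sq_nonneg _), mul_comm,
      ← ENNReal.ofReal_pow (norm_nonneg _), Real.norm_eq_abs, sq_abs]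
  have hgood : ∀ᵐ y ∂(volume.restrict (Ioo (0 : ℝ) 1)), N y < ⊤ := by
    have hm : AEMeasurable (fun y => ENNReal.ofReal (μ y) * M y) (volume.restrict (Ioo 0 1)) :=
      hμm.ennreal_ofReal.mul (Measurable.lintegral_prod_left'
        (f := fun X : Pt n => ‖f₁ X‖ₑ ^ 2) (hf₁m.enorm.pow_const 2)).aemeasurable
    filter_upwards [ae_lt_top' hm hfin.ne, hμ.pos] with y hy hpos
    have hMy : M y < ⊤ := by
      by_contra hc
      rw [not_lt, top_le_iff] at hc
      rw [hc, ENNReal.mul_top (by simpa using hpos)] at hy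
      exact lt_irrefl _ hy
    have h2 : N y ^ 2 < ⊤ := (hNM y).trans_lt (ENNReal.mul_lt_top measure_ball_lt_top hMy)
    by_contra hc
    rw [not_lt, top_le_iff] at hc
    rw [hc] at h2
    simp at h2
  have hGm : MeasurableSet {X : Pt n | N X.2 < ⊤} :=
    measurableSet_lt (hNm.comp measurable_snd) measurable_const
  have hm' : Measurable ({X : Pt n | N X.2 < ⊤}.indicator f₁) := hf₁m.indicator hGm
  have hsl : ∀ y, Integrable fun z => {X : Pt n | N X.2 < ⊤}.indicator f₁ (z, y) := by
    intro y
    by_cases hy : N y < ⊤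
    · have : (fun z => {X : Pt n | N X.2 < ⊤}.indicator f₁ (z, y)) = fun z => f₁ (z, y) := by
        ext z; simp [indicator, hy]
      rw [this]
      exact ⟨(hf₁s y).aestronglyMeasurable, hy⟩
    · have : (fun z => {X : Pt n | N X.2 < ⊤}.indicator f₁ (z, y)) = fun z => 0 := by
        ext z; simp [indicator, hy]
      rw [this]
      exact integrable_zero _ _ _
  have hle : ∀ y, ENNReal.ofReal (sliceNorm ({X : Pt n | N X.2 < ⊤}.indicator f₁) y) ≤ N y := by
    intro y
    rw [sliceNorm, ofReal_integral_eq_lintegral_ofReal (hsl y).abs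
      (Eventually.of_forall fun _ => abs_nonneg _)]
    refine lintegral_mono fun z => ?_
    simp only
    rw [← Real.norm_eq_abs, ofReal_norm]
    exact enorm_indicator_le_enorm_self _ _
  refine ⟨{X : Pt n | N X.2 < ⊤}.indicator f₁, ⟨hm', hsl, ?_, ?_⟩, ?_, fun X hX => ?_⟩
  · have : StronglyMeasurable (Function.uncurry fun (y : ℝ) (z : EuclideanSpace ℝ (Fin n)) =>
        |{X : Pt n | N X.2 < ⊤}.indicator f₁ (z, y)|) :=
      (hm'.comp measurable_swap).abs.stronglyMeasurable
    exact (this.integral_prod_right.measurable.pow_const 2).aestronglyMeasurable.mul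
      hμ.integrable.aestronglyMeasurable
  · refine lt_of_le_of_lt ?_ (ENNReal.mul_lt_top (measure_ball_lt_top (x := (0 :
      EuclideanSpace ℝ (Fin n))) (r := ρ) (μ := volume)) hfin)
    rw [← lintegral_const_mul' _ _ measure_ball_lt_top.ne]
    refine lintegral_mono_ae ?_
    filter_upwards [hμ.pos] with y hpos
    rw [← ofReal_norm, norm_mul, Real.norm_of_nonneg (sq_nonneg _), Real.norm_of_nonneg hpos.le,
      ENNReal.ofReal_mul (sq_nonneg _), ENNReal.ofReal_pow (sliceNorm_nonneg _ _), mul_left_comm,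
      mul_comm]
    exact mul_le_mul_right ((pow_le_pow_left₀ (by positivity) (hle y) 2).trans (hNM y)) _
  · have : ∀ᵐ X : Pt n ∂(volume.restrict U), N X.2 < ⊤ := by
      rw [hU, volume_restrict_prod]
      exact Measure.quasiMeasurePreserving_snd.ae hgood
    filter_upwards [hae, this] with X h1 h2
    rw [indicator_of_mem (show X ∈ {X : Pt n | N X.2 < ⊤} from h2), h1]
  · by_cases h2 : N X.2 < ⊤ <;> simp [indicator, h2, hf₁0 X hX]

/-- Pairings with product test functions as iterated integrals. -/
theorem integral_slices_pairing {n : ℕ} {ρ : ℝ} {μ : ℝ → ℝ} {f f' : Pt n → ℝ}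
    (hf' : HasSlices μ f')
    (hae : f' =ᵐ[volume.restrict (Metric.ball (0 : EuclideanSpace ℝ (Fin n)) ρ ×ˢ Ioo 0 1)] f)
    (h0 : ∀ X, X ∉ Metric.ball (0 : EuclideanSpace ℝ (Fin n)) ρ ×ˢ Ioo (0 : ℝ) 1 → f' X = 0)
    {φ : EuclideanSpace ℝ (Fin n) → ℝ} (hφ : Continuous φ) (hφc : HasCompactSupport φ)
    {m : ℝ → ℝ} (hm : AEStronglyMeasurable m (volume.restrict (Ioo 0 1)))
    (hint : IntegrableOn (fun y => m y * sliceNorm f' y) (Ioo 0 1)) :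
    IntegrableOn (fun X => m X.2 * (f X * φ X.1))
      (Metric.ball (0 : EuclideanSpace ℝ (Fin n)) ρ ×ˢ Ioo 0 1) ∧
    IntegrableOn (fun y => m y * ∫ z, f' (z, y) * φ z) (Ioo 0 1) ∧
    ∫ y in Ioo (0 : ℝ) 1, m y * ∫ z, f' (z, y) * φ z =
      ∫ X in Metric.ball (0 : EuclideanSpace ℝ (Fin n)) ρ ×ˢ Ioo 0 1, m X.2 * (f X * φ X.1) := by
  obtain ⟨K, hK⟩ := hφc.exists_bound_of_continuous hφ
  have hK0 : 0 ≤ K := (norm_nonneg _).trans (hK 0)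
  have hsm : AEStronglyMeasurable (fun X : Pt n => m X.2 * (f' X * φ X.1))
      ((volume : Measure (EuclideanSpace ℝ (Fin n))).prod (volume.restrict (Ioo 0 1))) :=
    hm.comp_snd.mul (hf'.measurable.mul (hφ.measurable.comp measurable_fst)).aestronglyMeasurable
  have hprod : ∀ y, Integrable fun z => f' (z, y) * φ z := fun y =>
    (hf'.integrable y).mul_bdd (c := K) hφ.aestronglyMeasurable (Eventually.of_forall hK)
  have hI : Integrable (fun X : Pt n => m X.2 * (f' X * φ X.1))
      ((volume : Measure (EuclideanSpace ℝ (Fin n))).prod (volume.restrict (Ioo 0 1))) := by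
    rw [integrable_prod_iff' hsm]
    refine ⟨Eventually.of_forall fun y => (hprod y).const_mul (m y), ?_⟩
    refine Integrable.mono' (hint.norm.const_mul K) hsm.norm.prod_swap.integral_prod_right'
      (Eventually.of_forall fun y => ?_)
    rw [Real.norm_of_nonneg (integral_nonneg fun _ => norm_nonneg _), norm_mul,
      Real.norm_of_nonneg (sliceNorm_nonneg _ _), mul_left_comm, sliceNorm,
      ← integral_const_mul K, ← integral_const_mul]
    refine integral_mono ((hprod y).const_mul (m y)).norm
      (((hf'.integrable y).abs.const_mul K).const_mul _) fun z => ?_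
    simp only [norm_mul]
    rw [← Real.norm_eq_abs (f' _), mul_comm K]
    gcongr
    exact hK z
  have hUU : (volume : Measure (Pt n)).restrict (univ ×ˢ Ioo 0 1) =
      (volume : Measure (EuclideanSpace ℝ (Fin n))).prod (volume.restrict (Ioo 0 1)) := by
    rw [volume_restrict_prod, Measure.restrict_univ]
  have hcong : (fun X : Pt n => m X.2 * (f' X * φ X.1)) =ᵐ[volume.restrict
      (Metric.ball (0 : EuclideanSpace ℝ (Fin n)) ρ ×ˢ Ioo 0 1)]
      fun X => m X.2 * (f X * φ X.1) := by
    filter_upwards [hae] with X hX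
    rw [hX]
  have hI' := hI
  rw [← hUU] at hI'
  have hI2 : IntegrableOn (fun X : Pt n => m X.2 * (f' X * φ X.1))
      (Metric.ball (0 : EuclideanSpace ℝ (Fin n)) ρ ×ˢ Ioo 0 1) :=
    IntegrableOn.mono_set hI' (prod_mono (subset_univ _) le_rfl)
  refine ⟨hI2.congr hcong, ?_, ?_⟩
  · refine hI.integral_prod_right.congr (Eventually.of_forall fun y => ?_)
    simp only
    rw [integral_const_mul]
  rw [← integral_congr_ae hcong]
  have e2 : ∫ X in Metric.ball (0 : EuclideanSpace ℝ (Fin n)) ρ ×ˢ Ioo (0 : ℝ) 1,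
      m X.2 * (f' X * φ X.1) = ∫ X in (univ : Set (EuclideanSpace ℝ (Fin n))) ×ˢ Ioo (0 : ℝ) 1,
      m X.2 * (f' X * φ X.1) := by
    refine (setIntegral_eq_of_subset_of_forall_sdiff_eq_zero
      (MeasurableSet.univ.prod measurableSet_Ioo) (prod_mono (subset_univ _) le_rfl) ?_).symm
    intro X hX
    rw [h0 X hX.2]; ring
  rw [e2, hUU, integral_prod_symm _ hI]
  refine integral_congr_ae (Eventually.of_forall fun y => ?_)
  simp only
  rw [integral_const_mul]

theorem classicalGrad_prod {n : ℕ} {φ : EuclideanSpace ℝ (Fin n) → ℝ} {ζ : ℝ → ℝ}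
    (hφ : ContDiff ℝ ∞ φ) (hζ : ContDiff ℝ ∞ ζ) (X : Pt n) :
    classicalGrad (fun X : Pt n => φ X.1 * ζ X.2) X =
      WithLp.toLp 2 (Sum.elim (fun i => fderiv ℝ φ X.1 (EuclideanSpace.single i 1) * ζ X.2)
        (fun _ => φ X.1 * deriv ζ X.2)) := by
  have h1 : HasFDerivAt (fun X : Pt n => φ X.1)
      ((fderiv ℝ φ X.1).comp (ContinuousLinearMap.fst ℝ _ _)) X :=
    ((hφ.differentiable (by simp)) X.1).hasFDerivAt.comp X hasFDerivAt_fst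
  have h2 : HasFDerivAt (fun X : Pt n => ζ X.2)
      ((fderiv ℝ ζ X.2).comp (ContinuousLinearMap.snd ℝ _ _)) X :=
    ((hζ.differentiable (by simp)) X.2).hasFDerivAt.comp X hasFDerivAt_snd
  have h3 : fderiv ℝ (fun X : Pt n => φ X.1 * ζ X.2) X = _ := (h1.mul h2).fderiv
  ext i
  rcases i with i | i
  · simp [classicalGrad, h3, mul_comm]
  · simp [classicalGrad, h3]

theorem tsupport_prod_subset {n : ℕ} {φ : EuclideanSpace ℝ (Fin n) → ℝ} {ζ : ℝ → ℝ} :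
    tsupport (fun X : Pt n => φ X.1 * ζ X.2) ⊆ tsupport φ ×ˢ tsupport ζ := by
  refine closure_minimal (fun X hX => ?_) ((isClosed_tsupport φ).prod (isClosed_tsupport ζ))
  exact ⟨subset_closure (left_ne_zero_of_mul hX), subset_closure (right_ne_zero_of_mul hX)⟩

theorem IsDegElliptic.form_bounds {n : ℕ} {τ Λ : ℝ} {μ : ℝ → ℝ}
    {A : ℝ → Matrix (Fin n ⊕ Unit) (Fin n ⊕ Unit) ℝ} (hA : IsDegElliptic τ Λ μ A)
    (hblock : ∀ y i, A y (Sum.inl i) (Sum.inr ()) = 0 ∧ A y (Sum.inr ()) (Sum.inl i) = 0) :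
    ∀ᵐ y ∂(volume.restrict (Ioo (0 : ℝ) τ)), ∀ (ξ : Fin n → ℝ) (t : ℝ),
    Λ⁻¹ * μ y * (∑ i, ξ i ^ 2 + t ^ 2) ≤
      ∑ i, ∑ j, A y (Sum.inl i) (Sum.inl j) * ξ i * ξ j + A y (Sum.inr ()) (Sum.inr ()) * t ^ 2 ∧
      ∑ i, ∑ j, A y (Sum.inl i) (Sum.inl j) * ξ i * ξ j + A y (Sum.inr ()) (Sum.inr ()) * t ^ 2
        ≤ Λ * μ y * (∑ i, ξ i ^ 2 + t ^ 2) := by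
  filter_upwards [hA.elliptic] with y hy ξ t
  have h := hy (WithLp.toLp 2 (Sum.elim ξ fun _ => t))
  have e1 : ‖(WithLp.toLp 2 (Sum.elim ξ fun _ => t) : Vec n)‖ ^ 2 = ∑ i, ξ i ^ 2 + t ^ 2 := by
    rw [EuclideanSpace.norm_sq_eq, Fintype.sum_sum_type]
    simp
  have e2 : (A y *ᵥ (WithLp.toLp 2 (Sum.elim ξ fun _ => t) : Vec n).ofLp) ⬝ᵥ
      (WithLp.toLp 2 (Sum.elim ξ fun _ => t) : Vec n).ofLp =
      ∑ i, ∑ j, A y (Sum.inl i) (Sum.inl j) * ξ i * ξ j +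
        A y (Sum.inr ()) (Sum.inr ()) * t ^ 2 := by
    simp only [dotProduct, Matrix.mulVec, Fintype.sum_sum_type, Sum.elim_inl, Sum.elim_inr,
      Finset.univ_unique, Finset.sum_singleton, PUnit.default_eq_unit, (hblock y _).1,
      (hblock y _).2, zero_mul, Finset.sum_const_zero, add_zero, zero_add, Finset.sum_mul]
    congr 1
    · exact Finset.sum_congr rfl fun i _ => Finset.sum_congr rfl fun j _ => by ring
    · ring
  rwa [e1, e2] at h

/-- Product tests φ(x) ζ(y) and Fubini turn the integrals over the cylinder into iterated ones. The
block form of A separates tangential and vertical terms, and the functions are replaced by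
representatives with integrable slices. -/
theorem LocalSol.exists_sliceSol {n : ℕ} {ρ Λ : ℝ} {μ : ℝ → ℝ}
    {A : ℝ → Matrix (Fin n ⊕ Unit) (Fin n ⊕ Unit) ℝ} {v : Pt n → ℝ} {G : Pt n → Vec n}
    (h : LocalSol 0 ρ 1 μ A v G) (hΛ : 0 < Λ) (hμ : UnitWeight μ) (hA : IsDegElliptic 1 Λ μ A)
    (hblock : ∀ y i, A y (Sum.inl i) (Sum.inr ()) = 0 ∧ A y (Sum.inr ()) (Sum.inl i) = 0) :
    ∃ (v' g' : Pt n → ℝ) (G' : Fin n → Pt n → ℝ),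
      SliceSol ρ Λ μ (fun i j y => A y (Sum.inl i) (Sum.inl j))
        (fun y => A y (Sum.inr ()) (Sum.inr ())) v' g' G' ∧
      (g' =ᵐ[volume.restrict (Metric.ball (0 : EuclideanSpace ℝ (Fin n)) ρ ×ˢ Ioo 0 1)]
        fun X => G X (Sum.inr ())) ∧
      (∀ i, G' i =ᵐ[volume.restrict (Metric.ball (0 : EuclideanSpace ℝ (Fin n)) ρ ×ˢ Ioo 0 1)]
        fun X => G X (Sum.inl i)) ∧
      ∀ i X, X ∉ Metric.ball (0 : EuclideanSpace ℝ (Fin n)) ρ ×ˢ Ioo (0 : ℝ) 1 → G' i X = 0 := by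
  have hposU : ∀ᵐ X : Pt n ∂(volume.restrict
      (Metric.ball (0 : EuclideanSpace ℝ (Fin n)) ρ ×ˢ Ioo (0 : ℝ) 1)), 0 < μ X.2 := by
    rw [volume_restrict_prod]
    exact Measure.quasiMeasurePreserving_snd.ae hμ.pos
  have hcomp_m : ∀ k, AEStronglyMeasurable (fun X => G X k) (volume.restrict
      (Metric.ball (0 : EuclideanSpace ℝ (Fin n)) ρ ×ˢ Ioo (0 : ℝ) 1)) := fun k =>
    (show Continuous fun w : Vec n => w k by fun_prop).comp_aestronglyMeasurable h.grad_aesm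
  have hcomp_i : ∀ k, IntegrableOn (fun X => G X k ^ 2 * μ X.2)
      (Metric.ball (0 : EuclideanSpace ℝ (Fin n)) ρ ×ˢ Ioo (0 : ℝ) 1) := by
    intro k
    refine Integrable.mono' h.grad_sq_integrable (((hcomp_m k).pow 2).mul ?_) ?_
    · rw [volume_restrict_prod]
      exact hμ.integrable.aestronglyMeasurable.comp_snd
    · filter_upwards [hposU] with X hX
      rw [Real.norm_of_nonneg (by positivity)]
      have := EuclideanSpace.norm_sq_eq (G X)
      rw [this]
      gcongr
      rw [← sq_abs, ← Real.norm_eq_abs]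
      exact Finset.single_le_sum (f := fun k => ‖G X k‖ ^ 2) (fun _ _ => by positivity)
        (Finset.mem_univ k)
  obtain ⟨v', hv', hve, hv0⟩ := exists_slices hμ h.aesm h.sq_integrable
  obtain ⟨g', hg', hge, hg0⟩ := exists_slices hμ (hcomp_m (Sum.inr ())) (hcomp_i (Sum.inr ()))
  choose G' hG' hGe hG0 using fun i : Fin n =>
    exists_slices hμ (hcomp_m (Sum.inl i)) (hcomp_i (Sum.inl i))
  have hform := hA.form_bounds hblock
  have hsymm : ∀ᵐ y ∂(volume.restrict (Ioo (0 : ℝ) 1)), ∀ i j : Fin n,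
      A y (Sum.inl i) (Sum.inl j) = A y (Sum.inl j) (Sum.inl i) := by
    filter_upwards [hA.isSymm] with y hy i j
    exact (hy.apply _ _)
  have habs_a : ∀ᵐ y ∂(volume.restrict (Ioo (0 : ℝ) 1)), ∀ i j : Fin n,
      |A y (Sum.inl i) (Sum.inl j)| ≤ 2 * Λ * μ y := by
    filter_upwards [hform, hsymm, hμ.pos] with y h1 h2 h3 i j
    exact abs_entry_le_of_form_bounds (a := fun i j => A y (Sum.inl i) (Sum.inl j)) hΛ h3 h2 h1 i j
  have habs_d : ∀ᵐ y ∂(volume.restrict (Ioo (0 : ℝ) 1)),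
      |A y (Sum.inr ()) (Sum.inr ())| ≤ 2 * Λ * μ y := by
    filter_upwards [hform, hμ.pos] with y h1 h3
    have := h1 0 1
    simp only [Pi.zero_apply, mul_zero, Finset.sum_const_zero, ne_eq, OfNat.ofNat_ne_zero,
      not_false_eq_true, zero_pow, one_pow, mul_one, zero_add] at this
    have h4 : 0 < Λ * μ y := mul_pos hΛ h3
    have h5 : 0 < Λ⁻¹ * μ y := mul_pos (inv_pos.2 hΛ) h3
    rw [abs_le]
    constructor <;> nlinarith [this.1, this.2]
  have int1 : ∀ {f : Pt n → ℝ}, HasSlices μ f → ∀ {ζ : ℝ → ℝ}, Continuous ζ →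
      IntegrableOn (fun y => ζ y * sliceNorm f y) (Ioo 0 1) := by
    intro f hf ζ hζ
    refine ((hf.integrable_sliceNorm hμ).mul_continuous_Ioo hζ).congr
      (Eventually.of_forall fun y => mul_comm _ _)
  have int2 : ∀ {f : Pt n → ℝ}, HasSlices μ f → ∀ {ζ : ℝ → ℝ}, Continuous ζ → ∀ {a : ℝ → ℝ},
      AEMeasurable a (volume.restrict (Ioo 0 1)) →
      (∀ᵐ y ∂(volume.restrict (Ioo (0 : ℝ) 1)), |a y| ≤ 2 * Λ * μ y) →
      IntegrableOn (fun y => a y * ζ y * sliceNorm f y) (Ioo 0 1) := by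
    intro f hf ζ hζ a ha hab
    have : IntegrableOn (fun y => a y * sliceNorm f y) (Ioo 0 1) := by
      refine Integrable.mono' ((hf.integrable_weight hμ).const_mul (2 * Λ))
        (ha.aestronglyMeasurable.mul hf.measurable_sliceNorm.aestronglyMeasurable) ?_
      filter_upwards [hab] with y hy
      rw [norm_mul, Real.norm_eq_abs, Real.norm_of_nonneg (sliceNorm_nonneg _ _)]
      calc _ ≤ 2 * Λ * μ y * sliceNorm f y := mul_le_mul_of_nonneg_right hy (sliceNorm_nonneg _ _)
        _ = _ := by ring
    refine (this.mul_continuous_Ioo hζ).congr (Eventually.of_forall fun y => ?_)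
    simp only; ring
  have hpc : ∀ {φ : EuclideanSpace ℝ (Fin n) → ℝ}, ContDiff ℝ ∞ φ → HasCompactSupport φ →
      ∀ i : Fin n, Continuous (fun z => fderiv ℝ φ z (EuclideanSpace.single i 1)) ∧
        HasCompactSupport (fun z => fderiv ℝ φ z (EuclideanSpace.single i 1)) := by
    intro φ hφ hφc i
    exact ⟨(hφ.continuous_fderiv (by simp)).clm_apply continuous_const, hφc.fderiv_apply ℝ _⟩
  refine ⟨v', g', G', ⟨hΛ, hμ, fun i j => hA.aemeasurable _ _, hA.aemeasurable _ _, hsymm, hform,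
    hv', hg', hG', ?_, ?_, ?_⟩, hge, hGe, hG0⟩
  · intro φ hφ hφc hφs ζ hζ hζc hζs i
    have hw := h.weak (fun X => φ X.1 * ζ X.2)
      ((hφ.comp contDiff_fst).mul (hζ.comp contDiff_snd))
      (HasCompactSupport.of_support_subset_isCompact (hφc.isCompact.prod hζc.isCompact)
        (subset_closure.trans tsupport_prod_subset))
      (tsupport_prod_subset.trans (prod_mono hφs hζs)) (Sum.inl i)
    obtain ⟨-, -, e1⟩ := integral_slices_pairing hv' hve hv0 (hpc hφ hφc i).1 (hpc hφ hφc i).2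
      hζ.continuous.aestronglyMeasurable (int1 hv' hζ.continuous)
    obtain ⟨-, -, e2⟩ := integral_slices_pairing (hG' i) (hGe i) (hG0 i) hφ.continuous hφc
      hζ.continuous.aestronglyMeasurable (int1 (hG' i) hζ.continuous)
    simp only [mul_comm _ (ζ _)]
    rw [e1, e2]
    convert hw using 2
    · ext X
      rw [classicalGrad_prod hφ hζ]
      simp only [Sum.elim_inl]; ring
    · refine integral_congr_ae (Eventually.of_forall fun X => ?_)
      simp only; ring
  · intro φ hφ hφc hφs ζ hζ hζc hζs
    have hw := h.weak (fun X => φ X.1 * ζ X.2)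
      ((hφ.comp contDiff_fst).mul (hζ.comp contDiff_snd))
      (HasCompactSupport.of_support_subset_isCompact (hφc.isCompact.prod hζc.isCompact)
        (subset_closure.trans tsupport_prod_subset))
      (tsupport_prod_subset.trans (prod_mono hφs hζs)) (Sum.inr ())
    have hζ' : Continuous (deriv ζ) := hζ.continuous_deriv (by simp)
    obtain ⟨-, -, e1⟩ := integral_slices_pairing hv' hve hv0 hφ.continuous hφc
      hζ'.aestronglyMeasurable (int1 hv' hζ')
    obtain ⟨-, -, e2⟩ := integral_slices_pairing hg' hge hg0 hφ.continuous hφc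
      hζ.continuous.aestronglyMeasurable (int1 hg' hζ.continuous)
    simp only [mul_comm _ (ζ _), mul_comm _ (deriv ζ _)]
    rw [e1, e2]
    convert hw using 2
    · ext X
      rw [classicalGrad_prod hφ hζ]
      simp only [Sum.elim_inr]; ring
    · refine integral_congr_ae (Eventually.of_forall fun X => ?_)
      simp only; ring
  · rintro φ hφ hφc hφs ζ hζ ⟨S, hS1, hS⟩
    -- The closed support stays strictly below the top since S < 1. It may reach y = 0 and below,
    -- which the weak equation allows.
    have hζs : tsupport ζ ⊆ Iio 1 := by
      have : tsupport ζ ⊆ Iic S := closure_minimal (fun y hy => by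
        by_contra hc
        exact hy (hS y (not_le.1 hc).le)) isClosed_Iic
      exact this.trans (Iic_subset_Iio.2 hS1)
    have hw := h.eq (fun X => φ X.1 * ζ X.2)
      ((hφ.comp contDiff_fst).mul (hζ.comp contDiff_snd))
      (tsupport_prod_subset.trans (prod_mono hφs hζs))
    have hζ' : Continuous (deriv ζ) := hζ.continuous_deriv (by simp)
    have P1 := fun i j : Fin n => integral_slices_pairing (hG' j) (hGe j) (hG0 j)
      (hpc hφ hφc i).1 (hpc hφ hφc i).2
      (m := fun y => A y (Sum.inl i) (Sum.inl j) * ζ y)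
      ((hA.aemeasurable _ _).aestronglyMeasurable.mul hζ.continuous.aestronglyMeasurable)
      (int2 (hG' j) hζ.continuous (hA.aemeasurable _ _) (habs_a.mono fun y hy => hy i j))
    have P2 := integral_slices_pairing hg' hge hg0 hφ.continuous hφc
      (m := fun y => A y (Sum.inr ()) (Sum.inr ()) * deriv ζ y)
      ((hA.aemeasurable _ _).aestronglyMeasurable.mul hζ'.aestronglyMeasurable)
      (int2 hg' hζ' (hA.aemeasurable _ _) habs_d)
    calc _ = ∫ y in Ioo (0 : ℝ) 1, ((∑ i, ∑ j, A y (Sum.inl i) (Sum.inl j) * ζ y *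
            ∫ z, G' j (z, y) * fderiv ℝ φ z (EuclideanSpace.single i 1)) +
            A y (Sum.inr ()) (Sum.inr ()) * deriv ζ y * ∫ z, g' (z, y) * φ z) := by
          congr 1; ext y
          congr 1
          · rw [Finset.sum_mul]
            refine Finset.sum_congr rfl fun i _ => ?_
            rw [Finset.sum_mul]
            exact Finset.sum_congr rfl fun j _ => by ring
          · ring
      _ = (∑ i, ∑ j, ∫ X in Metric.ball (0 : EuclideanSpace ℝ (Fin n)) ρ ×ˢ Ioo (0 : ℝ) 1,
            A X.2 (Sum.inl i) (Sum.inl j) * ζ X.2 *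
              (G X (Sum.inl j) * fderiv ℝ φ X.1 (EuclideanSpace.single i 1))) +
            ∫ X in Metric.ball (0 : EuclideanSpace ℝ (Fin n)) ρ ×ˢ Ioo (0 : ℝ) 1,
              A X.2 (Sum.inr ()) (Sum.inr ()) * deriv ζ X.2 * (G X (Sum.inr ()) * φ X.1) := by
          rw [integral_add (integrable_finsetSum _ fun i _ => integrable_finsetSum _ fun j _ =>
            (P1 i j).2.1) P2.2.1, integral_finsetSum _ fun i _ => integrable_finsetSum _ fun j _ =>
            (P1 i j).2.1, P2.2.2]
          congr 1
          refine Finset.sum_congr rfl fun i _ => ?_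
          rw [integral_finsetSum _ fun j _ => (P1 i j).2.1]
          exact Finset.sum_congr rfl fun j _ => (P1 i j).2.2
      _ = 0 := by
          refine Eq.trans ?_ hw
          simp only [dotProduct, Matrix.mulVec, Fintype.sum_sum_type, classicalGrad_prod hφ hζ,
            Sum.elim_inl, Sum.elim_inr, Finset.univ_unique, Finset.sum_singleton,
            PUnit.default_eq_unit, (hblock _ _).1, (hblock _ _).2, zero_mul,
            Finset.sum_const_zero, add_zero, zero_add, Finset.sum_mul]
          have Q1 : ∀ i j : Fin n, IntegrableOn (fun X : Pt n => A X.2 (Sum.inl i) (Sum.inl j) *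
              G X (Sum.inl j) * (fderiv ℝ φ X.1 (EuclideanSpace.single i 1) * ζ X.2))
              (Metric.ball (0 : EuclideanSpace ℝ (Fin n)) ρ ×ˢ Ioo (0 : ℝ) 1) := fun i j =>
            (P1 i j).1.congr (Eventually.of_forall fun X => by simp only; ring)
          have Q2 : IntegrableOn (fun X : Pt n => A X.2 (Sum.inr ()) (Sum.inr ()) *
              G X (Sum.inr ()) * (φ X.1 * deriv ζ X.2))
              (Metric.ball (0 : EuclideanSpace ℝ (Fin n)) ρ ×ˢ Ioo (0 : ℝ) 1) :=
            P2.1.congr (Eventually.of_forall fun X => by simp only; ring)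
          rw [integral_add (integrable_finsetSum _ fun i _ => integrable_finsetSum _ fun j _ =>
            Q1 i j) Q2, integral_finsetSum _ fun i _ => integrable_finsetSum _ fun j _ => Q1 i j]
          congr 1
          · refine Finset.sum_congr rfl fun i _ => ?_
            rw [integral_finsetSum _ fun j _ => Q1 i j]
            refine Finset.sum_congr rfl fun j _ => ?_
            exact integral_congr_ae (Eventually.of_forall fun X => by simp only; ring)
          · exact integral_congr_ae (Eventually.of_forall fun X => by simp only; ring)

/-! ### Change of scale for integrals, weights and coefficients -/

theorem setLIntegral_comp_homothety {E : Type*} [NormedAddCommGroup E] [NormedSpace ℝ E]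
    [MeasurableSpace E] [BorelSpace E] [FiniteDimensional ℝ E] (m : Measure E) [m.IsAddHaarMeasure]
    {t : ℝ} (x₀ : E) (ht : 0 < t) {U : Set E} (hU : MeasurableSet U) (F : E → ℝ≥0∞) :
    ∫⁻ x in (fun x : E => t • x + x₀) ⁻¹' U, F (t • x + x₀) ∂m =
      ENNReal.ofReal (t ^ Module.finrank ℝ E)⁻¹ * ∫⁻ x in U, F x ∂m := by
  set e : E ≃ᵐ E := ((Homeomorph.smulOfNeZero t ht.ne').trans (Homeomorph.addRight x₀)).toMeasurableEquiv
  have he : ⇑e = fun x : E => t • x + x₀ := rfl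
  have hmap : m.map e = ENNReal.ofReal (t ^ Module.finrank ℝ E)⁻¹ • m := by
    have : (fun x : E => t • x + x₀) = (fun x => x + x₀) ∘ fun x => t • x := rfl
    rw [he, this, ← Measure.map_map (by fun_prop) (by fun_prop), Measure.map_addHaar_smul m ht.ne',
      Measure.map_smul, map_add_right_eq_self, abs_of_pos (by positivity)]
  have h1 := e.measurableEmbedding.lintegral_map (μ := m.restrict (e ⁻¹' U)) F
  rw [← Measure.restrict_map e.measurable hU, hmap, Measure.restrict_smul, lintegral_smul_measure] at h1
  exact h1.symm

theorem preimage_homothety_Ioo {t : ℝ} (ht : 0 < t) (y : ℝ) :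
    (fun x : ℝ => t • x + 0) ⁻¹' Ioo 0 (t * y) = Ioo 0 y := by
  ext x
  simp only [mem_preimage, smul_eq_mul, add_zero, mem_Ioo]
  rw [mul_lt_mul_iff_right₀ ht, mul_pos_iff_of_pos_left ht]

theorem quasiMeasurePreserving_mul_Ioo {t : ℝ} (ht : 0 < t) :
    Measure.QuasiMeasurePreserving (fun y : ℝ => t * y) (volume.restrict (Ioo 0 1))
      (volume.restrict (Ioo 0 t)) := by
  have h := quasiMeasurePreserving_homothety (volume : Measure ℝ) 0 ht.ne'
  simp only [smul_eq_mul, add_zero] at h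
  refine h.restrict fun x hx => ?_
  exact ⟨mul_pos ht hx.1, by nlinarith [hx.2]⟩

section weight

variable {μ : ℝ → ℝ} {τ M₀ : ℝ}

theorem IsA2Weight.integrableOn (hμ : IsA2Weight μ) (τ : ℝ) : IntegrableOn μ (Ioo 0 τ) :=
  (hμ.locallyIntegrable.integrableOn_isCompact isCompact_Icc).mono_set Ioo_subset_Icc_self

theorem IsA2Weight.integral_pos (hμ : IsA2Weight μ) (hτ : 0 < τ) : 0 < ∫ y in Ioo 0 τ, μ y := by
  rw [integral_pos_iff_support_of_nonneg_ae (Eventually.of_forall hμ.nonneg) (hμ.integrableOn τ)]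
  have : (volume.restrict (Ioo 0 τ)) (Function.support μ) = volume (Ioo 0 τ) := by
    rw [← Measure.restrict_apply_univ (Ioo 0 τ)]
    refine measure_congr ?_
    filter_upwards [ae_restrict_of_ae hμ.pos_ae] with y hy
    exact propext ⟨fun _ => mem_univ y, fun _ => hy.ne'⟩
  rw [this, Real.volume_Ioo]
  simpa using hτ

/-- Only the interval (0, τ), the ball of centre and radius τ / 2, is used from the supremum
defining the A₂ constant; the factor τ² undoes the two averages. -/
theorem IsA2Weight.lintegral_mul_le (hM : a2Const μ ≤ ENNReal.ofReal M₀) (hτ : 0 < τ) :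
    (∫⁻ y in Ioo 0 τ, ENNReal.ofReal (μ y)) * ∫⁻ y in Ioo 0 τ, (ENNReal.ofReal (μ y))⁻¹ ≤
      ENNReal.ofReal (τ ^ 2 * M₀) := by
  have hb : Metric.ball (τ / 2) (τ / 2) = Ioo 0 τ := by
    rw [Real.ball_eq_Ioo]; congr 1 <;> ring
  have h : laverage (volume.restrict (Ioo 0 τ)) (fun y => ENNReal.ofReal (μ y)) *
      laverage (volume.restrict (Ioo 0 τ)) (fun y => (ENNReal.ofReal (μ y))⁻¹) ≤
        ENNReal.ofReal M₀ := by
    refine le_trans ?_ hM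
    rw [← hb]
    exact le_iSup_of_le (τ / 2) (le_iSup_of_le (τ / 2) (le_iSup_of_le (half_pos hτ) le_rfl))
  rw [laverage_eq, laverage_eq, Measure.restrict_apply_univ, Real.volume_Ioo, sub_zero] at h
  have hτ0 : ENNReal.ofReal τ ≠ 0 := by simpa using hτ
  have h2 := mul_le_mul_right h (ENNReal.ofReal τ ^ 2)
  rw [ENNReal.ofReal_mul (by positivity), ENNReal.ofReal_pow hτ.le]
  refine le_trans (le_of_eq ?_) h2
  set a := ∫⁻ y in Ioo 0 τ, ENNReal.ofReal (μ y)
  set b := ∫⁻ y in Ioo 0 τ, (ENNReal.ofReal (μ y))⁻¹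
  calc a * b = (ENNReal.ofReal τ * (a / ENNReal.ofReal τ)) *
        (ENNReal.ofReal τ * (b / ENNReal.ofReal τ)) := by
        rw [ENNReal.mul_div_cancel hτ0 ENNReal.ofReal_ne_top,
          ENNReal.mul_div_cancel hτ0 ENNReal.ofReal_ne_top]
    _ = _ := by ring

theorem IsA2Weight.lintegral_inv (hμ : IsA2Weight μ) (τ : ℝ) :
    ∫⁻ y in Ioo 0 τ, (ENNReal.ofReal (μ y))⁻¹ = ∫⁻ y in Ioo 0 τ, ENNReal.ofReal (μ y)⁻¹ :=
  lintegral_congr_ae (by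
    filter_upwards [ae_restrict_of_ae hμ.pos_ae] with y hy
    rw [ENNReal.ofReal_inv_of_pos hy])

/-- Rescaled `A₂` weights and their masses on the unit interval. -/
theorem IsA2Weight.rescale (hμ : IsA2Weight μ) (hM : a2Const μ ≤ ENNReal.ofReal M₀) (hτ : 0 < τ) :
    UnitWeight (fun y => μ (τ * y)) ∧
      invMass (fun y => μ (τ * y)) * ENNReal.ofReal (τ⁻¹ * ∫ y in Ioo 0 τ, μ y) ≤
        ENNReal.ofReal M₀ := by
  have hmul := IsA2Weight.lintegral_mul_le hM hτ
  rw [hμ.lintegral_inv τ, ← ofReal_integral_eq_lintegral_ofReal (hμ.integrableOn τ)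
    (Eventually.of_forall hμ.nonneg)] at hmul
  have hpos := hμ.integral_pos hτ
  have hpre : (fun x : ℝ => τ • x + 0) ⁻¹' Ioo 0 τ = Ioo 0 1 := by
    simpa using preimage_homothety_Ioo hτ 1
  have hinv : IntegrableOn (fun y => (μ y)⁻¹) (Ioo 0 τ) := by
    refine ⟨(hμ.integrableOn τ).aestronglyMeasurable.aemeasurable.inv.aestronglyMeasurable, ?_⟩
    rw [hasFiniteIntegral_iff_ofReal (Eventually.of_forall fun y => inv_nonneg.2 (hμ.nonneg y))]
    -- An infinite mass of μ⁻¹ would make the product infinite, as the mass of μ is positive.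
    by_contra hc
    rw [not_lt, top_le_iff] at hc
    rw [hc, ENNReal.mul_top (by simpa using hpos)] at hmul
    exact ENNReal.ofReal_ne_top (top_le_iff.1 hmul)
  refine ⟨⟨?_, ?_, ?_⟩, ?_⟩
  · have := integrableOn_comp_homothety volume 0 hτ.ne' measurableSet_Ioo (hμ.integrableOn τ)
    rw [hpre] at this
    simpa using this
  · have := integrableOn_comp_homothety volume 0 hτ.ne' measurableSet_Ioo hinv
    rw [hpre] at this
    simpa using this
  · exact (quasiMeasurePreserving_mul_Ioo hτ).ae (ae_restrict_of_ae hμ.pos_ae)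
  · have h1 := setLIntegral_comp_homothety volume 0 hτ (measurableSet_Ioo (a := 0) (b := τ))
      fun y => ENNReal.ofReal (μ y)⁻¹
    rw [hpre] at h1
    simp only [smul_eq_mul, add_zero, Module.finrank_self, pow_one] at h1
    rw [invMass, h1, ENNReal.ofReal_mul (by positivity)]
    calc _ = ENNReal.ofReal τ⁻¹ * ENNReal.ofReal τ⁻¹ * (ENNReal.ofReal (∫ y in Ioo 0 τ, μ y) *
          ∫⁻ y in Ioo 0 τ, ENNReal.ofReal (μ y)⁻¹) := by ring
      _ ≤ ENNReal.ofReal τ⁻¹ * ENNReal.ofReal τ⁻¹ * ENNReal.ofReal (τ ^ 2 * M₀) :=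
        mul_le_mul_right hmul _
      _ = ENNReal.ofReal M₀ := by
        rw [← ENNReal.ofReal_mul (by positivity), ← ENNReal.ofReal_mul (by positivity)]
        congr 1; field_simp

theorem GrowthCond.rescale {C₀ : ℝ} (h : GrowthCond C₀ τ μ) (hτ : 0 < τ) :
    ∀ᵐ y ∂(volume.restrict (Ioo (0 : ℝ) 1)), ∫ s in Ioo 0 y, μ (τ * s) ≤ C₀ * μ (τ * y) := by
  filter_upwards [h] with y hy
  have h1 := setIntegral_comp_homothety volume 0 hτ (measurableSet_Ioo (a := 0) (b := τ * y)) μ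
  rw [preimage_homothety_Ioo hτ] at h1
  simp only [smul_eq_mul, add_zero, Module.finrank_self, pow_one] at h1
  rw [h1]
  calc _ ≤ τ⁻¹ * (C₀ * τ * μ (τ * y)) := by gcongr
    _ = _ := by field_simp

theorem IsDegElliptic.rescale {n : ℕ} {Λ : ℝ} {A : ℝ → Matrix (Fin n ⊕ Unit) (Fin n ⊕ Unit) ℝ}
    (h : IsDegElliptic τ Λ μ A) (hτ : 0 < τ) :
    IsDegElliptic 1 Λ (fun y => μ (τ * y)) (fun y => A (τ * y)) :=
  ⟨fun i j => (h.aemeasurable i j).comp_quasiMeasurePreserving (quasiMeasurePreserving_mul_Ioo hτ),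
    (quasiMeasurePreserving_mul_Ioo hτ).ae h.isSymm,
    (quasiMeasurePreserving_mul_Ioo hτ).ae h.elliptic⟩

theorem muHat_cyl (n : ℕ) (μ : ℝ → ℝ) (hτ : 0 < τ) :
    muHat μ (cyl (baseBall n τ) τ) =
      volume.real (Metric.ball (0 : EuclideanSpace ℝ (Fin n)) 1) * (τ ^ n * ∫ y in Ioo 0 τ, μ y) := by
  have h1 : volume.real (Metric.ball (0 : EuclideanSpace ℝ (Fin n)) τ) =
      τ ^ n * volume.real (Metric.ball (0 : EuclideanSpace ℝ (Fin n)) 1) := by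
    rw [Measure.real, Measure.real, Measure.addHaar_ball_of_pos _ _ hτ, ENNReal.toReal_mul,
      ENNReal.toReal_ofReal (by positivity), finrank_euclideanSpace_fin]
  rw [muHat, cyl, baseBall, volume_restrict_prod]
  have := integral_prod_mul (μ := volume.restrict (Metric.ball (0 : EuclideanSpace ℝ (Fin n)) τ))
    (ν := volume.restrict (Ioo 0 τ)) (fun _ => (1 : ℝ)) μ
  simp only [one_mul, integral_const, smul_eq_mul, mul_one, measureReal_restrict_apply_univ] at this
  rw [this, h1]
  ring

end weight

/-! ### The interior gradient bound at height τ -/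

theorem norm_vec_le {n : ℕ} (w : Vec n) {B : ℝ} (hB : 0 ≤ B) (h : ∀ k, |w k| ≤ B) :
    ‖w‖ ≤ (n + 1) * B := by
  have h1 : ‖w‖ ^ 2 ≤ (n + 1) * B ^ 2 := by
    rw [EuclideanSpace.norm_sq_eq]
    calc _ ≤ ∑ k : Fin n ⊕ Unit, B ^ 2 := Finset.sum_le_sum fun k _ => by
          rw [Real.norm_eq_abs]
          exact pow_le_pow_left₀ (abs_nonneg _) (h k) 2
      _ = _ := by simp
  refine abs_le_of_sq_le_sq' (h1.trans ?_) (by positivity) |>.2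
  rw [mul_pow]
  have : (1 : ℝ) ≤ n + 1 := by linarith [(Nat.cast_nonneg n : (0 : ℝ) ≤ n)]
  nlinarith [sq_nonneg B]

/-- Gradient bound for weak solutions on cylinders. -/
theorem LocalSol.exists_gradient_bound (n : ℕ) {ρ Λ C₀ θ : ℝ} (M₀ : ℝ) (hρ : 0 < ρ) (hΛ : 0 < Λ)
    (hC₀ : 0 < C₀) (hθ : θ < 1) :
    ∃ c, 0 < c ∧ c ≤ ρ ∧ ∃ C, 0 < C ∧ ∀ {x₀ : EuclideanSpace ℝ (Fin n)} {τ : ℝ} {μ : ℝ → ℝ}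
      {A : ℝ → Matrix (Fin n ⊕ Unit) (Fin n ⊕ Unit) ℝ} {v : Pt n → ℝ} {G : Pt n → Vec n} {E : ℝ},
      0 < τ → IsA2Weight μ → a2Const μ ≤ ENNReal.ofReal M₀ → GrowthCond C₀ τ μ →
      IsDegElliptic τ Λ μ A →
      (∀ y i, A y (Sum.inl i) (Sum.inr ()) = 0 ∧ A y (Sum.inr ()) (Sum.inl i) = 0) →
      LocalSol x₀ (ρ * τ) τ μ A v G →
      ∫ X in Metric.ball x₀ (ρ * τ) ×ˢ Ioo 0 τ, ‖G X‖ ^ 2 * μ X.2 ≤ E →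
      ∀ᵐ X ∂(volume.restrict (Metric.ball x₀ (c * τ) ×ˢ Ioo 0 (θ * τ))),
        ‖G X‖ ≤ C * Real.sqrt (1 / muHat μ (cyl (baseBall n τ) τ) * E) := by
  obtain ⟨c, hc, hcρ, C, hC, H⟩ := SliceSol.exists_gradient_bound n hρ hΛ hC₀ hθ
  have hV : 0 < volume.real (Metric.ball (0 : EuclideanSpace ℝ (Fin n)) 1) :=
    ENNReal.toReal_pos (Metric.measure_ball_pos _ _ one_pos).ne' measure_ball_lt_top.ne
  set V := volume.real (Metric.ball (0 : EuclideanSpace ℝ (Fin n)) 1)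
  -- No sign of M₀ is assumed; enlarging it to a positive number keeps the constant positive.
  set M := max M₀ 1 with hM
  have hMpos : 0 < M := lt_max_of_lt_right one_pos
  refine ⟨c, hc, hcρ, (n + 1) * (C * Real.sqrt (M * V)), by positivity, ?_⟩
  intro x₀ τ μ A v G E hτ hμ hA2 hgr hA hblock hsol hE
  have hA2' : a2Const μ ≤ ENNReal.ofReal M := hA2.trans (ENNReal.ofReal_le_ofReal (le_max_left _ _))
  obtain ⟨hμ', hmass⟩ := hμ.rescale hA2' hτ
  have hsol' := hsol.rescale hτ
  obtain ⟨v', g', G', hs, hge, hGe, hG0⟩ := hsol'.exists_sliceSol hΛ hμ' (hA.rescale hτ)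
    fun y i => hblock (τ * y) i
  set J := ∫ y in Ioo 0 τ, μ y
  have hJ : 0 < J := hμ.integral_pos hτ
  have hmh : muHat μ (cyl (baseBall n τ) τ) = V * (τ ^ n * J) := muHat_cyl n μ hτ
  have hE0 : 0 ≤ E := le_trans (integral_nonneg fun X => mul_nonneg (sq_nonneg _) (hμ.nonneg _)) hE
  -- At unit height the energy is at most τ^(-n-1) E and the mass of the inverse weight is at most M
  -- / (τ⁻¹ J), so their product is at most M E / (τⁿ J) = K². As V τⁿ J is the weighted measure of
  -- the full cylinder, K is the root of the average times √(M V).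
  set K := Real.sqrt (M * V) * Real.sqrt (1 / muHat μ (cyl (baseBall n τ) τ) * E) with hK
  have hK2 : K ^ 2 = M * (E / (τ ^ n * J)) := by
    rw [hK, mul_pow, Real.sq_sqrt (by positivity), Real.sq_sqrt (by rw [hmh]; positivity), hmh]
    field_simp
  have hUm : MeasurableSet (Metric.ball (0 : EuclideanSpace ℝ (Fin n)) ρ ×ˢ Ioo (0 : ℝ) 1) :=
    Metric.isOpen_ball.measurableSet.prod measurableSet_Ioo
  have hen : ∀ i, ∫⁻ X in univ ×ˢ Ioo (0 : ℝ) 1, ENNReal.ofReal (μ (τ * X.2) * G' i X ^ 2) ≤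
      ENNReal.ofReal ((τ ^ (n + 1))⁻¹ * E) := by
    intro i
    have e0 := setIntegral_comp_homothety volume ((x₀, 0) : Pt n) hτ
      (Metric.isOpen_ball.measurableSet.prod measurableSet_Ioo :
        MeasurableSet (Metric.ball x₀ (ρ * τ) ×ˢ Ioo (0 : ℝ) τ)) fun X => ‖G X‖ ^ 2 * μ X.2
    have hpre := preimage_homothety_cyl x₀ (r := ρ) (s := 0) (τ := 1) hτ
    rw [zero_mul, one_mul] at hpre
    rw [hpre] at e0
    have hfr : Module.finrank ℝ (Pt n) = n + 1 := by
      rw [Module.finrank_prod, finrank_euclideanSpace_fin, Module.finrank_self]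
    rw [hfr] at e0
    calc _ = ∫⁻ X in Metric.ball (0 : EuclideanSpace ℝ (Fin n)) ρ ×ˢ Ioo (0 : ℝ) 1,
            ENNReal.ofReal (μ (τ * X.2) * G' i X ^ 2) := by
          rw [← lintegral_indicator (MeasurableSet.univ.prod measurableSet_Ioo),
            ← lintegral_indicator hUm]
          refine lintegral_congr fun X => ?_
          by_cases hX : X ∈ Metric.ball (0 : EuclideanSpace ℝ (Fin n)) ρ ×ˢ Ioo (0 : ℝ) 1
          · rw [indicator_of_mem hX, indicator_of_mem
              (show X ∈ univ ×ˢ Ioo (0 : ℝ) 1 from ⟨mem_univ _, hX.2⟩)]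
          · rw [indicator_of_notMem hX]
            simp [indicator, hG0 i X hX]
      _ ≤ ∫⁻ X in Metric.ball (0 : EuclideanSpace ℝ (Fin n)) ρ ×ˢ Ioo (0 : ℝ) 1,
            ENNReal.ofReal (‖G (τ • X + (x₀, 0))‖ ^ 2 * μ (τ * X.2)) := by
          refine lintegral_mono_ae ?_
          filter_upwards [hGe i] with X hX
          refine ENNReal.ofReal_le_ofReal ?_
          rw [hX, mul_comm]
          refine mul_le_mul_of_nonneg_right ?_ (hμ.nonneg _)
          rw [EuclideanSpace.norm_sq_eq, ← sq_abs, ← Real.norm_eq_abs]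
          exact Finset.single_le_sum (f := fun k => ‖G (τ • X + (x₀, 0)) k‖ ^ 2)
            (fun _ _ => by positivity) (Finset.mem_univ _)
      _ = ENNReal.ofReal (∫ X in Metric.ball (0 : EuclideanSpace ℝ (Fin n)) ρ ×ˢ Ioo (0 : ℝ) 1,
            ‖G (τ • X + (x₀, 0))‖ ^ 2 * μ (τ * X.2)) :=
          (ofReal_integral_eq_lintegral_ofReal hsol'.grad_sq_integrable
            (Eventually.of_forall fun X => mul_nonneg (sq_nonneg _) (hμ.nonneg _))).symm
      _ ≤ _ := by
          refine ENNReal.ofReal_le_ofReal ?_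
          simp only [Prod.snd_add, Prod.smul_snd, smul_eq_mul, add_zero] at e0
          rw [e0]
          gcongr
  have hfin := H hs (hgr.rescale hτ) K (by positivity) fun i => by
    calc _ ≤ invMass (fun y => μ (τ * y)) * ENNReal.ofReal ((τ ^ (n + 1))⁻¹ * E) :=
          mul_le_mul_right (hen i) _
      _ = (invMass (fun y => μ (τ * y)) * ENNReal.ofReal (τ⁻¹ * J)) *
            ENNReal.ofReal (E / (τ ^ n * J)) := by
          rw [mul_assoc, ← ENNReal.ofReal_mul (by positivity)]
          congr 2
          field_simp
          ring
      _ ≤ ENNReal.ofReal M * ENNReal.ofReal (E / (τ ^ n * J)) := mul_le_mul_left hmass _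
      _ = _ := by rw [← ENNReal.ofReal_mul (by positivity), hK2]
  have hsub : Metric.ball (0 : EuclideanSpace ℝ (Fin n)) c ×ˢ Ioo 0 θ ⊆
      Metric.ball (0 : EuclideanSpace ℝ (Fin n)) ρ ×ˢ Ioo (0 : ℝ) 1 :=
    prod_mono (Metric.ball_subset_ball hcρ) (Ioo_subset_Ioo le_rfl hθ.le)
  have hfin2 : ∀ᵐ X ∂(volume.restrict (Metric.ball (0 : EuclideanSpace ℝ (Fin n)) c ×ˢ Ioo 0 θ)),
      ‖G (τ • X + (x₀, 0))‖ ≤ (n + 1) * (C * K) := by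
    filter_upwards [hfin, ae_mono (Measure.restrict_mono hsub le_rfl) hge,
      ae_all_iff.2 fun i => ae_mono (Measure.restrict_mono hsub le_rfl) (hGe i)] with X h1 h2 h3
    refine norm_vec_le _ (by positivity) ?_
    rintro (i | i)
    · rw [← h3 i]; exact h1.1 i
    · rw [← h2]; exact h1.2
  have hmaps : MapsTo (fun X : Pt n => τ⁻¹ • X + -(τ⁻¹ • ((x₀, 0) : Pt n)))
      (Metric.ball x₀ (c * τ) ×ˢ Ioo 0 (θ * τ)) (Metric.ball 0 c ×ˢ Ioo 0 θ) := by
    intro X hX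
    have hpre := preimage_homothety_cyl x₀ (r := c) (s := 0) (τ := θ) hτ
    rw [zero_mul] at hpre
    rw [← hpre, mem_preimage]
    convert hX using 1
    rw [smul_add, smul_smul, mul_inv_cancel₀ hτ.ne', one_smul, smul_neg, smul_smul,
      mul_inv_cancel₀ hτ.ne', one_smul]
    abel
  have hq := (quasiMeasurePreserving_homothety volume (-(τ⁻¹ • ((x₀, 0) : Pt n)))
    (inv_ne_zero hτ.ne')).restrict hmaps
  filter_upwards [hq.ae hfin2] with X hX
  have e : τ • (τ⁻¹ • X + -(τ⁻¹ • ((x₀, 0) : Pt n))) + (x₀, 0) = X := by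
    rw [smul_add, smul_smul, mul_inv_cancel₀ hτ.ne', one_smul, smul_neg, smul_smul,
      mul_inv_cancel₀ hτ.ne', one_smul]
    abel
  rw [e] at hX
  refine hX.trans (le_of_eq ?_)
  rw [hK]; ring

/-! ### Sobolev spaces on bounded domains -/

theorem IsA2Weight.aemeasurable_snd {n : ℕ} {μ : ℝ → ℝ} (hμ : IsA2Weight μ) (U : Set (Pt n)) :
    AEMeasurable (fun X : Pt n => μ X.2) (volume.restrict U) := by
  have := hμ.locallyIntegrable.aestronglyMeasurable.aemeasurable
  exact (AEMeasurable.comp_snd (μ := (volume : Measure (EuclideanSpace ℝ (Fin n)))) this).mono_measure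
    Measure.restrict_le_self

theorem MeasureTheory.MemLp.integrableOn_sq_mul_weight {n : ℕ} {μ : ℝ → ℝ} (hμ : IsA2Weight μ)
    {U : Set (Pt n)} {F : Type*} [NormedAddCommGroup F] {f : Pt n → F}
    (hf : MemLp f 2 (weightedMeasure μ U)) : IntegrableOn (fun X => ‖f X‖ ^ 2 * μ X.2) U := by
  have h1 := hf.integrable_norm_pow (by norm_num)
  rw [weightedMeasure, integrable_withDensity_iff_integrable_smul₀'
    (hμ.aemeasurable_snd U).ennreal_ofReal (Eventually.of_forall fun _ => ENNReal.ofReal_lt_top)] at h1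
  refine h1.congr (Eventually.of_forall fun X => ?_)
  simp only [ENNReal.toReal_ofReal (hμ.nonneg _), smul_eq_mul]
  rw [mul_comm]

theorem IsA2Weight.integrableOn_cyl {n : ℕ} {μ : ℝ → ℝ} (hμ : IsA2Weight μ)
    {Ω : Set (EuclideanSpace ℝ (Fin n))} (hΩ : Bornology.IsBounded Ω) (τ : ℝ) :
    IntegrableOn (fun X : Pt n => μ X.2) (cyl Ω τ) := by
  rw [IntegrableOn, cyl, volume_restrict_prod]
  have : IsFiniteMeasure (volume.restrict Ω) := ⟨by
    rw [Measure.restrict_apply_univ]; exact hΩ.measure_lt_top⟩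
  exact (hμ.integrableOn τ).comp_snd _

theorem classicalGrad_apply {n : ℕ} (φ : Pt n → ℝ) (X : Pt n) (i : Fin n ⊕ Unit) :
    classicalGrad φ X i = fderiv ℝ φ X (Sum.elim
      (fun i => (EuclideanSpace.single i (1 : ℝ), (0 : ℝ))) (fun _ => (0, 1)) i) := by
  rcases i with i | i <;> rfl

theorem continuous_classicalGrad {n : ℕ} {φ : Pt n → ℝ} (hφ : ContDiff ℝ ∞ φ) :
    Continuous (classicalGrad φ) := by
  refine (PiLp.continuous_toLp 2 _).comp (continuous_pi fun i => ?_)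
  rcases i with i | i
  · exact (hφ.continuous_fderiv (by simp)).clm_apply continuous_const
  · exact (hφ.continuous_fderiv (by simp)).clm_apply continuous_const

theorem classicalGrad_eq_zero {n : ℕ} {φ : Pt n → ℝ} {X : Pt n} (hX : X ∉ tsupport φ) :
    classicalGrad φ X = 0 := by
  have : fderiv ℝ φ X = 0 := image_eq_zero_of_notMem_tsupport fun h => hX (tsupport_fderiv_subset ℝ h)
  ext i
  rw [classicalGrad_apply, this]
  simp

theorem integral_mul_classicalGrad {n : ℕ} {ψ φ : Pt n → ℝ} (hψ : ContDiff ℝ ∞ ψ)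
    (hφ : ContDiff ℝ ∞ φ) (hφc : HasCompactSupport φ) (i : Fin n ⊕ Unit) :
    ∫ X, ψ X * classicalGrad φ X i = -∫ X, classicalGrad ψ X i * φ X := by
  simp only [classicalGrad_apply]
  have hφ' := hφ.continuous_fderiv (by simp)
  have hψ' := hψ.continuous_fderiv (by simp)
  set w : Pt n := Sum.elim
      (fun i => (EuclideanSpace.single i (1 : ℝ), (0 : ℝ))) (fun _ => (0, 1)) i
  have hc : HasCompactSupport fun X => fderiv ℝ φ X w := hφc.fderiv_apply ℝ w
  exact integral_mul_fderiv_eq_neg_fderiv_mul_of_integrable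
    (((hψ'.clm_apply continuous_const).mul hφ.continuous).integrable_of_hasCompactSupport
      hφc.mul_left)
    ((hψ.continuous.mul (hφ'.clm_apply continuous_const)).integrable_of_hasCompactSupport hc.mul_left)
    ((hψ.continuous.mul hφ.continuous).integrable_of_hasCompactSupport hφc.mul_left)
    (fun x _ => hψ.differentiable (by simp) x) (fun x _ => hφ.differentiable (by simp) x)

theorem memLp_weightedMeasure_of_continuous {n : ℕ} {μ : ℝ → ℝ} (hμ : IsA2Weight μ)
    {Ω : Set (EuclideanSpace ℝ (Fin n))} (hΩ : Bornology.IsBounded Ω) (hΩm : MeasurableSet Ω) (τ : ℝ)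
    {F : Type*} [NormedAddCommGroup F] [SecondCountableTopology F] {f : Pt n → F}
    (hf : Continuous f) : MemLp f 2 (weightedMeasure μ (cyl Ω τ)) := by
  have hb : Bornology.IsBounded (cyl Ω τ) := hΩ.prod (Metric.isBounded_Ioo 0 τ)
  obtain ⟨K, hK⟩ := hb.isCompact_closure.exists_bound_of_continuousOn hf.continuousOn
  have hfin : IsFiniteMeasure (weightedMeasure μ (cyl Ω τ)) := ⟨by
    rw [weightedMeasure, withDensity_apply _ MeasurableSet.univ, Measure.restrict_univ]
    have := (hμ.integrableOn_cyl hΩ τ).hasFiniteIntegral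
    rwa [hasFiniteIntegral_iff_ofReal (Eventually.of_forall fun X => hμ.nonneg _)] at this⟩
  refine MemLp.of_bound hf.aestronglyMeasurable K ?_
  refine (withDensity_absolutelyContinuous _ _).ae_le ?_
  filter_upwards [ae_restrict_mem (hΩm.prod measurableSet_Ioo)] with X hX
  exact hK X (subset_closure hX)

/-- A smooth function is bounded with its gradient on the bounded cylinder, where μ has finite mass.
This admits smooth functions themselves as tests in `WeakEq`. -/
theorem memW12_classicalGrad {n : ℕ} {μ : ℝ → ℝ} (hμ : IsA2Weight μ)
    {Ω : Set (EuclideanSpace ℝ (Fin n))} (hΩ : Bornology.IsBounded Ω) (hΩm : MeasurableSet Ω) (τ : ℝ)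
    {ψ : Pt n → ℝ} (hψ : ContDiff ℝ ∞ ψ) : MemW12 (cyl Ω τ) μ ψ (classicalGrad ψ) := by
  refine ⟨⟨hψ.continuous.locallyIntegrable.locallyIntegrableOn _,
    (continuous_classicalGrad hψ).locallyIntegrable.locallyIntegrableOn _, ?_⟩,
    memLp_weightedMeasure_of_continuous hμ hΩ hΩm τ hψ.continuous,
    memLp_weightedMeasure_of_continuous hμ hΩ hΩm τ (continuous_classicalGrad hψ)⟩
  intro φ hφ hφc hφs i
  rw [setIntegral_eq_integral_of_forall_compl_eq_zero,
    setIntegral_eq_integral_of_forall_compl_eq_zero, integral_mul_classicalGrad hψ hφ hφc]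
  · intro X hX
    rw [image_eq_zero_of_notMem_tsupport fun h => hX (hφs h), mul_zero]
  · intro X hX
    rw [classicalGrad_eq_zero fun h => hX (hφs h)]
    simp

theorem MemW12.closure_of_mem {n : ℕ} {U : Set (Pt n)} {μ : ℝ → ℝ} {S : Set (Pt n → ℝ)}
    {ψ : Pt n → ℝ} (h : MemW12 U μ ψ (classicalGrad ψ)) (hψ : ψ ∈ S) :
    MemW12Closure U μ S ψ (classicalGrad ψ) :=
  ⟨h, fun _ => ψ, fun _ => hψ, by simp⟩

/-- The weak formulation with smooth test functions. -/
theorem WeakEq.smooth {n : ℕ} {μ : ℝ → ℝ} (hμ : IsA2Weight μ)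
    {Ω : Set (EuclideanSpace ℝ (Fin n))} (hΩ : Bornology.IsBounded Ω) (hΩm : MeasurableSet Ω) {τ : ℝ}
    {A : ℝ → Matrix (Fin n ⊕ Unit) (Fin n ⊕ Unit) ℝ} {G : Pt n → Vec n} (h : WeakEq Ω τ μ A G)
    {ψ : Pt n → ℝ} (hψ : ψ ∈ starTest Ω τ) :
    ∫ X in cyl Ω τ, (A X.2 *ᵥ (G X).ofLp) ⬝ᵥ (classicalGrad ψ X).ofLp = 0 :=
  h ψ _ ((memW12_classicalGrad hμ hΩ hΩm τ hψ.1).closure_of_mem hψ)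

theorem MemW12.localSol {n : ℕ} {μ : ℝ → ℝ} (hμ : IsA2Weight μ)
    {Ω : Set (EuclideanSpace ℝ (Fin n))} (hΩ : Bornology.IsBounded Ω) (hΩo : IsOpen Ω) {τ : ℝ}
    {A : ℝ → Matrix (Fin n ⊕ Unit) (Fin n ⊕ Unit) ℝ} {v : Pt n → ℝ} {G : Pt n → Vec n}
    (hv : MemW12 (cyl Ω τ) μ v G) (h : WeakEq Ω τ μ A G) {x₀ : EuclideanSpace ℝ (Fin n)} {r : ℝ}
    (hsub : Metric.ball x₀ r ⊆ Ω) : LocalSol x₀ r τ μ A v G := by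
  have hsub' : Metric.ball x₀ r ×ˢ Ioo 0 τ ⊆ cyl Ω τ := prod_mono hsub le_rfl
  have hcm : MeasurableSet (cyl Ω τ) := hΩo.measurableSet.prod measurableSet_Ioo
  constructor
  · exact hv.hasWeakGrad.locallyIntegrableOn.aestronglyMeasurable.mono_set hsub'
  · exact hv.hasWeakGrad.grad_locallyIntegrableOn.aestronglyMeasurable.mono_set hsub'
  · have := (hv.memLp.integrableOn_sq_mul_weight hμ).mono_set hsub'
    simpa only [Real.norm_eq_abs, sq_abs] using this
  · exact (hv.grad_memLp.integrableOn_sq_mul_weight hμ).mono_set hsub'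
  · intro φ hφ hφc hφs i
    have h1 := hv.hasWeakGrad.integral_eq φ hφ hφc (hφs.trans hsub') i
    rwa [setIntegral_eq_of_subset_of_forall_sdiff_eq_zero hcm hsub',
      setIntegral_eq_of_subset_of_forall_sdiff_eq_zero hcm hsub'] at h1
    · intro X hX
      rw [image_eq_zero_of_notMem_tsupport fun h => hX.2 (hφs h), mul_zero]
    · intro X hX
      rw [classicalGrad_eq_zero fun h => hX.2 (hφs h)]
      simp
  · intro ψ hψ hψs
    -- A smooth function supported in the ball times (-∞, τ) vanishes on the lateral boundary,
    -- because Ω is open and contains the ball, and at the top. Nothing is required at the bottom.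
    have hst : ψ ∈ starTest Ω τ := by
      refine ⟨hψ, ?_⟩
      rintro X (hX | hX)
      · refine image_eq_zero_of_notMem_tsupport fun h => ?_
        have := hX.1
        rw [hΩo.frontier_eq] at this
        exact this.2 (hsub (hψs h).1)
      · refine image_eq_zero_of_notMem_tsupport fun h => ?_
        have h2 := (hψs h).2
        have h3 : X.2 = τ := hX.2
        rw [h3] at h2
        exact lt_irrefl _ (mem_Iio.1 h2)
    have h1 := h.smooth hμ hΩ hΩo.measurableSet hst
    rwa [setIntegral_eq_of_subset_of_forall_sdiff_eq_zero hcm hsub'] at h1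
    intro X hX
    rw [classicalGrad_eq_zero fun h => hX.2 ⟨(hψs h).1, hX.1.2⟩]
    simp

/-- By second countability, countably many neighbourhoods suffice. This replaces an explicit
covering: the local bounds all have the same constant, so their number does not matter. -/
theorem ae_restrict_of_locally {α : Type*} [TopologicalSpace α] [SecondCountableTopology α]
    [MeasurableSpace α] [OpensMeasurableSpace α] {m : Measure α} {U : Set α} (hU : MeasurableSet U)
    {P : α → Prop}
    (h : ∀ x ∈ U, ∃ W, IsOpen W ∧ x ∈ W ∧ ∀ᵐ z ∂(m.restrict (W ∩ U)), P z) :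
    ∀ᵐ z ∂(m.restrict U), P z := by
  rw [ae_restrict_iff' hU, ae_iff]
  refine measure_null_of_locally_null _ fun x hx => ?_
  have hx' : x ∈ U := by
    by_contra hc
    exact hx fun h => absurd h hc
  obtain ⟨W, hWo, hxW, hW⟩ := h x hx'
  rw [ae_restrict_iff' (hWo.measurableSet.inter hU), ae_iff] at hW
  refine ⟨_, inter_mem_nhdsWithin _ (hWo.mem_nhds hxW), measure_mono_null ?_ hW⟩
  rintro z ⟨hz, hzW⟩ hc
  exact hz fun hzU => hc ⟨hzW, hzU⟩

/-! ### The estimate in the full cylinder -/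

theorem blockCoeff_off_diag {n : ℕ} (μ : ℝ → ℝ) (B : ℝ → Matrix (Fin n) (Fin n) ℝ) (b : ℝ → ℝ)
    (y : ℝ) (i : Fin n) :
    blockCoeff μ B b y (Sum.inl i) (Sum.inr ()) = 0 ∧
      blockCoeff μ B b y (Sum.inr ()) (Sum.inl i) = 0 := by
  simp [blockCoeff]

/-- The gradient estimate up to the bottom, away from the lateral boundary. -/
theorem exists_gradient_bound_Q (n : ℕ) {Λ C₀ θ : ℝ} (M₀ : ℝ) (hΛ : 0 < Λ) (hC₀ : 0 < C₀)
    (hθ : θ ∈ Ioo (0 : ℝ) 1) :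
    ∃ C : ℝ, 0 < C ∧
      ∀ (τ : ℝ) (μ : ℝ → ℝ) (B : ℝ → Matrix (Fin n) (Fin n) ℝ) (b : ℝ → ℝ),
        τ ∈ Ioo (0 : ℝ) 1 → IsA2Weight μ → a2Const μ ≤ ENNReal.ofReal M₀ → GrowthCond C₀ τ μ →
        IsDegElliptic τ Λ μ (blockCoeff μ B b) →
        ∀ (v : Pt n → ℝ) (G : Pt n → Vec n),
          IsWeakSolutionQ τ μ (blockCoeff μ B b) v G →
          eLpNorm G ⊤ (volume.restrict (cyl (baseBall n (θ * τ)) (θ * τ))) ≤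
            ENNReal.ofReal (C * Real.sqrt ((1 / muHat μ (cyl (baseBall n τ) τ)) *
              ∫ X in cyl (baseBall n τ) τ, ‖G X‖ ^ 2 * μ X.2)) := by
  -- The radius ratio is ρ = 1 - θ: a ball of radius (1 - θ) τ about a point of the ball of radius θ
  -- τ stays in the ball of radius τ.
  obtain ⟨c, hc, -, C, hC, H⟩ := LocalSol.exists_gradient_bound n M₀
    (sub_pos.2 hθ.2) hΛ hC₀ hθ.2
  refine ⟨C, hC, ?_⟩
  intro τ μ B b hτ hμ hA2 hgr hA v G hsol
  rw [eLpNorm_exponent_top]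
  refine eLpNormEssSup_le_of_ae_bound ?_
  refine ae_restrict_of_locally (Metric.isOpen_ball.measurableSet.prod measurableSet_Ioo)
    fun X hX => ⟨Metric.ball X.1 (c * τ) ×ˢ univ, Metric.isOpen_ball.prod isOpen_univ,
      ⟨Metric.mem_ball_self (mul_pos hc hτ.1), mem_univ _⟩, ?_⟩
  have hsub : Metric.ball X.1 ((1 - θ) * τ) ⊆ baseBall n τ := by
    refine Metric.ball_subset_ball' ?_
    have h1 : dist X.1 0 < θ * τ := hX.1
    linarith
  have hloc := hsol.1.localSol hμ Metric.isBounded_ball Metric.isOpen_ball hsol.2 hsub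
  refine ae_mono (Measure.restrict_mono ?_ le_rfl) (H hτ.1 hμ hA2 hgr hA
    (blockCoeff_off_diag μ B b) hloc (setIntegral_mono_set
      (hsol.1.grad_memLp.integrableOn_sq_mul_weight hμ)
      (Eventually.of_forall fun X => mul_nonneg (sq_nonneg _) (hμ.nonneg _))
      (prod_mono hsub le_rfl).eventuallyLE))
  exact fun Z hZ => ⟨hZ.1.1, hZ.2.2⟩

/-! ### Functions vanishing on the flat boundary -/

/-- The direction in `ℝⁿ × ℝ` with coordinates `κ`. -/
def dirPt {n : ℕ} (κ : Vec n) : Pt n := (WithLp.toLp 2 fun i => κ (Sum.inl i), κ (Sum.inr ()))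

theorem inner_classicalGrad {n : ℕ} (κ : Vec n) (ψ : Pt n → ℝ) (X : Pt n) :
    inner ℝ κ (classicalGrad ψ X) = fderiv ℝ ψ X (dirPt κ) := by
  have h : dirPt κ = ∑ i, κ (Sum.inl i) • ((EuclideanSpace.single i (1 : ℝ), (0 : ℝ)) : Pt n) +
      κ (Sum.inr ()) • ((0, 1) : Pt n) := by
    refine Prod.ext ?_ ?_
    · ext j
      simp [dirPt, Prod.fst_sum, Finset.sum_apply, Pi.single_apply]
    · simp [dirPt, Prod.snd_sum]
  rw [h, map_add, map_sum, map_smul, PiLp.inner_apply, Fintype.sum_sum_type]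
  simp only [map_smul]
  simp [classicalGrad, mul_comm, -Prod.smul_mk]

theorem volume_flat_eq_zero (n : ℕ) [NeZero n] :
    volume {X : Pt n | X.1 (lastIdx n) = 0} = 0 := by
  set ℓ : Pt n →L[ℝ] ℝ := (EuclideanSpace.proj (lastIdx n)).comp (ContinuousLinearMap.fst ℝ _ _)
  have h := Measure.addHaar_submodule (volume : Measure (Pt n)) (LinearMap.ker ℓ.toLinearMap) (by
    intro hc
    have : ((EuclideanSpace.single (lastIdx n) (1 : ℝ), (0 : ℝ)) : Pt n) ∈ LinearMap.ker ℓ.toLinearMap := by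
      rw [hc]; trivial
    simp [ℓ] at this)
  convert h using 2
  ext X
  simp [ℓ]

/-- The integral over the half space of a derivative of a function vanishing on the boundary. -/
theorem integral_half_fderiv_eq_zero {n : ℕ} [NeZero n] {f : Pt n → ℝ} (hf : ContDiff ℝ 1 f)
    (hfc : HasCompactSupport f) (h0 : ∀ X : Pt n, X.1 (lastIdx n) = 0 → f X = 0) (w : Pt n) :
    ∫ X in {X : Pt n | 0 < X.1 (lastIdx n)}, fderiv ℝ f X w = 0 := by
  set H : Set (Pt n) := {X : Pt n | 0 < X.1 (lastIdx n)} with hH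
  have hcoord : Continuous fun X : Pt n => X.1 (lastIdx n) := by fun_prop
  have hHo : IsOpen H := isOpen_lt continuous_const hcoord
  set e : Pt n := (EuclideanSpace.single (lastIdx n) 1, 0) with he
  set g : Pt n → ℝ := H.indicator f with hg
  have hℓ : LipschitzWith 1 fun X : Pt n => X.1 (lastIdx n) := by
    refine LipschitzWith.of_dist_le_mul fun X Y => ?_
    rw [NNReal.coe_one, one_mul, dist_eq_norm, dist_eq_norm]
    calc _ = ‖(X.1 - Y.1) (lastIdx n)‖ := by simp
      _ ≤ ‖X.1 - Y.1‖ := PiLp.norm_apply_le _ _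
      _ ≤ _ := norm_fst_le (X - Y)
  obtain ⟨K, hK⟩ := hf.lipschitzWith_of_hasCompactSupport hfc one_ne_zero
  -- This map projects onto the closed half space along e_n. Since f vanishes on the hyperplane, the
  -- extension of f by zero is f composed with the projection, hence Lipschitz.
  have hP : LipschitzWith (1 + (1 * 1 + 1) * ‖e‖₊)
      fun X : Pt n => X + (max (X.1 (lastIdx n)) 0 - X.1 (lastIdx n)) • e := by
    refine LipschitzWith.id.add ?_
    refine LipschitzWith.of_dist_le_mul fun X Y => ?_
    rw [dist_eq_norm, ← sub_smul, norm_smul]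
    push_cast
    rw [mul_right_comm]
    gcongr
    rw [← dist_eq_norm]
    have := ((hℓ.max_const 0).sub hℓ).dist_le_mul X Y
    push_cast at this
    linarith
  have hgP : g = fun X => f (X + (max (X.1 (lastIdx n)) 0 - X.1 (lastIdx n)) • e) := by
    ext X
    by_cases hX : X ∈ H
    · rw [hg, indicator_of_mem hX, max_eq_left (le_of_lt hX)]
      simp
    · rw [hg, indicator_of_notMem hX, max_eq_right (not_lt.1 hX), h0]
      simp [he]
  have hgL : LipschitzWith (K * (1 + (1 * 1 + 1) * ‖e‖₊)) g := by
    rw [hgP]; exact hK.comp hP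
  have hgc : HasCompactSupport g :=
    hfc.mono (by rw [hg, support_indicator]; exact inter_subset_right)
  -- Integration by parts for Lipschitz functions against the constant 1: the integral of any
  -- directional derivative of the extension is zero. Off the null hyperplane this derivative is
  -- that of f on one side and 0 on the other.
  have h1 := LipschitzWith.integral_lineDeriv_mul_eq (μ := (volume : Measure (Pt n)))
    (LipschitzWith.const (1 : ℝ)) hgL hgc (-w)
  have h2 : ∀ X : Pt n, lineDeriv ℝ (fun _ : Pt n => (1 : ℝ)) X (-w) = 0 := fun X => by
    simp [lineDeriv]
  simp only [h2, zero_mul, integral_zero, neg_neg, mul_one] at h1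
  rw [← integral_indicator hHo.measurableSet, h1]
  refine integral_congr_ae ?_
  have hnull : ∀ᵐ X : Pt n, X.1 (lastIdx n) ≠ 0 := by
    rw [ae_iff]; simpa using volume_flat_eq_zero n
  filter_upwards [hnull] with X hX
  by_cases hXH : X ∈ H
  · rw [indicator_of_mem hXH]
    have : g =ᶠ[𝓝 X] f := by
      filter_upwards [hHo.mem_nhds hXH] with Y hY
      rw [hg, indicator_of_mem hY]
    rw [this.lineDeriv_eq, (hf.differentiable one_ne_zero X).lineDeriv_eq_fderiv]
  · rw [indicator_of_notMem hXH]
    have hlt : X.1 (lastIdx n) < 0 := lt_of_le_of_ne (not_lt.1 hXH) hX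
    have : g =ᶠ[𝓝 X] fun _ => 0 := by
      filter_upwards [(isOpen_lt hcoord continuous_const).mem_nhds hlt] with Y hY
      rw [hg, indicator_of_notMem (show Y ∉ H from fun hY' => lt_asymm hY' hY)]
    rw [this.lineDeriv_eq]
    simp [lineDeriv]

/-- Cauchy–Schwarz with the factors μ^(1/2) and μ^(-1/2). It makes convergence in the weighted space
imply convergence in unweighted L¹ on bounded cylinders, where μ⁻¹ has finite mass. -/
theorem lintegral_enorm_le_eLpNorm_mul {n : ℕ} {μ : ℝ → ℝ} (hμ : IsA2Weight μ) {U : Set (Pt n)}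
    {F : Type*} [NormedAddCommGroup F] {f : Pt n → F}
    (hf : AEStronglyMeasurable f (volume.restrict U)) :
    ∫⁻ X in U, ‖f X‖ₑ ≤ eLpNorm f 2 (weightedMeasure μ U) *
      (∫⁻ X in U, (ENNReal.ofReal (μ X.2))⁻¹) ^ (1 / 2 : ℝ) := by
  have hm := (hμ.aemeasurable_snd U).ennreal_ofReal
  have hpos : ∀ᵐ X : Pt n ∂(volume.restrict U), 0 < μ X.2 :=
    ae_restrict_of_ae (Measure.quasiMeasurePreserving_snd.ae hμ.pos_ae)
  have h := ENNReal.lintegral_mul_le_Lp_mul_Lq (volume.restrict U) Real.HolderConjugate.two_two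
    (f := fun X => ‖f X‖ₑ * ENNReal.ofReal (μ X.2) ^ (1 / 2 : ℝ))
    (g := fun X => (ENNReal.ofReal (μ X.2))⁻¹ ^ (1 / 2 : ℝ))
    (hf.enorm.mul (hm.pow_const _)) (hm.inv.pow_const _)
  have e1 : ∫⁻ X in U, ‖f X‖ₑ = ∫⁻ X in U, ((fun X : Pt n => ‖f X‖ₑ * ENNReal.ofReal (μ X.2) ^ (1 / 2 : ℝ)) *
      fun X : Pt n => (ENNReal.ofReal (μ X.2))⁻¹ ^ (1 / 2 : ℝ)) X := by
    refine lintegral_congr_ae ?_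
    filter_upwards [hpos] with X hX
    simp only [Pi.mul_apply]
    rw [mul_assoc, ← ENNReal.mul_rpow_of_nonneg _ _ (by norm_num : (0 : ℝ) ≤ 1 / 2),
      ENNReal.mul_inv_cancel (by simpa using hX) ENNReal.ofReal_ne_top, ENNReal.one_rpow, mul_one]
  rw [e1]
  refine h.trans (le_of_eq ?_)
  have hsq : ∀ a : ℝ≥0∞, (a ^ (1 / 2 : ℝ)) ^ (2 : ℝ) = a := fun a => by
    rw [← ENNReal.rpow_mul]; norm_num
  congr 1
  · rw [eLpNorm_eq_lintegral_rpow_enorm_toReal (by norm_num) (by norm_num), ENNReal.toReal_ofNat,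
      weightedMeasure, lintegral_withDensity_eq_lintegral_mul₀ hm (hf.enorm.pow_const _)]
    congr 1
    refine lintegral_congr fun X => ?_
    rw [ENNReal.mul_rpow_of_nonneg _ _ (by norm_num), hsq, mul_comm]
    rfl
  · congr 1
    exact lintegral_congr fun X => hsq _

theorem IsA2Weight.lintegral_inv_cyl_lt_top {n : ℕ} {μ : ℝ → ℝ} (hμ : IsA2Weight μ)
    {Ω : Set (EuclideanSpace ℝ (Fin n))} (hΩ : Bornology.IsBounded Ω) {τ : ℝ} (hτ : 0 < τ) :
    ∫⁻ X in cyl Ω τ, (ENNReal.ofReal (μ X.2))⁻¹ < ⊤ := by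
  have h1 : ∫⁻ y in Ioo 0 τ, (ENNReal.ofReal (μ y))⁻¹ < ⊤ := by
    have hmul := IsA2Weight.lintegral_mul_le (M₀ := (a2Const μ).toReal)
      (ENNReal.ofReal_toReal hμ.const_lt_top.ne).ge hτ
    rw [← ofReal_integral_eq_lintegral_ofReal (hμ.integrableOn τ)
      (Eventually.of_forall hμ.nonneg)] at hmul
    by_contra hc
    rw [not_lt, top_le_iff] at hc
    rw [hc, ENNReal.mul_top (by simpa using hμ.integral_pos hτ)] at hmul
    exact ENNReal.ofReal_ne_top (top_le_iff.1 hmul)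
  rw [cyl, volume_restrict_prod]
  have h2 := lintegral_prod_mul (μ := volume.restrict Ω) (ν := volume.restrict (Ioo 0 τ))
    (f := fun _ => 1) (g := fun y => (ENNReal.ofReal (μ y))⁻¹) aemeasurable_const
    (hμ.integrableOn τ).aestronglyMeasurable.aemeasurable.ennreal_ofReal.inv
  simp only [one_mul, lintegral_const, Measure.restrict_apply_univ] at h2
  rw [h2]
  exact ENNReal.mul_lt_top hΩ.measure_lt_top h1

theorem MemW12.integrableOn {n : ℕ} {μ : ℝ → ℝ} (hμ : IsA2Weight μ)
    {Ω : Set (EuclideanSpace ℝ (Fin n))} (hΩ : Bornology.IsBounded Ω) {τ : ℝ} (hτ : 0 < τ)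
    {v : Pt n → ℝ} {G : Pt n → Vec n} (h : MemW12 (cyl Ω τ) μ v G) :
    IntegrableOn v (cyl Ω τ) ∧ IntegrableOn G (cyl Ω τ) := by
  have hC : (∫⁻ X in cyl Ω τ, (ENNReal.ofReal (μ X.2))⁻¹) ^ (1 / 2 : ℝ) < ⊤ :=
    ENNReal.rpow_lt_top_of_nonneg (by norm_num) (hμ.lintegral_inv_cyl_lt_top hΩ hτ).ne
  have h1 := h.hasWeakGrad.locallyIntegrableOn.aestronglyMeasurable
  have h2 := h.hasWeakGrad.grad_locallyIntegrableOn.aestronglyMeasurable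
  exact ⟨⟨h1, (lintegral_enorm_le_eLpNorm_mul hμ h1).trans_lt
      (ENNReal.mul_lt_top h.memLp.eLpNorm_lt_top hC)⟩,
    ⟨h2, (lintegral_enorm_le_eLpNorm_mul hμ h2).trans_lt
      (ENNReal.mul_lt_top h.grad_memLp.eLpNorm_lt_top hC)⟩⟩

theorem isOpen_halfBall (n : ℕ) [NeZero n] (r : ℝ) : IsOpen (halfBall n r) :=
  Metric.isOpen_ball.inter (isOpen_lt continuous_const
    (show Continuous fun x : EuclideanSpace ℝ (Fin n) => x (lastIdx n) by fun_prop))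

theorem isBounded_halfBall (n : ℕ) [NeZero n] (r : ℝ) : Bornology.IsBounded (halfBall n r) :=
  Metric.isBounded_ball.subset fun _ hx => hx.1

/-- Integration by parts against test functions that need not vanish on the flat boundary. -/
theorem integral_mul_inner_classicalGrad_flat {n : ℕ} [NeZero n] {μ : ℝ → ℝ} (hμ : IsA2Weight μ)
    {τ : ℝ} (hτ : 0 < τ) {v : Pt n → ℝ} {G : Pt n → Vec n}
    (h : MemW12Closure (cyl (halfBall n τ) τ) μ (flatZero n τ) v G) {ψ : Pt n → ℝ}
    (hψ : ContDiff ℝ ∞ ψ) (hψc : HasCompactSupport ψ) (hψs : tsupport ψ ⊆ baseBall n τ ×ˢ Ioo 0 τ)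
    (κ : Vec n) :
    ∫ X in cyl (halfBall n τ) τ, v X * inner ℝ κ (classicalGrad ψ X) =
      -∫ X in cyl (halfBall n τ) τ, inner ℝ κ (G X) * ψ X := by
  set U := cyl (halfBall n τ) τ with hU
  have hUm : MeasurableSet U := (isOpen_halfBall n τ).measurableSet.prod measurableSet_Ioo
  obtain ⟨hW, φ, hφ, hlim⟩ := h
  obtain ⟨hvi, hGi⟩ := hW.integrableOn hμ (isBounded_halfBall n τ) hτ
  obtain ⟨K₁, hK₁⟩ := hψc.exists_bound_of_continuous hψ.continuous
  have hψ'c : Continuous fun X => inner ℝ κ (classicalGrad ψ X) :=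
    continuous_const.inner (continuous_classicalGrad hψ)
  have hψ's : HasCompactSupport fun X => inner ℝ κ (classicalGrad ψ X) := by
    simp only [inner_classicalGrad]
    exact hψc.fderiv_apply ℝ _
  obtain ⟨K₂, hK₂⟩ := hψ's.exists_bound_of_continuous hψ'c
  have hK₁0 : 0 ≤ K₁ := (norm_nonneg _).trans (hK₁ 0)
  have hK₂0 : 0 ≤ K₂ := (norm_nonneg _).trans (hK₂ 0)
  have i1 : ∀ {f : Pt n → ℝ}, IntegrableOn f U →
      IntegrableOn (fun X => f X * inner ℝ κ (classicalGrad ψ X)) U := fun hf =>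
    hf.mul_bdd (c := K₂) hψ'c.aestronglyMeasurable (Eventually.of_forall hK₂)
  have i2 : ∀ {F : Pt n → Vec n}, IntegrableOn F U →
      IntegrableOn (fun X => inner ℝ κ (F X) * ψ X) U := fun hF =>
    (hF.const_inner κ).mul_bdd (c := K₁) hψ.continuous.aestronglyMeasurable
      (Eventually.of_forall hK₁)
  set C := (∫⁻ X in U, (ENNReal.ofReal (μ X.2))⁻¹) ^ (1 / 2 : ℝ) with hC
  have hCtop : C ≠ ⊤ :=
    ENNReal.rpow_ne_top_of_nonneg (by norm_num)
      (hμ.lintegral_inv_cyl_lt_top (isBounded_halfBall n τ) hτ).ne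
  set I := ∫ X in U, (v X * inner ℝ κ (classicalGrad ψ X) + inner ℝ κ (G X) * ψ X) with hI
  set K := max K₂ (‖κ‖ * K₁) with hK
  -- For an approximating φ_k the integrand is the derivative of φ_k ψ along κ. This product
  -- vanishes on the whole hyperplane x_n = 0: on the flat part because φ_k does, elsewhere because
  -- ψ does.
  have hzero : ∀ k, ∫ X in U, (φ k X * inner ℝ κ (classicalGrad ψ X) +
      inner ℝ κ (classicalGrad (φ k) X) * ψ X) = 0 := by
    intro k
    have hφk := (hφ k).1
    have hd := integral_half_fderiv_eq_zero (n := n) (f := fun X => φ k X * ψ X)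
      ((hφk.mul hψ).of_le (by simp)) hψc.mul_left (fun X hX => by
        by_cases hXt : X ∈ tsupport ψ
        · rw [(hφ k).2 X ⟨⟨(hψs hXt).1, hX⟩, (hψs hXt).2⟩, zero_mul]
        · rw [image_eq_zero_of_notMem_tsupport hXt, mul_zero]) (dirPt κ)
    have hfd : ∀ X, fderiv ℝ (fun X => φ k X * ψ X) X (dirPt κ) =
        φ k X * inner ℝ κ (classicalGrad ψ X) + inner ℝ κ (classicalGrad (φ k) X) * ψ X := by
      intro X
      rw [inner_classicalGrad, inner_classicalGrad, fderiv_fun_mul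
        (hφk.differentiable (by simp) X) (hψ.differentiable (by simp) X)]
      simp; ring
    rw [← hd]
    simp only [hfd]
    refine (setIntegral_eq_of_subset_of_forall_sdiff_eq_zero
      (isOpen_lt continuous_const (by fun_prop)).measurableSet (fun X hX => hX.1.2) ?_).symm
    intro X hX
    have hXt : X ∉ tsupport ψ := fun hXt =>
      hX.2 ⟨⟨(hψs hXt).1, hX.1⟩, (hψs hXt).2⟩
    rw [image_eq_zero_of_notMem_tsupport hXt, classicalGrad_eq_zero hXt]
    simp
  -- Subtracting the vanishing integral for φ_k leaves the differences φ_k - v and ∇φ_k - G, paired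
  -- with bounded functions; their L¹ norms are controlled by the weighted norms, which tend to
  -- zero.
  have hbound : ∀ k, ‖I‖ₑ ≤ ENNReal.ofReal K * C *
      (eLpNorm (fun X => φ k X - v X) 2 (weightedMeasure μ U)
      + eLpNorm (fun X => classicalGrad (φ k) X - G X) 2 (weightedMeasure μ U)) := by
    intro k
    have hk := memW12_classicalGrad hμ (isBounded_halfBall n τ) (isOpen_halfBall n τ).measurableSet τ
      (hφ k).1
    obtain ⟨hki, hkGi⟩ := hk.integrableOn hμ (isBounded_halfBall n τ) hτ
    have e1 : I = -∫ X in U, ((φ k X - v X) * inner ℝ κ (classicalGrad ψ X) +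
        inner ℝ κ (classicalGrad (φ k) X - G X) * ψ X) := by
      rw [← integral_neg, hI, ← sub_zero (∫ X in U, _), ← hzero k,
        ← integral_sub ((i1 hvi).fun_add (i2 hGi)) ((i1 hki).fun_add (i2 hkGi))]
      refine integral_congr_ae (Eventually.of_forall fun X => ?_)
      simp only [inner_sub_right]
      ring
    rw [e1, enorm_neg]
    refine (enorm_integral_le_lintegral_enorm _).trans ?_
    calc _ ≤ ∫⁻ X in U, ENNReal.ofReal K * (‖φ k X - v X‖ₑ + ‖classicalGrad (φ k) X - G X‖ₑ) := by
          refine lintegral_mono fun X => ?_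
          simp only
          rw [← ofReal_norm, ← ofReal_norm, ← ofReal_norm, ← ENNReal.ofReal_add (norm_nonneg _)
            (norm_nonneg _), ← ENNReal.ofReal_mul (hK₂0.trans (le_max_left _ _))]
          refine ENNReal.ofReal_le_ofReal ?_
          refine (norm_add_le _ _).trans ?_
          rw [norm_mul, norm_mul, mul_add]
          refine add_le_add ?_ ?_
          · rw [mul_comm]
            exact mul_le_mul_of_nonneg_right ((hK₂ X).trans (le_max_left _ _)) (norm_nonneg _)
          · calc _ ≤ (‖κ‖ * ‖classicalGrad (φ k) X - G X‖) * K₁ :=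
                  mul_le_mul (norm_inner_le_norm _ _) (hK₁ X) (norm_nonneg _) (by positivity)
              _ = (‖κ‖ * K₁) * ‖classicalGrad (φ k) X - G X‖ := by ring
              _ ≤ _ := mul_le_mul_of_nonneg_right (le_max_right _ _) (norm_nonneg _)
      _ = ENNReal.ofReal K * ((∫⁻ X in U, ‖φ k X - v X‖ₑ) +
            ∫⁻ X in U, ‖classicalGrad (φ k) X - G X‖ₑ) := by
          have m1 : AEMeasurable (fun X => ‖φ k X - v X‖ₑ) (volume.restrict U) :=
            (hki.aestronglyMeasurable.sub hvi.aestronglyMeasurable).enorm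
          rw [lintegral_const_mul' _ _ ENNReal.ofReal_ne_top, lintegral_add_left' m1]
      _ ≤ ENNReal.ofReal K * (eLpNorm (fun X => φ k X - v X) 2 (weightedMeasure μ U) * C +
            eLpNorm (fun X => classicalGrad (φ k) X - G X) 2 (weightedMeasure μ U) * C) := by
          refine mul_le_mul_right (add_le_add ?_ ?_) _
          · exact lintegral_enorm_le_eLpNorm_mul hμ
              (hki.aestronglyMeasurable.sub hvi.aestronglyMeasurable)
          · exact lintegral_enorm_le_eLpNorm_mul hμ
              (hkGi.aestronglyMeasurable.sub hGi.aestronglyMeasurable)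
      _ = _ := by ring
  have hlim2 := ENNReal.Tendsto.const_mul (a := ENNReal.ofReal K * C) hlim
    (Or.inr (ENNReal.mul_ne_top ENNReal.ofReal_ne_top hCtop))
  rw [mul_zero] at hlim2
  have hI0 : ‖I‖ₑ ≤ 0 := ge_of_tendsto' hlim2 hbound
  have hI1 : I = 0 := by simpa using hI0
  rw [hI, integral_add (i1 hvi) (i2 hGi)] at hI1
  linarith

/-! ### Oblique reflection in the flat boundary -/

section reflection

variable {n : ℕ}

/-- The horizontal vector `(c, 0)`. -/
def liftVec (c : EuclideanSpace ℝ (Fin n)) : Vec n := WithLp.toLp 2 (Sum.elim c 0)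

theorem dirPt_liftVec (c : EuclideanSpace ℝ (Fin n)) : dirPt (liftVec c) = (c, 0) := rfl

theorem norm_liftVec (c : EuclideanSpace ℝ (Fin n)) : ‖liftVec c‖ = ‖c‖ := by
  rw [EuclideanSpace.norm_eq, EuclideanSpace.norm_eq, Fintype.sum_sum_type]
  simp [liftVec]

theorem classicalGrad_sub {φ ψ : Pt n → ℝ} (hφ : ContDiff ℝ ∞ φ) (hψ : ContDiff ℝ ∞ ψ) (X : Pt n) :
    classicalGrad (fun X => φ X - ψ X) X = classicalGrad φ X - classicalGrad ψ X := by
  ext i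
  rw [PiLp.sub_apply, classicalGrad_apply, classicalGrad_apply, classicalGrad_apply,
    fderiv_fun_sub (hφ.differentiable (by simp) X) (hψ.differentiable (by simp) X)]
  rfl

variable [NeZero n] (c : EuclideanSpace ℝ (Fin n))

/-- The reflection `x ↦ x - 2 xₙ c` in `{xₙ = 0}` along `c`. -/
noncomputable def reflPt : Pt n →L[ℝ] Pt n :=
  ContinuousLinearMap.id ℝ (Pt n) - (((2 : ℝ) • EuclideanSpace.proj (lastIdx n)).comp
    (ContinuousLinearMap.fst ℝ (EuclideanSpace ℝ (Fin n)) ℝ)).smulRight ((c, 0) : Pt n)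

/-- The transpose of `reflPt`. -/
noncomputable def reflVec (w : Vec n) : Vec n :=
  w - (2 * inner ℝ (liftVec c) w) • EuclideanSpace.single (Sum.inl (lastIdx n)) 1

theorem reflPt_apply (X : Pt n) : reflPt c X = X - (2 * X.1 (lastIdx n)) • ((c, 0) : Pt n) := by
  simp [reflPt]

theorem reflPt_fst (X : Pt n) : (reflPt c X).1 = X.1 - (2 * X.1 (lastIdx n)) • c := by
  simp [reflPt_apply]

@[simp]
theorem reflPt_snd (X : Pt n) : (reflPt c X).2 = X.2 := by
  simp [reflPt_apply]

theorem reflPt_fst_sub {x₀ : EuclideanSpace ℝ (Fin n)} (hx₀ : x₀ (lastIdx n) = 0) (X : Pt n) :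
    ‖(reflPt c X).1 - x₀‖ ≤ (1 + 2 * ‖c‖) * ‖X.1 - x₀‖ := by
  have e : (reflPt c X).1 - x₀ = (X.1 - x₀) - (2 * (X.1 - x₀) (lastIdx n)) • c := by
    rw [reflPt_fst, PiLp.sub_apply, hx₀, sub_zero]
    abel
  have h1 : ‖(X.1 - x₀) (lastIdx n)‖ ≤ ‖X.1 - x₀‖ := PiLp.norm_apply_le _ _
  rw [e]
  refine (norm_sub_le _ _).trans ?_
  rw [norm_smul, norm_mul, Real.norm_ofNat]
  nlinarith [norm_nonneg c]

theorem norm_reflVec_le (w : Vec n) : ‖reflVec c w‖ ≤ (1 + 2 * ‖c‖) * ‖w‖ := by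
  refine (norm_sub_le _ _).trans ?_
  rw [norm_smul, norm_mul, Real.norm_ofNat, PiLp.norm_single, norm_one, mul_one]
  have := norm_inner_le_norm (𝕜 := ℝ) (liftVec c) w
  rw [norm_liftVec] at this
  nlinarith

theorem continuous_reflVec : Continuous (reflVec c) := by
  unfold reflVec; fun_prop

/-- A component of the transposed reflection is the pairing with one fixed vector. For this reason
the integration by parts at the flat boundary is stated for arbitrary directions κ. -/
theorem reflVec_apply (w : Vec n) (i : Fin n ⊕ Unit) :
    reflVec c w i = inner ℝ (EuclideanSpace.single i (1 : ℝ) -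
      (2 * (EuclideanSpace.single (Sum.inl (lastIdx n)) (1 : ℝ) : Vec n) i) • liftVec c) w := by
  rw [inner_sub_left, real_inner_smul_left, EuclideanSpace.inner_single_left]
  simp only [reflVec, PiLp.sub_apply, PiLp.smul_apply, smul_eq_mul, map_one, one_mul]
  ring

theorem classicalGrad_comp_reflPt {ψ : Pt n → ℝ} (hψ : ContDiff ℝ ∞ ψ) (X : Pt n) :
    classicalGrad (fun X => ψ (reflPt c X)) X = reflVec c (classicalGrad ψ (reflPt c X)) := by
  have h1 : fderiv ℝ (fun X => ψ (reflPt c X)) X = (fderiv ℝ ψ (reflPt c X)).comp (reflPt c) :=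
    ((hψ.differentiable (by simp) _).hasFDerivAt.comp X (reflPt c).hasFDerivAt).fderiv
  ext i
  rw [classicalGrad_apply, h1, ContinuousLinearMap.comp_apply, reflPt_apply c (Sum.elim _ _ i),
    map_sub, map_smul, reflVec, PiLp.sub_apply, PiLp.smul_apply, inner_classicalGrad, dirPt_liftVec,
    classicalGrad_apply]
  have hi : (Sum.elim (fun i => (EuclideanSpace.single i (1 : ℝ), (0 : ℝ)))
      (fun _ => (0, 1)) i : Pt n).1 (lastIdx n) =
        (EuclideanSpace.single (Sum.inl (lastIdx n)) (1 : ℝ) : Vec n) i := by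
    rcases i with i | i
    · by_cases hi : i = lastIdx n
      · simp [hi]
      · simp [hi, Ne.symm hi]
    · simp
  rw [hi, smul_eq_mul, smul_eq_mul]
  ring

variable {c}

theorem reflPt_fst_last (hc : c (lastIdx n) = 1) (X : Pt n) :
    (reflPt c X).1 (lastIdx n) = -X.1 (lastIdx n) := by
  rw [reflPt_fst]
  simp [hc]; ring

theorem reflPt_reflPt (hc : c (lastIdx n) = 1) (X : Pt n) : reflPt c (reflPt c X) = X := by
  rw [reflPt_apply c (reflPt c X), reflPt_fst_last hc, reflPt_apply, mul_neg, neg_smul]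
  abel

/-- A linear involution has determinant 1 or -1. It is an involution exactly because c is normalised
to have last coordinate 1. -/
theorem measurePreserving_reflPt (hc : c (lastIdx n) = 1) :
    MeasurePreserving (reflPt c) (volume : Measure (Pt n)) volume := by
  have hcomp : (reflPt c).toLinearMap ∘ₗ (reflPt c).toLinearMap = LinearMap.id := by
    ext1 <;> ext <;> simp [reflPt_reflPt hc]
  have hdet := congrArg LinearMap.det hcomp
  rw [LinearMap.det_comp, LinearMap.det_id] at hdet
  have hne : LinearMap.det (reflPt c).toLinearMap ≠ 0 := left_ne_zero_of_mul_eq_one hdet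
  refine ⟨(reflPt c).continuous.measurable, ?_⟩
  have h := Measure.map_linearMap_addHaar_eq_smul_addHaar (volume : Measure (Pt n)) hne
  have habs : |(LinearMap.det (reflPt c).toLinearMap)⁻¹| = 1 := by
    rw [abs_inv, inv_eq_one]
    rcases mul_self_eq_one_iff.1 hdet with h | h <;> rw [h] <;> simp
  rw [habs, ENNReal.ofReal_one, one_smul] at h
  exact h

theorem measurableEmbedding_reflPt (hc : c (lastIdx n) = 1) : MeasurableEmbedding (reflPt c) :=
  (MeasurableEquiv.ofInvolutive (reflPt c) (reflPt_reflPt hc)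
    (reflPt c).continuous.measurable).measurableEmbedding

theorem integral_comp_reflPt (hc : c (lastIdx n) = 1) (F : Pt n → ℝ) :
    ∫ X, F (reflPt c X) = ∫ X, F X :=
  (measurePreserving_reflPt hc).integral_comp (measurableEmbedding_reflPt hc) F

theorem integrable_comp_reflPt (hc : c (lastIdx n) = 1) {F : Type*} [NormedAddCommGroup F]
    {f : Pt n → F}
    (hf : Integrable f) : Integrable fun X => f (reflPt c X) :=
  ((measurePreserving_reflPt hc).integrable_comp_emb (measurableEmbedding_reflPt hc)).2 hf

theorem inner_liftVec_reflVec (hc : c (lastIdx n) = 1) (w : Vec n) :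
    inner ℝ (liftVec c) (reflVec c w) = -inner ℝ (liftVec c) w := by
  have : inner ℝ (liftVec c) (EuclideanSpace.single (Sum.inl (lastIdx n)) (1 : ℝ)) = 1 := by
    rw [EuclideanSpace.inner_single_right]
    simp [liftVec, hc]
  rw [reflVec, inner_sub_right, real_inner_smul_right, this]
  ring

theorem reflVec_reflVec (hc : c (lastIdx n) = 1) (w : Vec n) : reflVec c (reflVec c w) = w := by
  rw [reflVec, inner_liftVec_reflVec hc, reflVec, mul_neg, neg_smul]
  abel

/-- The coefficients are invariant under the reflection. -/
theorem form_reflVec (hc : c (lastIdx n) = 1) {B : Matrix (Fin n) (Fin n) ℝ} (hB : B.IsSymm)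
    (hBc : ∀ i, B i (lastIdx n) = B (lastIdx n) (lastIdx n) * c i) (w z : Vec n) :
    (Matrix.fromBlocks B 0 0 (Matrix.diagonal fun _ : Unit => (1 : ℝ)) *ᵥ (reflVec c w).ofLp) ⬝ᵥ
      (reflVec c z).ofLp =
    (Matrix.fromBlocks B 0 0 (Matrix.diagonal fun _ : Unit => (1 : ℝ)) *ᵥ w.ofLp) ⬝ᵥ z.ofLp := by
  set N := Matrix.fromBlocks B 0 0 (Matrix.diagonal fun _ : Unit => (1 : ℝ)) with hN
  set b := B (lastIdx n) (lastIdx n)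
  set e : Vec n := EuclideanSpace.single (Sum.inl (lastIdx n)) 1 with he
  have hNs : Nᵀ = N := by
    rw [hN, Matrix.fromBlocks_transpose, hB.eq]
    simp
  -- The choice of c is made for this identity. Each of the two cross terms of the expanded form
  -- equals -2b times the product of the pairings of w and z with (c, 0), and the term quadratic in
  -- e equals 4b times it, so they cancel.
  have hNe : N *ᵥ e.ofLp = b • (liftVec c).ofLp := by
    ext i
    rw [he]
    simp only [PiLp.ofLp_single, Matrix.mulVec_single_one, Matrix.col_apply,
      Pi.smul_apply, smul_eq_mul]
    rcases i with i | i
    · simp [hN, liftVec, hBc i, b]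
    · simp [hN, liftVec]
  have hin : ∀ u : Vec n, (liftVec c).ofLp ⬝ᵥ u.ofLp = inner ℝ (liftVec c) u := by
    intro u
    rw [EuclideanSpace.inner_eq_star_dotProduct, dotProduct_comm]
    rfl
  have hwe : ∀ u : Vec n, (N *ᵥ u.ofLp) ⬝ᵥ e.ofLp = b * inner ℝ (liftVec c) u := by
    intro u
    rw [dotProduct_comm, Matrix.dotProduct_mulVec, ← Matrix.mulVec_transpose, hNs, hNe,
      smul_dotProduct, hin, smul_eq_mul]
  have hce : inner ℝ (liftVec c) e = 1 := by
    rw [he, EuclideanSpace.inner_single_right]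
    simp [liftVec, hc]
  simp only [reflVec, ← he, WithLp.ofLp_sub, WithLp.ofLp_smul, Matrix.mulVec_sub,
    Matrix.mulVec_smul, sub_dotProduct, dotProduct_sub, smul_dotProduct, dotProduct_smul, hNe, hwe,
    hin, smul_eq_mul, hce]
  ring

end reflection

/-! ### The odd reflection as a weak solution -/

theorem blockCoeff_const_mulVec_dotProduct {n : ℕ} (μ : ℝ → ℝ) (B : Matrix (Fin n) (Fin n) ℝ)
    (y : ℝ) (w z : Fin n ⊕ Unit → ℝ) :
    (blockCoeff μ (fun _ => B) (fun _ => 1) y *ᵥ w) ⬝ᵥ z =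
      μ y * ((Matrix.fromBlocks B 0 0 (Matrix.diagonal fun _ : Unit => (1 : ℝ)) *ᵥ w) ⬝ᵥ z) := by
  rw [blockCoeff, Matrix.smul_mulVec, smul_dotProduct, smul_eq_mul]

theorem MemW12.integrableOn_weight_mul_form {n : ℕ} {μ : ℝ → ℝ} (hμ : IsA2Weight μ)
    {Ω : Set (EuclideanSpace ℝ (Fin n))} (hΩ : Bornology.IsBounded Ω) (hΩm : MeasurableSet Ω)
    {τ : ℝ} {v : Pt n → ℝ} {G : Pt n → Vec n} (h : MemW12 (cyl Ω τ) μ v G)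
    (N : Matrix (Fin n ⊕ Unit) (Fin n ⊕ Unit) ℝ) {H : Pt n → Vec n} (hH : Continuous H) :
    IntegrableOn (fun X => μ X.2 * ((N *ᵥ (G X).ofLp) ⬝ᵥ (H X).ofLp)) (cyl Ω τ) := by
  have hcm : MeasurableSet (cyl Ω τ) := hΩm.prod measurableSet_Ioo
  have hb : Bornology.IsBounded (cyl Ω τ) := hΩ.prod (Metric.isBounded_Ioo 0 τ)
  have hGm := h.hasWeakGrad.grad_locallyIntegrableOn.aestronglyMeasurable
  have h1 : ∀ j, IntegrableOn (fun X => μ X.2 * G X j) (cyl Ω τ) := by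
    intro j
    refine Integrable.mono' ((h.grad_memLp.integrableOn_sq_mul_weight hμ).add
      (hμ.integrableOn_cyl hΩ τ)) ((hμ.aemeasurable_snd _).aestronglyMeasurable.mul
      ((show Continuous fun w : Vec n => w j by fun_prop).comp_aestronglyMeasurable hGm))
      (Eventually.of_forall fun X => ?_)
    have h2 : ‖G X j‖ ≤ ‖G X‖ := PiLp.norm_apply_le _ _
    have h3 := hμ.nonneg X.2
    have h4 : ‖G X j‖ ≤ ‖G X‖ ^ 2 + 1 := by nlinarith [sq_nonneg (‖G X‖ - 1)]
    rw [norm_mul, Real.norm_of_nonneg h3, Pi.add_apply]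
    nlinarith
  have h2 : ∀ i j, IntegrableOn (fun X => μ X.2 * G X j * H X i) (cyl Ω τ) := fun i j =>
    (h1 j).mul_continuousOn_of_subset
      ((show Continuous fun w : Vec n => w i by fun_prop).comp hH).continuousOn hcm
      hb.isCompact_closure subset_closure
  have h3 : IntegrableOn (fun X => ∑ i, ∑ j, N i j * (μ X.2 * G X j * H X i)) (cyl Ω τ) :=
    integrable_finsetSum _ fun i _ => integrable_finsetSum _ fun j _ => (h2 i j).const_mul _
  refine h3.congr (Eventually.of_forall fun X => ?_)
  simp only [dotProduct, Matrix.mulVec, Finset.mul_sum, Finset.sum_mul]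
  exact Finset.sum_congr rfl fun i _ => Finset.sum_congr rfl fun j _ => by ring

/-- The odd reflection of a weak solution in the flat boundary is a weak solution. -/
theorem IsWeakSolutionHalfQ.localSol_reflect {n : ℕ} [NeZero n] {μ : ℝ → ℝ} (hμ : IsA2Weight μ)
    {τ : ℝ} (hτ : 0 < τ) {B : Matrix (Fin n) (Fin n) ℝ} (hB : B.IsSymm)
    {c : EuclideanSpace ℝ (Fin n)} (hc : c (lastIdx n) = 1)
    (hBc : ∀ i, B i (lastIdx n) = B (lastIdx n) (lastIdx n) * c i) {v : Pt n → ℝ} {G : Pt n → Vec n}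
    (h : IsWeakSolutionHalfQ τ μ (blockCoeff μ (fun _ => B) (fun _ => 1)) v G)
    {x₀ : EuclideanSpace ℝ (Fin n)} {r : ℝ} (hr : Metric.ball x₀ r ⊆ baseBall n τ)
    (hr' : ∀ X : Pt n, X.1 ∈ Metric.ball x₀ r → (reflPt c X).1 ∈ baseBall n τ) :
    LocalSol x₀ r τ μ (blockCoeff μ (fun _ => B) (fun _ => 1))
      (fun X => (cyl (halfBall n τ) τ).indicator v X -
        (cyl (halfBall n τ) τ).indicator v (reflPt c X))
      (fun X => (cyl (halfBall n τ) τ).indicator G X -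
        reflVec c ((cyl (halfBall n τ) τ).indicator G (reflPt c X))) := by
  set U := cyl (halfBall n τ) τ with hU
  set v₀ := U.indicator v with hv₀
  set G₀ := U.indicator G with hG₀
  obtain ⟨hcl, heq⟩ := h
  have hW := hcl.1
  have hUm : MeasurableSet U := (isOpen_halfBall n τ).measurableSet.prod measurableSet_Ioo
  obtain ⟨hvi, hGi⟩ := hW.integrableOn hμ (isBounded_halfBall n τ) hτ
  have hvi₀ : Integrable v₀ := (integrable_indicator_iff hUm).2 hvi
  have hGi₀ : Integrable G₀ := (integrable_indicator_iff hUm).2 hGi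
  have hGi₁ : Integrable fun X => reflVec c (G₀ (reflPt c X)) := by
    have h1 := integrable_comp_reflPt hc hGi₀
    refine Integrable.mono' (h1.norm.const_mul (1 + 2 * ‖c‖))
      ((continuous_reflVec c).comp_aestronglyMeasurable h1.aestronglyMeasurable)
      (Eventually.of_forall fun X => norm_reflVec_le c _)
  have hv2 : Integrable fun X => v₀ X ^ 2 * μ X.2 := by
    have := (integrable_indicator_iff hUm).2 (hW.memLp.integrableOn_sq_mul_weight hμ)
    refine this.congr (Eventually.of_forall fun X => ?_)
    by_cases hX : X ∈ U <;> simp [hv₀, hX]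
  have hG2 : Integrable fun X => ‖G₀ X‖ ^ 2 * μ X.2 := by
    have := (integrable_indicator_iff hUm).2 (hW.grad_memLp.integrableOn_sq_mul_weight hμ)
    refine this.congr (Eventually.of_forall fun X => ?_)
    by_cases hX : X ∈ U <;> simp [hG₀, hX]
  have hμm : AEStronglyMeasurable (fun X : Pt n => μ X.2) := by
    have := hμ.aemeasurable_snd (n := n) univ
    rw [Measure.restrict_univ] at this
    exact this.aestronglyMeasurable
  have hIpart : ∀ {ψ : Pt n → ℝ}, ContDiff ℝ ∞ ψ → HasCompactSupport ψ →
      tsupport ψ ⊆ baseBall n τ ×ˢ Ioo 0 τ → ∀ κ : Vec n,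
      ∫ X, v₀ X * inner ℝ κ (classicalGrad ψ X) = -∫ X, inner ℝ κ (G₀ X) * ψ X := by
    intro ψ hψ hψc hψs κ
    have := integral_mul_inner_classicalGrad_flat hμ hτ hcl hψ hψc hψs κ
    rw [← hU, ← integral_indicator hUm, ← integral_indicator hUm] at this
    have e1 : (U.indicator fun X => v X * inner ℝ κ (classicalGrad ψ X)) =
        fun X => v₀ X * inner ℝ κ (classicalGrad ψ X) := by
      ext X
      by_cases hX : X ∈ U <;> simp [hv₀, hX]
    have e2 : (U.indicator fun X => inner ℝ κ (G X) * ψ X) =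
        fun X => inner ℝ κ (G₀ X) * ψ X := by
      ext X
      by_cases hX : X ∈ U <;> simp [hG₀, hX]
    rwa [e1, e2] at this
  have hts : ∀ ψ : Pt n → ℝ, tsupport (fun X => ψ (reflPt c X)) ⊆ reflPt c ⁻¹' tsupport ψ :=
    fun ψ => tsupport_comp_subset_preimage ψ (reflPt c).continuous
  have hback : ∀ X : Pt n, (reflPt c X).1 ∈ Metric.ball x₀ r → X.1 ∈ baseBall n τ := by
    intro X hX
    have := hr' (reflPt c X) hX
    rwa [reflPt_reflPt hc] at this
  constructor
  · exact (hvi₀.sub (integrable_comp_reflPt hc hvi₀)).aestronglyMeasurable.restrict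
  · exact (hGi₀.sub hGi₁).aestronglyMeasurable.restrict
  · have h1 := integrable_comp_reflPt hc hv2
    simp only [reflPt_snd] at h1
    refine (Integrable.mono' ((hv2.const_mul 2).add (h1.const_mul 2))
      (((hvi₀.sub (integrable_comp_reflPt hc hvi₀)).aestronglyMeasurable.pow 2).mul hμm)
      (Eventually.of_forall fun X => ?_)).integrableOn
    have h3 := hμ.nonneg X.2
    simp only [Pi.add_apply, Pi.mul_apply, Pi.pow_apply, Pi.sub_apply]
    rw [Real.norm_of_nonneg (mul_nonneg (sq_nonneg _) h3)]
    nlinarith [mul_nonneg (sq_nonneg (v₀ X + v₀ (reflPt c X))) h3]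
  · have h1 := integrable_comp_reflPt hc hG2
    simp only [reflPt_snd] at h1
    refine (Integrable.mono' ((hG2.const_mul 2).add (h1.const_mul (2 * (1 + 2 * ‖c‖) ^ 2)))
      (((hGi₀.sub hGi₁).aestronglyMeasurable.norm.pow 2).mul hμm)
      (Eventually.of_forall fun X => ?_)).integrableOn
    have h3 := hμ.nonneg X.2
    simp only [Pi.add_apply, Pi.mul_apply, Pi.pow_apply, Pi.sub_apply]
    rw [Real.norm_of_nonneg (mul_nonneg (sq_nonneg _) h3)]
    have h4 : ‖G₀ X - reflVec c (G₀ (reflPt c X))‖ ^ 2 ≤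
        2 * ‖G₀ X‖ ^ 2 + 2 * ((1 + 2 * ‖c‖) * ‖G₀ (reflPt c X)‖) ^ 2 := by
      have h5 := (norm_sub_le (G₀ X) (reflVec c (G₀ (reflPt c X)))).trans
        (add_le_add_right (norm_reflVec_le c (G₀ (reflPt c X))) _)
      refine (pow_le_pow_left₀ (norm_nonneg _) h5 2).trans ?_
      nlinarith [sq_nonneg (‖G₀ X‖ - (1 + 2 * ‖c‖) * ‖G₀ (reflPt c X)‖)]
    calc _ ≤ _ := mul_le_mul_of_nonneg_right h4 h3
      _ = _ := by ring
  · intro φ hφ hφc hφs i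
    -- This is the direction representing the i-th component of `reflVec`. Integration by parts is
    -- used for φ in direction i and for φ composed with the reflection in direction κ. Neither
    -- function need vanish on the flat boundary; there the vanishing of v is what removes boundary
    -- terms.
    set κ : Vec n := EuclideanSpace.single i (1 : ℝ) -
      (2 * (EuclideanSpace.single (Sum.inl (lastIdx n)) (1 : ℝ) : Vec n) i) • liftVec c with hκ
    have hφ' : ContDiff ℝ ∞ fun X => φ (reflPt c X) := hφ.comp (reflPt c).contDiff
    have hφc' : HasCompactSupport fun X => φ (reflPt c X) :=
      hφc.comp_homeomorph ⟨⟨reflPt c, reflPt c, reflPt_reflPt hc, reflPt_reflPt hc⟩,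
        (reflPt c).continuous, (reflPt c).continuous⟩
    have hφs1 : tsupport φ ⊆ baseBall n τ ×ˢ Ioo 0 τ := hφs.trans (prod_mono hr le_rfl)
    have hφs2 : tsupport (fun X => φ (reflPt c X)) ⊆ baseBall n τ ×ˢ Ioo 0 τ := by
      intro X hX
      have h1 := hφs (hts φ hX)
      refine ⟨hback X h1.1, ?_⟩
      have := h1.2
      rwa [reflPt_snd] at this
    have E1 := hIpart hφ hφc hφs1 (EuclideanSpace.single i 1)
    have E2 := hIpart hφ' hφc' hφs2 κ
    simp only [EuclideanSpace.inner_single_left, map_one, one_mul] at E1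
    simp only [classicalGrad_comp_reflPt c hφ, hκ, ← reflVec_apply, reflVec_reflVec hc] at E2
    obtain ⟨K₁, hK₁⟩ := hφc.exists_bound_of_continuous hφ.continuous
    have hdc : Continuous fun X => classicalGrad φ X i :=
      (show Continuous fun w : Vec n => w i by fun_prop).comp (continuous_classicalGrad hφ)
    have hds : HasCompactSupport fun X => classicalGrad φ X i := by
      simp only [classicalGrad_apply]
      exact hφc.fderiv_apply ℝ _
    obtain ⟨K₂, hK₂⟩ := hds.exists_bound_of_continuous hdc
    have F1 := integral_comp_reflPt hc fun X => v₀ X * classicalGrad φ (reflPt c X) i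
    have F2 := integral_comp_reflPt hc fun X => reflVec c (G₀ X) i * φ (reflPt c X)
    simp only [reflPt_reflPt hc] at F1 F2
    have hcomp : ∀ {F : Pt n → Vec n}, Integrable F → Integrable fun X => F X i * φ X := fun hF =>
      (hF.eval_piLp i).mul_bdd (c := K₁) hφ.continuous.aestronglyMeasurable
        (Eventually.of_forall hK₁)
    have hcomp' : ∀ {f : Pt n → ℝ}, Integrable f → Integrable fun X => f X * classicalGrad φ X i :=
      fun hf => hf.mul_bdd (c := K₂) hdc.aestronglyMeasurable (Eventually.of_forall hK₂)
    rw [setIntegral_eq_integral_of_forall_compl_eq_zero,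
      setIntegral_eq_integral_of_forall_compl_eq_zero]
    · simp only [sub_mul, PiLp.sub_apply]
      rw [integral_sub (hcomp' hvi₀) (hcomp' (integrable_comp_reflPt hc hvi₀)),
        integral_sub (hcomp hGi₀) (hcomp hGi₁), F1, F2, E1, E2]
      ring
    · intro X hX
      rw [image_eq_zero_of_notMem_tsupport fun h => hX (hφs h), mul_zero]
    · intro X hX
      rw [classicalGrad_eq_zero fun h => hX (hφs h)]
      simp
  · intro ψ hψ hψs
    set N := Matrix.fromBlocks B 0 0 (Matrix.diagonal fun _ : Unit => (1 : ℝ)) with hN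
    have hψ' : ContDiff ℝ ∞ fun X => ψ (reflPt c X) := hψ.comp (reflPt c).contDiff
    -- The equation on the half cylinder is tested with the antisymmetric part of ψ, which vanishes
    -- on x_n = 0. The change of variables by the reflection and the invariance of the form then
    -- turn it into the equation of the odd extension tested with ψ.
    have hst : (fun X => ψ X - ψ (reflPt c X)) ∈ starTest (halfBall n τ) τ := by
      refine ⟨hψ.sub hψ', ?_⟩
      have hz : ∀ X : Pt n, (X.1 ∉ baseBall n τ ∨ X.2 = τ) → ψ X - ψ (reflPt c X) = 0 := by
        intro X hX
        have h1 : X ∉ tsupport ψ := fun ht => by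
          rcases hX with hX | hX
          · exact hX (hr (hψs ht).1)
          · exact (mem_Iio.1 (hψs ht).2).ne hX
        have h2 : reflPt c X ∉ tsupport ψ := fun ht => by
          rcases hX with hX | hX
          · exact hX (hback X (hψs ht).1)
          · have := (mem_Iio.1 (hψs ht).2).ne
            rw [reflPt_snd] at this
            exact this hX
        rw [image_eq_zero_of_notMem_tsupport h1, image_eq_zero_of_notMem_tsupport h2, sub_zero]
      rintro X (hX | hX)
      · by_cases hXn : X.1 (lastIdx n) = 0
        · simp only
          rw [reflPt_apply, hXn, mul_zero, zero_smul, sub_zero, sub_self]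
        · refine hz X (Or.inl fun hXb => ?_)
          have hfr := hX.1
          rw [(isOpen_halfBall n τ).frontier_eq] at hfr
          have hcl : X.1 ∈ {x : EuclideanSpace ℝ (Fin n) | 0 ≤ x (lastIdx n)} :=
            closure_minimal (fun x hx => le_of_lt hx.2) (isClosed_le continuous_const
              (show Continuous fun x : EuclideanSpace ℝ (Fin n) => x (lastIdx n) by fun_prop)) hfr.1
          exact hfr.2 ⟨hXb, lt_of_le_of_ne hcl (Ne.symm hXn)⟩
      · exact hz X (Or.inr hX.2)
    have hE := heq.smooth hμ (isBounded_halfBall n τ) (isOpen_halfBall n τ).measurableSet hst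
    simp only [blockCoeff_const_mulVec_dotProduct, ← hN, classicalGrad_sub hψ hψ', WithLp.ofLp_sub,
      dotProduct_sub] at hE ⊢
    have J : ∀ {H : Pt n → Vec n}, Continuous H →
        IntegrableOn (fun X => μ X.2 * ((N *ᵥ (G X).ofLp) ⬝ᵥ (H X).ofLp)) U ∧
        (∫ X in U, μ X.2 * ((N *ᵥ (G X).ofLp) ⬝ᵥ (H X).ofLp) =
          ∫ X, μ X.2 * ((N *ᵥ (G₀ X).ofLp) ⬝ᵥ (H X).ofLp)) ∧
        Integrable fun X => μ X.2 * ((N *ᵥ (G₀ X).ofLp) ⬝ᵥ (H X).ofLp) := by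
      intro H hH
      have e : (U.indicator fun X => μ X.2 * ((N *ᵥ (G X).ofLp) ⬝ᵥ (H X).ofLp)) =
          fun X => μ X.2 * ((N *ᵥ (G₀ X).ofLp) ⬝ᵥ (H X).ofLp) := by
        ext X
        by_cases hX : X ∈ U <;> simp [hG₀, hX]
      have hi := hW.integrableOn_weight_mul_form hμ (isBounded_halfBall n τ)
        (isOpen_halfBall n τ).measurableSet N hH
      rw [← e, integral_indicator hUm, integrable_indicator_iff hUm]
      exact ⟨hi, rfl, hi⟩
    have J1 := J (continuous_classicalGrad hψ)
    have J2 := J (continuous_classicalGrad hψ')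
    rw [integral_sub J1.1 J2.1, J1.2.1, J2.2.1] at hE
    have F := integral_comp_reflPt hc fun X =>
      μ X.2 * ((N *ᵥ (G₀ X).ofLp) ⬝ᵥ (classicalGrad (fun X => ψ (reflPt c X)) X).ofLp)
    have F' := integrable_comp_reflPt hc J2.2.2
    have e : ∀ X, μ (reflPt c X).2 * ((N *ᵥ (G₀ (reflPt c X)).ofLp) ⬝ᵥ
        (classicalGrad (fun X => ψ (reflPt c X)) (reflPt c X)).ofLp) =
        μ X.2 * ((N *ᵥ (reflVec c (G₀ (reflPt c X))).ofLp) ⬝ᵥ (classicalGrad ψ X).ofLp) := by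
      intro X
      rw [reflPt_snd, classicalGrad_comp_reflPt c hψ, reflPt_reflPt hc,
        ← form_reflVec hc hB hBc (G₀ (reflPt c X)), reflVec_reflVec hc]
    simp only [e] at F F'
    rw [setIntegral_eq_integral_of_forall_compl_eq_zero]
    · simp only [Matrix.mulVec_sub, sub_dotProduct, mul_sub]
      rw [integral_sub J1.2.2 F', F, hE]
    · intro X hX
      by_cases ht : X ∈ tsupport ψ
      -- The support of ψ may reach below y = 0. There both extended gradients are zero, since the
      -- reflection preserves y.
      · have h2 : X.2 ∉ Ioo 0 τ := fun h2 => hX ⟨(hψs ht).1, h2⟩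
        have h3 : G₀ X = 0 := indicator_of_notMem (fun h => h2 h.2) _
        have h4 : G₀ (reflPt c X) = 0 := indicator_of_notMem (fun h => h2 (by
          have := h.2
          rwa [reflPt_snd] at this)) _
        rw [h3, h4]
        simp [reflVec]
      · rw [classicalGrad_eq_zero ht]
        simp

/-- The conormal direction of the flat boundary, normalised and bounded by the ellipticity. -/
theorem IsDegElliptic.exists_conormal {n : ℕ} [NeZero n] {Λ τ : ℝ} (hΛ : 0 < Λ) (hτ : 0 < τ)
    {μ : ℝ → ℝ} (hμ : IsA2Weight μ) {B : Matrix (Fin n) (Fin n) ℝ}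
    (hA : IsDegElliptic τ Λ μ (blockCoeff μ (fun _ => B) (fun _ => 1))) :
    B.IsSymm ∧ ∃ c : EuclideanSpace ℝ (Fin n), c (lastIdx n) = 1 ∧
      (∀ i, B i (lastIdx n) = B (lastIdx n) (lastIdx n) * c i) ∧
      ‖c‖ ≤ (n + 1) * (2 * Λ ^ 2) := by
  have hne : (ae (volume.restrict (Ioo 0 τ))).NeBot := by
    rw [ae_neBot, Ne, Measure.restrict_eq_zero, Real.volume_Ioo]
    simpa using hτ
  -- B does not depend on y, so one height at which the ellipticity bounds hold and μ is positive
  -- yields everything about B, after division by μ(y).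
  obtain ⟨y, hform, hsymm, hpos⟩ := ((hA.form_bounds (blockCoeff_off_diag μ _ _)).and
    (hA.isSymm.and (ae_restrict_of_ae hμ.pos_ae))).exists
  have hBs : ∀ i j, B i j = B j i := by
    intro i j
    have := hsymm.apply (Sum.inl j) (Sum.inl i)
    simpa [blockCoeff, hpos.ne'] using this
  have habs : ∀ i j, |B i j| ≤ 2 * Λ := by
    intro i j
    have := abs_entry_le_of_form_bounds hΛ hpos (a := fun i j =>
      blockCoeff μ (fun _ => B) (fun _ => 1) y (Sum.inl i) (Sum.inl j))
      (fun i j => (hsymm.apply _ _)) hform i j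
    simp only [blockCoeff, Matrix.smul_apply, Matrix.fromBlocks_apply₁₁, smul_eq_mul, abs_mul,
      abs_of_pos hpos] at this
    rw [mul_comm] at this
    exact le_of_mul_le_mul_right this hpos
  have hlow : Λ⁻¹ ≤ B (lastIdx n) (lastIdx n) := by
    have := (hform (Pi.single (lastIdx n) 1) 0).1
    simp only [blockCoeff, Matrix.smul_apply, Matrix.fromBlocks_apply₁₁, smul_eq_mul,
      Pi.single_apply, mul_ite, mul_one, mul_zero, ite_pow, one_pow, ne_eq, OfNat.ofNat_ne_zero,
      not_false_eq_true, zero_pow, Finset.sum_ite_eq', Finset.mem_univ, if_true, add_zero] at this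
    rw [mul_comm] at this
    exact le_of_mul_le_mul_left this hpos
  have hb : 0 < B (lastIdx n) (lastIdx n) := (inv_pos.2 hΛ).trans_le hlow
  refine ⟨Matrix.IsSymm.ext fun i j => hBs j i, WithLp.toLp 2 fun i => B i (lastIdx n) / B (lastIdx n) (lastIdx n),
    div_self hb.ne', fun i => ?_, ?_⟩
  · simp only
    field_simp
  · rw [← norm_liftVec]
    refine norm_vec_le _ (by positivity) ?_
    rintro (i | i)
    · simp only [liftVec, Sum.elim_inl]
      rw [abs_div, abs_of_pos hb, div_le_iff₀ hb]
      -- An entry of size at most 2 Λ is divided by the diagonal entry, which is at least Λ⁻¹; hence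
      -- 2 Λ² for each coordinate of c.
      calc |B i (lastIdx n)| ≤ 2 * Λ := habs _ _
        _ = 2 * Λ ^ 2 * Λ⁻¹ := by field_simp
        _ ≤ _ := by gcongr
    · simp only [liftVec, Sum.elim_inr, Pi.zero_apply, abs_zero]
      positivity

/-- The reflection preserves volume and y, hence the weighted measure, and the transposed reflection
has norm at most 1 + 2‖c‖. The rest is (a + b)² ≤ 2 a² + 2 b². -/
theorem integral_reflect_sq_le {n : ℕ} [NeZero n] {μ : ℝ → ℝ} (hμ : IsA2Weight μ)
    {c : EuclideanSpace ℝ (Fin n)} (hc : c (lastIdx n) = 1) {U V : Set (Pt n)}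
    (hU : MeasurableSet U) {G : Pt n → Vec n}
    (hG : IntegrableOn (fun X => ‖G X‖ ^ 2 * μ X.2) U) :
    ∫ X in V, ‖U.indicator G X - reflVec c (U.indicator G (reflPt c X))‖ ^ 2 * μ X.2 ≤
      (2 + 2 * (1 + 2 * ‖c‖) ^ 2) * ∫ X in U, ‖G X‖ ^ 2 * μ X.2 := by
  have e : (U.indicator fun X => ‖G X‖ ^ 2 * μ X.2) = fun X => ‖U.indicator G X‖ ^ 2 * μ X.2 := by
    ext X
    by_cases hX : X ∈ U <;> simp [hX]
  have h0 : Integrable fun X => ‖U.indicator G X‖ ^ 2 * μ X.2 := by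
    rw [← e]; exact (integrable_indicator_iff hU).2 hG
  have h1 := integrable_comp_reflPt hc h0
  have h2 := integral_comp_reflPt hc fun X => ‖U.indicator G X‖ ^ 2 * μ X.2
  simp only [reflPt_snd] at h1 h2
  have h3 : ∀ X : Pt n,
      ‖U.indicator G X - reflVec c (U.indicator G (reflPt c X))‖ ^ 2 * μ X.2 ≤
      2 * (‖U.indicator G X‖ ^ 2 * μ X.2) +
        2 * (1 + 2 * ‖c‖) ^ 2 * (‖U.indicator G (reflPt c X)‖ ^ 2 * μ X.2) := by
    intro X
    have h5 := (norm_sub_le (U.indicator G X) (reflVec c (U.indicator G (reflPt c X)))).trans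
      (add_le_add_right (norm_reflVec_le c (U.indicator G (reflPt c X))) _)
    have h6 := pow_le_pow_left₀ (norm_nonneg _) h5 2
    have h7 := hμ.nonneg X.2
    calc _ ≤ (2 * ‖U.indicator G X‖ ^ 2 +
          2 * ((1 + 2 * ‖c‖) * ‖U.indicator G (reflPt c X)‖) ^ 2) * μ X.2 := by
          refine mul_le_mul_of_nonneg_right (h6.trans ?_) h7
          nlinarith [sq_nonneg (‖U.indicator G X‖ - (1 + 2 * ‖c‖) * ‖U.indicator G (reflPt c X)‖)]
      _ = _ := by ring
  have h4 := (h0.const_mul 2).fun_add (h1.const_mul (2 * (1 + 2 * ‖c‖) ^ 2))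
  have h7 : ∀ X : Pt n, 0 ≤ 2 * (‖U.indicator G X‖ ^ 2 * μ X.2) +
        2 * (1 + 2 * ‖c‖) ^ 2 * (‖U.indicator G (reflPt c X)‖ ^ 2 * μ X.2) := fun X => by
    have := hμ.nonneg X.2
    positivity
  calc _ ≤ ∫ X in V, (2 * (‖U.indicator G X‖ ^ 2 * μ X.2) +
        2 * (1 + 2 * ‖c‖) ^ 2 * (‖U.indicator G (reflPt c X)‖ ^ 2 * μ X.2)) :=
        integral_mono_of_nonneg
          (Eventually.of_forall fun X => mul_nonneg (sq_nonneg _) (hμ.nonneg _)) h4.integrableOn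
          (Eventually.of_forall h3)
    _ ≤ ∫ X, (2 * (‖U.indicator G X‖ ^ 2 * μ X.2) +
        2 * (1 + 2 * ‖c‖) ^ 2 * (‖U.indicator G (reflPt c X)‖ ^ 2 * μ X.2)) :=
        setIntegral_le_integral h4 (Eventually.of_forall h7)
    _ = _ := by
        rw [integral_add (h0.const_mul 2) (h1.const_mul _), integral_const_mul, integral_const_mul,
          h2, ← integral_indicator hU, e]
        ring

/-- The gradient estimate up to the bottom and the flat boundary. -/
theorem exists_gradient_bound_halfQ (n : ℕ) [NeZero n] {Λ C₀ θ : ℝ} (M₀ : ℝ) (hΛ : 0 < Λ)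
    (hC₀ : 0 < C₀) (hθ : θ ∈ Ioo (0 : ℝ) 1) :
    ∃ C : ℝ, 0 < C ∧
      ∀ (τ : ℝ) (μ : ℝ → ℝ) (B : Matrix (Fin n) (Fin n) ℝ),
        τ ∈ Ioo (0 : ℝ) 1 → IsA2Weight μ → a2Const μ ≤ ENNReal.ofReal M₀ → GrowthCond C₀ τ μ →
        IsDegElliptic τ Λ μ (blockCoeff μ (fun _ => B) (fun _ => 1)) →
        ∀ (v : Pt n → ℝ) (G : Pt n → Vec n),
          IsWeakSolutionHalfQ τ μ (blockCoeff μ (fun _ => B) (fun _ => 1)) v G →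
          eLpNorm G ⊤ (volume.restrict (cyl (halfBall n (θ * τ)) (θ * τ))) ≤
            ENNReal.ofReal (C * Real.sqrt ((1 / muHat μ (cyl (baseBall n τ) τ)) *
              ∫ X in cyl (halfBall n τ) τ, ‖G X‖ ^ 2 * μ X.2)) := by
  -- L bounds the Lipschitz constant 1 + 2‖c‖ of the reflection by the ellipticity alone. Near the
  -- flat part the radius is (1 - θ) τ / L, so that the reflected ball, too, remains in the ball of
  -- radius τ.
  set L : ℝ := 1 + 2 * ((n + 1) * (2 * Λ ^ 2)) with hL
  have hL1 : 1 ≤ L := by rw [hL]; linarith [show 0 ≤ 2 * (((n : ℝ) + 1) * (2 * Λ ^ 2)) by positivity]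
  have hθ' : 0 < 1 - θ := sub_pos.2 hθ.2
  obtain ⟨c₁, hc₁, hc₁ρ, C₁, hC₁, H₁⟩ := LocalSol.exists_gradient_bound n M₀
    (div_pos hθ' (one_pos.trans_le hL1)) hΛ hC₀ hθ.2
  obtain ⟨c₂, hc₂, -, C₂, hC₂, H₂⟩ := LocalSol.exists_gradient_bound n M₀
    (lt_min hc₁ hθ') hΛ hC₀ hθ.2
  refine ⟨C₁ * Real.sqrt (2 + 2 * L ^ 2) + C₂, by positivity, ?_⟩
  intro τ μ B hτ hμ hA2 hgr hA v G hsol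
  obtain ⟨hBs, c, hc, hBc, hcn⟩ := hA.exists_conormal hΛ hτ.1 hμ
  have hcL : 1 + 2 * ‖c‖ ≤ L := by rw [hL]; linarith
  set U := cyl (halfBall n τ) τ with hU
  have hUm : MeasurableSet U := (isOpen_halfBall n τ).measurableSet.prod measurableSet_Ioo
  set E := ∫ X in U, ‖G X‖ ^ 2 * μ X.2 with hE
  have hE0 : 0 ≤ E := integral_nonneg fun X => mul_nonneg (sq_nonneg _) (hμ.nonneg _)
  have hGi := hsol.1.1.grad_memLp.integrableOn_sq_mul_weight hμ
  set S := Real.sqrt (1 / muHat μ (cyl (baseBall n τ) τ) * E) with hS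
  have hS0 : 0 ≤ S := Real.sqrt_nonneg _
  rw [eLpNorm_exponent_top]
  refine eLpNormEssSup_le_of_ae_bound ?_
  have hVm : MeasurableSet (cyl (halfBall n (θ * τ)) (θ * τ)) :=
    (isOpen_halfBall n _).measurableSet.prod measurableSet_Ioo
  refine ae_restrict_of_locally hVm fun X hX => ?_
  have hX0 : dist X.1 0 < θ * τ := hX.1.1
  have hcoord : ∀ x : EuclideanSpace ℝ (Fin n), |x (lastIdx n)| ≤ ‖x‖ := fun x =>
    PiLp.norm_apply_le x (lastIdx n)
  by_cases hcase : X.1 (lastIdx n) < c₁ * τ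
  -- Near the flat boundary the estimate is centred at the orthogonal projection z of the point onto
  -- x_n = 0. It is no farther from the origin, and the point lies in the ball about z where the
  -- gradient of the odd extension is bounded.
  · set z : EuclideanSpace ℝ (Fin n) :=
      X.1 - X.1 (lastIdx n) • EuclideanSpace.single (lastIdx n) 1 with hz
    have hz0 : z (lastIdx n) = 0 := by simp [hz]
    have hzX : dist X.1 z < c₁ * τ := by
      rw [dist_eq_norm, hz, sub_sub_cancel, norm_smul, PiLp.norm_single, norm_one, mul_one,
        Real.norm_of_nonneg (le_of_lt hX.1.2)]
      exact hcase
    have hzn : ‖z‖ ≤ ‖X.1‖ := by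
      rw [EuclideanSpace.norm_eq, EuclideanSpace.norm_eq]
      refine Real.sqrt_le_sqrt (Finset.sum_le_sum fun i _ => ?_)
      by_cases hi : i = lastIdx n
      · rw [hi, hz0, norm_zero, zero_pow two_ne_zero]; exact sq_nonneg _
      · have : z i = X.1 i := by simp [hz, hi]
        rw [this]
    have hz1 : ‖z‖ < θ * τ := by
      rw [dist_zero_right] at hX0
      exact hzn.trans_lt hX0
    have hdiv : (1 - θ) / L * τ * L = (1 - θ) * τ := by field_simp
    have hle : (1 - θ) / L * τ ≤ (1 - θ) * τ := by
      have h1 : (1 - θ) / L ≤ 1 - θ := div_le_self hθ'.le hL1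
      exact mul_le_mul_of_nonneg_right h1 hτ.1.le
    have hr : Metric.ball z ((1 - θ) / L * τ) ⊆ baseBall n τ := by
      refine Metric.ball_subset_ball' ?_
      rw [dist_zero_right]
      linarith
    have hr' : ∀ X : Pt n, X.1 ∈ Metric.ball z ((1 - θ) / L * τ) →
        (reflPt c X).1 ∈ baseBall n τ := by
      intro Y hY
      have h1 := reflPt_fst_sub c hz0 Y
      rw [Metric.mem_ball, dist_eq_norm] at hY
      have h2 : (1 + 2 * ‖c‖) * ‖Y.1 - z‖ ≤ L * ((1 - θ) / L * τ) :=
        mul_le_mul hcL hY.le (norm_nonneg _) (by linarith)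
      rw [mul_comm L, hdiv] at h2
      rw [baseBall, Metric.mem_ball, dist_zero_right]
      calc ‖(reflPt c Y).1‖ = ‖((reflPt c Y).1 - z) + z‖ := by rw [sub_add_cancel]
        _ ≤ ‖(reflPt c Y).1 - z‖ + ‖z‖ := norm_add_le _ _
        _ < τ := by linarith
    have hloc := hsol.localSol_reflect hμ hτ.1 hBs hc hBc hr hr'
    have hEb := (integral_reflect_sq_le (V := Metric.ball z ((1 - θ) / L * τ) ×ˢ Ioo 0 τ)
      hμ hc hUm hGi).trans (mul_le_mul_of_nonneg_right (show 2 + 2 * (1 + 2 * ‖c‖) ^ 2 ≤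
        2 + 2 * L ^ 2 by gcongr) hE0)
    have hfin := H₁ hτ.1 hμ hA2 hgr hA (blockCoeff_off_diag μ _ _) hloc hEb
    refine ⟨Metric.ball z (c₁ * τ) ×ˢ univ, Metric.isOpen_ball.prod isOpen_univ,
      ⟨hzX, mem_univ _⟩, ?_⟩
    have hsub : Metric.ball z (c₁ * τ) ×ˢ univ ∩ cyl (halfBall n (θ * τ)) (θ * τ) ⊆
      Metric.ball z (c₁ * τ) ×ˢ Ioo 0 (θ * τ) := fun Z hZ => ⟨hZ.1.1, hZ.2.2⟩
    filter_upwards [ae_mono (Measure.restrict_mono hsub le_rfl) hfin,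
      ae_restrict_mem ((Metric.isOpen_ball.prod isOpen_univ).measurableSet.inter hVm)] with Y hY hYm
    have hτθ : θ * τ ≤ τ := mul_le_of_le_one_left hτ.1.le hθ.2.le
    have hYU : Y ∈ U := ⟨⟨Metric.ball_subset_ball hτθ hYm.2.1.1, hYm.2.1.2⟩,
      ⟨hYm.2.2.1, hYm.2.2.2.trans_le hτθ⟩⟩
    -- On the half space x_n > 0 the reflected copy contributes nothing, so the gradient of the odd
    -- extension is G itself.
    have hYU' : reflPt c Y ∉ U := fun h => by
      have h1 := h.1.2
      rw [reflPt_fst_last hc] at h1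
      linarith [hYm.2.1.2]
    rw [indicator_of_mem hYU, indicator_of_notMem hYU'] at hY
    have hr0 : reflVec c 0 = 0 := by simp [reflVec]
    rw [hr0, sub_zero] at hY
    refine hY.trans ?_
    have e : 1 / muHat μ (cyl (baseBall n τ) τ) * ((2 + 2 * L ^ 2) * E) =
        (2 + 2 * L ^ 2) * (1 / muHat μ (cyl (baseBall n τ) τ) * E) := by ring
    rw [e, Real.sqrt_mul (by positivity), ← hS, ← mul_assoc, add_mul]
    exact le_add_of_nonneg_right (by positivity)
  · rw [not_lt] at hcase
    -- Here x_n ≥ c₁ τ, so a ball of radius at most c₁ τ does not reach the flat boundary and the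
    -- interior estimate applies to v directly. The second constant depends on c₁, which is fixed
    -- beforehand.
    have hsub : Metric.ball X.1 (min c₁ (1 - θ) * τ) ⊆ halfBall n τ := by
      intro x hx
      rw [Metric.mem_ball] at hx
      have h1 : min c₁ (1 - θ) * τ ≤ c₁ * τ := mul_le_mul_of_nonneg_right (min_le_left _ _) hτ.1.le
      have h2 : min c₁ (1 - θ) * τ ≤ (1 - θ) * τ :=
        mul_le_mul_of_nonneg_right (min_le_right _ _) hτ.1.le
      refine ⟨?_, ?_⟩
      · rw [baseBall, Metric.mem_ball]
        linarith [dist_triangle x X.1 0]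
      · have h3 := hcoord (x - X.1)
        rw [← dist_eq_norm, PiLp.sub_apply] at h3
        have h4 := neg_abs_le (x (lastIdx n) - X.1 (lastIdx n))
        linarith
    have hloc := hsol.1.1.localSol hμ (isBounded_halfBall n τ) (isOpen_halfBall n τ) hsol.2 hsub
    have hfin := H₂ hτ.1 hμ hA2 hgr hA (blockCoeff_off_diag μ _ _) hloc (setIntegral_mono_set hGi
      (Eventually.of_forall fun X => mul_nonneg (sq_nonneg _) (hμ.nonneg _))
      (prod_mono hsub le_rfl).eventuallyLE)
    refine ⟨Metric.ball X.1 (c₂ * τ) ×ˢ univ, Metric.isOpen_ball.prod isOpen_univ,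
      ⟨Metric.mem_ball_self (mul_pos hc₂ hτ.1), mem_univ _⟩, ?_⟩
    have hsub' : Metric.ball X.1 (c₂ * τ) ×ˢ univ ∩ cyl (halfBall n (θ * τ)) (θ * τ) ⊆
      Metric.ball X.1 (c₂ * τ) ×ˢ Ioo 0 (θ * τ) := fun Z hZ => ⟨hZ.1.1, hZ.2.2⟩
    filter_upwards [ae_mono (Measure.restrict_mono hsub' le_rfl) hfin] with Y hY
    refine hY.trans ?_
    rw [← hE, ← hS, add_mul]
    exact le_add_of_nonneg_left (by positivity)

theorem mainTheorem5 (n : ℕ) [NeZero n] (Λ C₀ M₀ θ : ℝ) (hΛ : 0 < Λ) (hC₀ : 0 < C₀)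
    (hθ : θ ∈ Set.Ioo (0 : ℝ) 1) :
    (∃ C : ℝ, 0 < C ∧
      ∀ (τ : ℝ) (μ : ℝ → ℝ) (B : ℝ → Matrix (Fin n) (Fin n) ℝ) (b : ℝ → ℝ),
        τ ∈ Set.Ioo (0 : ℝ) 1 →
        IsA2Weight μ → a2Const μ ≤ ENNReal.ofReal M₀ →
        GrowthCond C₀ τ μ →
        IsDegElliptic τ Λ μ (blockCoeff μ B b) →
        ∀ (v : Pt n → ℝ) (G : Pt n → Vec n),
          IsWeakSolutionQ τ μ (blockCoeff μ B b) v G →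
          eLpNorm G ⊤ (volume.restrict (cyl (baseBall n (θ * τ)) (θ * τ))) ≤
            ENNReal.ofReal (C * Real.sqrt ((1 / muHat μ (cyl (baseBall n τ) τ)) *
              ∫ X in cyl (baseBall n τ) τ, ‖G X‖ ^ 2 * μ X.2))) ∧
    (∃ C : ℝ, 0 < C ∧
      ∀ (τ : ℝ) (μ : ℝ → ℝ) (B : Matrix (Fin n) (Fin n) ℝ),
        τ ∈ Set.Ioo (0 : ℝ) 1 →
        IsA2Weight μ → a2Const μ ≤ ENNReal.ofReal M₀ →
        GrowthCond C₀ τ μ →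
        IsDegElliptic τ Λ μ (blockCoeff μ (fun _ => B) (fun _ => 1)) →
        ∀ (v : Pt n → ℝ) (G : Pt n → Vec n),
          IsWeakSolutionHalfQ τ μ (blockCoeff μ (fun _ => B) (fun _ => 1)) v G →
          eLpNorm G ⊤ (volume.restrict (cyl (halfBall n (θ * τ)) (θ * τ))) ≤
            ENNReal.ofReal (C * Real.sqrt ((1 / muHat μ (cyl (baseBall n τ) τ)) *
              ∫ X in cyl (halfBall n τ) τ, ‖G X‖ ^ 2 * μ X.2))) := by
  exact ⟨exists_gradient_bound_Q n M₀ hΛ hC₀ hθ, exists_gradient_bound_halfQ n M₀ hΛ hC₀ hθ⟩
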